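/- Let $n,k$ be integers with $1\le k<n$, let $s\in(1/2,1)$, and write points of $\mathbb R^n$ as $x=(y,z)$ with $y\in\mathbb R^k$, $z\in\mathbb R^{n-k}$. Let $\mathcal K_k^s$ be the set of measurable $K:\mathbb R^n\to[0,\infty)$ such that, for all $z\in\mathbb R^{n-k}$ and $r>0$, the set $\{y\in\mathbb R^k: K(y,z)>r^{-n-2s}\}$ has the same $k$-dimensional Lebesgue measure as a ball of radius $(r^2-|z|^2)^{1/2}$ in $\mathbb R^k$ if $|z|<r$, and measure $0$ if $|z|\ge r$. For a continuous convex $u:\mathbb R^n\to\mathbb R$ let $\partial u(x_0)$ be the set of $p\in\mathbb R^n$ with $u(x)\ge u(x_0)+(x-x_0)\cdot p$ for all $x\in\mathbb R^n$, and put $$ \mathcal F_k^s u(x_0)=c_{n,s}\sup_{p\in\partial u(x_0)}\ \inf_{K\in\mathcal K_k^s}\int_{\mathbb R^n}\big(u(x_0+x)-u(x_0)-x\cdot p\big)K(x)\,dx\ \in[0,\infty], $$ where $c_{n,s}=\dfrac{4^s\,\Gamma(n/2+s)}{\pi^{n/2}\,|\Gamma(-s)|}$ is the normalizing constant of the fractional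 Laplacian. For a function $u$ in $C^{1,1}(\mathbb R^n)$, that is, differentiable with globally Lipschitz gradient, let $[u]_{C^{1,1}(\mathbb R^n)}$ denote the least Lipschitz constant of $\nabla u$. Let $\varphi:\mathbb R^n\to\mathbb R$ be nonnegative, smooth and strictly convex, with $\varphi\in C^{1,1}(\mathbb R^n)$, and asymptotic at infinity to a cone, i.e. there is a continuous $\phi:\mathbb R^n\to\mathbb R$ with $\phi(tx)=t\phi(x)$ for all $t>0$ and $x\in\mathbb R^n$, such that $(\varphi-\phi)(x)\to0$ as $|x|\to\infty$. Then there exists exactly one continuous convex function $u:\mathbb R^n\to\mathbb R$ such that $$ \mathcal F_k^s u(x)=u(x)-\varphi(x)\quad\text{for all }x\in\mathbb R^n,\qquad (u-\varphi)(x)\to0\quad\text{as }|x|\to\infty . $$ Moreover, $u\in C^{1,1}(\mathbb R^n)$ and $[u]_{C^{1,1}(\mathbb R^n)}\le[\varphi]_{C^{1,1}(\mathbb R^n)}$. -/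

import Mathlib

open Set Filter Topology MeasureTheory
open scoped NNReal ENNReal

noncomputable section

/-- The point `(y, z) ∈ ℝⁿ` with first `k` coordinates `y` and last `n - k` coordinates `z`. -/
def joinCoords {n k : ℕ} (y : EuclideanSpace ℝ (Fin k)) (z : EuclideanSpace ℝ (Fin (n - k))) :
    EuclideanSpace ℝ (Fin n) :=
  WithLp.toLp 2 fun i =>
    if h : i.val < k then y ⟨i.val, h⟩
    else z ⟨i.val - k, by have := i.isLt; omega⟩

/-- The class `𝒦_k^s` of admissible kernels: measurable `K : ℝⁿ → [0, ∞)` such that for every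
`z ∈ ℝ^{n-k}` and every `r > 0` the set `{y ∈ ℝᵏ : K (y, z) > r^{-n-2s}}` has the `k`-dimensional
measure of the ball of `ℝᵏ` of radius `(r² - |z|²)^{1/2}` if `|z| < r`, and measure zero
otherwise. (On `ℝᵏ`, `k`-dimensional Hausdorff measure is Lebesgue measure `volume`.) -/
def admissibleKernels (n k : ℕ) (s : ℝ) : Set (EuclideanSpace ℝ (Fin n) → ℝ≥0) :=
  {K | Measurable K ∧
    ∀ (z : EuclideanSpace ℝ (Fin (n - k))) (r : ℝ), 0 < r →
      volume {y : EuclideanSpace ℝ (Fin k) | r ^ (-(n : ℝ) - 2 * s) < (K (joinCoords y z) : ℝ)} =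
        if ‖z‖ < r then
          volume (Metric.ball (0 : EuclideanSpace ℝ (Fin k)) (Real.sqrt (r ^ 2 - ‖z‖ ^ 2)))
        else 0}

/-- The normalizing constant of the fractional Laplacian `Δ^s = -(-Δ)^s` on `ℝⁿ`,
`c_{n,s} = 4^s Γ(n/2 + s) / (π^{n/2} |Γ(-s)|)`, where `|Γ(-s)| = Γ(1 - s) / s`. -/
def fracLaplacianConst (n : ℕ) (s : ℝ) : ℝ :=
  (4 : ℝ) ^ s * s * Real.Gamma ((n : ℝ) / 2 + s) /
    (Real.pi ^ ((n : ℝ) / 2) * Real.Gamma (1 - s))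

/-- The subdifferential of `u` at `x`: the slopes `p` of the affine functions `y ↦ y · p + b` that
equal `u` at `x` and lie below `u` everywhere. -/
def subdifferentialAt {n : ℕ} (u : EuclideanSpace ℝ (Fin n) → ℝ) (x : EuclideanSpace ℝ (Fin n)) :
    Set (EuclideanSpace ℝ (Fin n)) :=
  {p | ∃ b : ℝ, inner ℝ x p + b = u x ∧ ∀ y, inner ℝ y p + b ≤ u y}

/-- For a continuous convex `u`, the value
`F_k^s u (x₀) = c_{n,s} sup_{p ∈ ∂u(x₀)} inf_{K ∈ 𝒦_k^s} ∫ (u (x₀ + x) - u x₀ - x · p) K x dx`.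
It lies in `[0, ∞]`: as `p` is a subgradient, `u (x₀ + x) - u x₀ - x · p ≥ 0` for all `x`, so
`ENNReal.ofReal` truncates nothing and the integral is that of a nonnegative function. -/
def nonlocalOp {n : ℕ} (k : ℕ) (s : ℝ) (u : EuclideanSpace ℝ (Fin n) → ℝ)
    (x₀ : EuclideanSpace ℝ (Fin n)) : ℝ≥0∞ :=
  ENNReal.ofReal (fracLaplacianConst n s) *
    ⨆ p ∈ subdifferentialAt u x₀, ⨅ K ∈ admissibleKernels n k s,
      ∫⁻ x, ENNReal.ofReal (u (x₀ + x) - u x₀ - inner ℝ x p) * (K x : ℝ≥0∞)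

/-- `u` is a (continuous, convex) subsolution of `F_k^s u = u - φ` in `ℝⁿ`. -/
def IsSubsolution {n : ℕ} (k : ℕ) (s : ℝ) (φ u : EuclideanSpace ℝ (Fin n) → ℝ) : Prop :=
  Continuous u ∧ ConvexOn ℝ univ u ∧
    ∀ x₀, ((u x₀ - φ x₀ : ℝ) : EReal) ≤ (nonlocalOp k s u x₀ : EReal)

/-- `u` is a (continuous, convex) supersolution of `F_k^s u = u - φ` in `ℝⁿ`. -/
def IsSupersolution {n : ℕ} (k : ℕ) (s : ℝ) (φ u : EuclideanSpace ℝ (Fin n) → ℝ) : Prop :=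
  Continuous u ∧ ConvexOn ℝ univ u ∧
    ∀ x₀, (nonlocalOp k s u x₀ : EReal) ≤ ((u x₀ - φ x₀ : ℝ) : EReal)

/-- `u` solves the global Poisson problem: `F_k^s u = u - φ` in `ℝⁿ`, and `u - φ → 0` at
infinity. -/
def IsPoissonSolution {n : ℕ} (k : ℕ) (s : ℝ) (φ u : EuclideanSpace ℝ (Fin n) → ℝ) : Prop :=
  IsSubsolution k s φ u ∧ IsSupersolution k s φ u ∧
    Tendsto (fun x => u x - φ x) (Bornology.cobounded (EuclideanSpace ℝ (Fin n))) (𝓝 0)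

/-- A cone (with vertex at the origin): a continuous function, positively homogeneous of
degree one. -/
def IsCone {n : ℕ} (ψ : EuclideanSpace ℝ (Fin n) → ℝ) : Prop :=
  Continuous ψ ∧ ∀ (t : ℝ) (x : EuclideanSpace ℝ (Fin n)), 0 < t → ψ (t • x) = t * ψ x

/-- `u ∈ C^{1,1}(ℝⁿ)`: `u` is differentiable with globally Lipschitz gradient. -/
def IsC11 {n : ℕ} (u : EuclideanSpace ℝ (Fin n) → ℝ) : Prop :=
  Differentiable ℝ u ∧ ∃ L : ℝ≥0, LipschitzWith L (gradient u)

/-- `[u]_{C^{1,1}(ℝⁿ)}`: the least Lipschitz constant of the gradient of `u`. -/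
def c11Seminorm {n : ℕ} (u : EuclideanSpace ℝ (Fin n) → ℝ) : ℝ≥0∞ :=
  ⨅ (L : ℝ≥0) (_ : LipschitzWith L (gradient u)), (L : ℝ≥0∞)

end

/-!
# A Poisson problem for a nonlocal Monge–Ampère type operator

The solution is Perron's: the supremum `u` of all convex subsolutions `v` with `limsup (v - φ) ≤
0` at infinity (`perronSolution`).

*Comparison and uniqueness.* The operator at `x` is monotone when one function touches another
from below at `x` (`nonlocalOp_mono_of_touch`). At a positive maximum of `v - u`, with `v` a
subsolution and `u` a supersolution, this contradicts the two equations
(`IsSubsolution.le_of_isSupersolution`).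

*Asymptotics.* The infimum over kernels is at most the integral against the kernel `|x| ^ (-n - 2
s)` of the fractional Laplacian, and for a `C^{1,1}` function asymptotic to a cone that integral
tends to `0` at infinity (`tendsto_fracEnergy`). Hence `φ` plus a function small at infinity is a
barrier from above for all subsolutions (`exists_barrier`), while `φ` itself is a subsolution.

*Regularity.* An infimum of linear functionals is concave, so half the sum of two translates of
subsolutions, lowered by `L |h|² / 2`, is again a subsolution when the second differences of `φ`
are at most `L |h|²`. The supremum `u` thus inherits this bound (`second_perronSolution`), which
for convex functions says that the gradient is `L`-Lipschitz.

*Subsolution.* The operator is semicontinuous along affine gaps `u (x + h) - u x - h · p` which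
grow linearly in `h` (`exists_kernelInf_le_add`). The gaps of `u` do: `u ≥ φ`, `φ` is strictly
convex and `u - φ → 0`, so `u` is affine on no ray (`exists_coercive`). Subsolutions almost
attaining `u` at a point are touched from above nearby by small perturbations of `u`, and
semicontinuity passes their inequality to `u` (`isSubsolution_perronSolution`).

*Supersolution.* Suppose the operator at `x₀` exceeds `u - φ`, and let `D` be the compact convex
set on which `u` agrees with its tangent plane at `x₀`. If `D` is not a point, `u` cannot simply
be raised near `x₀`. However, along `D` the value of the operator is convex: on each slice `{z =
const}` an optimal kernel for a gap is a rearrangement with the same sublevel sets, and the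
Brunn–Minkowski inequality, in the midpoint form of Prékopa and Leindler, gives
`two_mul_kernelInf_le`. Since `u` is affine on `D` and `φ` is strictly convex, the defect is
strictly convex on `D` and attains its maximum at an extreme point `e`
(`exists_extremePoint_max`). Extreme points lie in arbitrarily small slices of `D`, so a slightly
tilted plane exceeds `u` only near `e` (`exists_affine_cap`). The maximum of `u` and that plane is
a larger member of the class, which is a contradiction (`isSupersolution_perronSolution`).
-/

/-! ### The midpoint form of the Prékopa–Leindler inequality -/

theorem volume_setOf_pos_ofReal_lt (c : ℝ≥0∞) :
    volume {t : ℝ | 0 < t ∧ ENNReal.ofReal t < c} = c := by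
  rcases eq_or_ne c ⊤ with rfl | hc
  · have : {t : ℝ | 0 < t ∧ ENNReal.ofReal t < ⊤} = Ioi 0 := by ext; simp
    rw [this, Real.volume_Ioi]
  · have : {t : ℝ | 0 < t ∧ ENNReal.ofReal t < c} = Ioo 0 c.toReal := by
      ext t
      simp only [mem_ofPred_eq, mem_Ioo]
      refine and_congr_right fun ht => ?_
      rw [ENNReal.ofReal_lt_iff_lt_toReal ht.le hc]
    rw [this, Real.volume_Ioo, sub_zero, ENNReal.ofReal_toReal hc]

/-- The layer cake formula for functions with values in `[0, ∞]`. -/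
theorem lintegral_eq_lintegral_Ioi_measure_lt {α : Type*} [MeasurableSpace α] (μ : Measure α)
    [SFinite μ] {f : α → ℝ≥0∞} (hf : Measurable f) :
    ∫⁻ x, f x ∂μ = ∫⁻ t in Ioi (0 : ℝ), μ {x | ENNReal.ofReal t < f x} := by
  have hS : MeasurableSet {p : α × ℝ | 0 < p.2 ∧ ENNReal.ofReal p.2 < f p.1} :=
    (measurableSet_lt measurable_const measurable_snd).inter
      (measurableSet_lt (by fun_prop) (hf.comp measurable_fst))
  have h1 := Measure.prod_apply (μ := μ) (ν := (volume : Measure ℝ)) hS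
  have h2 := Measure.prod_apply_symm (μ := μ) (ν := (volume : Measure ℝ)) hS
  calc ∫⁻ x, f x ∂μ = ∫⁻ x, volume {t : ℝ | 0 < t ∧ ENNReal.ofReal t < f x} ∂μ := by
        simp_rw [volume_setOf_pos_ofReal_lt]
    _ = ∫⁻ t, μ {x | 0 < t ∧ ENNReal.ofReal t < f x} := h1.symm.trans h2
    _ = ∫⁻ t in Ioi (0 : ℝ), μ {x | ENNReal.ofReal t < f x} := by
        rw [← lintegral_indicator measurableSet_Ioi]
        refine lintegral_congr fun t => ?_
        by_cases ht : 0 < t <;> simp [ht]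

theorem IsCompact.volume_add_volume_le_of_midpoint {A B C : Set ℝ} (hA : A.Nonempty)
    (hB : B.Nonempty) (cA : IsCompact A) (cB : IsCompact B)
    (h : ∀ a ∈ A, ∀ b ∈ B, (2⁻¹ : ℝ) * (a + b) ∈ C) :
    volume A + volume B ≤ 2 * volume C := by
  have ha := cA.sSup_mem hA
  have hb := cB.sInf_mem hB
  set a := sSup A
  set b := sInf B
  set C' : Set ℝ := (fun x => (2⁻¹ : ℝ) * x) ⁻¹' C with hC'
  have hvol : volume C' = 2 * volume C := by
    rw [hC', Real.volume_preimage_mul_left (by norm_num)]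
    norm_num
  rw [← hvol, ← measure_inter_add_sdiff C' (measurableSet_Iio (a := a + b))]
  have hAe : volume A = volume ((fun x => x - b) ⁻¹' (A) \ {a + b}) := by
    rw [measure_sdiff_null (by simp)]
    simp_rw [sub_eq_add_neg]
    rw [measure_preimage_add_right]
  have hBe : volume B = volume ((fun x => x - a) ⁻¹' B) := by
    simp_rw [sub_eq_add_neg]
    rw [measure_preimage_add_right]
  rw [hAe, hBe]
  refine add_le_add (measure_mono ?_) (measure_mono ?_)
  · rintro x ⟨hx, hne⟩
    have hx' : x - b ∈ A := hx
    have hle := le_csSup cA.bddAbove hx'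
    have hmem := h _ hx' _ hb
    rw [sub_add_cancel] at hmem
    exact ⟨hmem, lt_of_le_of_ne (by change x - b ≤ a at hle; linarith) hne⟩
  · intro x hx
    have hx' : x - a ∈ B := hx
    have hle := csInf_le cB.bddBelow hx'
    have hmem := h _ ha _ hx'
    rw [add_sub_cancel] at hmem
    exact ⟨hmem, by change b ≤ x - a at hle; simp; linarith⟩

theorem exists_isCompact_nonempty_lt_volume {A : Set ℝ} (hA : A.Nonempty) (mA : MeasurableSet A)
    {r : ℝ≥0∞} (hr : r < volume A) : ∃ K ⊆ A, K.Nonempty ∧ IsCompact K ∧ r < volume K := by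
  obtain ⟨K, hK, cK, hrK⟩ := mA.exists_lt_isCompact hr
  obtain ⟨a, ha⟩ := hA
  exact ⟨insert a K, insert_subset ha hK, insert_nonempty _ _, cK.insert a,
    hrK.trans_le (measure_mono (subset_insert _ _))⟩

/-- The Brunn–Minkowski inequality on the line. -/
theorem Real.volume_add_volume_le_of_midpoint {A B C : Set ℝ} (hA : A.Nonempty)
    (hB : B.Nonempty) (mA : MeasurableSet A) (mB : MeasurableSet B)
    (h : ∀ a ∈ A, ∀ b ∈ B, (2⁻¹ : ℝ) * (a + b) ∈ C) :
    volume A + volume B ≤ 2 * volume C := by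
  have key : ∀ A' ⊆ A, A'.Nonempty → IsCompact A' → volume A' + volume B ≤ 2 * volume C := by
    intro A' hA' nA' cA'
    rcases eq_or_ne (volume B) 0 with h0 | h0
    · obtain ⟨b, hb⟩ := hB
      have := cA'.volume_add_volume_le_of_midpoint nA' (singleton_nonempty b)
        isCompact_singleton (C := C) (by rintro a ha _ rfl; exact h a (hA' ha) _ hb)
      simpa [h0] using this
    · obtain ⟨b, hb⟩ := hB
      have h1 := cA'.volume_add_volume_le_of_midpoint nA' (singleton_nonempty b)
        isCompact_singleton (C := C) (by rintro a ha _ rfl; exact h a (hA' ha) _ hb)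
      refine add_le_of_le_tsub_left_of_le (by simpa using h1) (le_of_forall_lt fun c hc => ?_)
      obtain ⟨B', hB', nB', cB', hlt⟩ := exists_isCompact_nonempty_lt_volume ⟨b, hb⟩ mB hc
      exact hlt.trans_le (ENNReal.le_sub_of_add_le_left cA'.measure_lt_top.ne
        (cA'.volume_add_volume_le_of_midpoint nA' nB' cB' fun a ha b hb =>
          h a (hA' ha) b (hB' hb)))
  by_cases hBt : volume B = ⊤
  · obtain ⟨a, ha⟩ := hA
    have h1 := key {a} (singleton_subset_iff.2 ha) (singleton_nonempty a) isCompact_singleton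
    rw [hBt] at h1 ⊢
    simpa using h1
  · obtain ⟨a, ha⟩ := id hA
    have h1 := key {a} (singleton_subset_iff.2 ha) (singleton_nonempty a) isCompact_singleton
    refine add_le_of_le_tsub_right_of_le (by simpa using h1) (le_of_forall_lt fun c hc => ?_)
    obtain ⟨A', hA', nA', cA', hlt⟩ := exists_isCompact_nonempty_lt_volume hA mA hc
    exact hlt.trans_le (ENNReal.le_sub_of_add_le_right hBt (key A' hA' nA' cA'))

theorem ENNReal.mul_le_sq_of_add_le {a b c : ℝ≥0∞} (h : a + b ≤ 2 * c) : a * b ≤ c ^ 2 := by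
  rcases eq_or_ne c ⊤ with rfl | hc
  · simp
  have hab : a + b ≠ ⊤ := ne_top_of_le_ne_top (ENNReal.mul_ne_top (by simp) hc) h
  lift a to ℝ≥0 using (ENNReal.add_ne_top.1 hab).1
  lift b to ℝ≥0 using (ENNReal.add_ne_top.1 hab).2
  lift c to ℝ≥0 using hc
  norm_cast at *
  have h' : (a : ℝ) + b ≤ 2 * c := by exact_mod_cast h
  have : (a : ℝ) * b ≤ c ^ 2 := by
    nlinarith [sq_nonneg ((a : ℝ) - b), a.2, b.2, c.2]
  exact_mod_cast this

/-- Prékopa–Leindler inequality at the midpoint, as a property of a measure space. -/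
def HasMidpointPrekopaLeindler (α : Type*) [AddCommGroup α] [Module ℝ α] [MeasureSpace α] : Prop :=
  ∀ f g h : α → ℝ≥0∞, Measurable f → Measurable g → Measurable h →
    (∀ x y, f x * g y ≤ h ((2⁻¹ : ℝ) • (x + y)) ^ 2) →
    (∫⁻ x, f x) * (∫⁻ x, g x) ≤ (∫⁻ x, h x) ^ 2

theorem lintegral_mul_lintegral_le_of_iSup_eq_one {f g h : ℝ → ℝ≥0∞} (hf : Measurable f)
    (hg : Measurable g) (hh : Measurable h) (hf1 : ⨆ x, f x = 1) (hg1 : ⨆ x, g x = 1)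
    (H : ∀ x y, f x * g y ≤ h ((2⁻¹ : ℝ) • (x + y)) ^ 2) :
    (∫⁻ x, f x) * (∫⁻ x, g x) ≤ (∫⁻ x, h x) ^ 2 := by
  apply ENNReal.mul_le_sq_of_add_le
  rw [lintegral_eq_lintegral_Ioi_measure_lt volume hf,
    lintegral_eq_lintegral_Ioi_measure_lt volume hg,
    lintegral_eq_lintegral_Ioi_measure_lt volume hh, ← lintegral_const_mul' _ _ (by simp),
    ← lintegral_add_left' ?_]
  · refine setLIntegral_mono' measurableSet_Ioi fun t ht => ?_
    rcases lt_or_ge (ENNReal.ofReal t) 1 with h1 | h1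
    · refine Real.volume_add_volume_le_of_midpoint ?_ ?_
        (measurableSet_lt measurable_const hf) (measurableSet_lt measurable_const hg) ?_
      · rw [← hf1, lt_iSup_iff] at h1; exact h1
      · rw [← hg1, lt_iSup_iff] at h1; exact h1
      · intro a ha b hb
        have h2 : ENNReal.ofReal t ^ 2 < h ((2⁻¹ : ℝ) • (a + b)) ^ 2 := by
          refine lt_of_lt_of_le ?_ (H a b)
          rw [sq]
          exact ENNReal.mul_lt_mul ha hb
        exact lt_of_not_ge fun hle => absurd h2 (pow_le_pow_left' hle 2).not_gt
    · have e1 : {x | ENNReal.ofReal t < f x} = ∅ := by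
        ext x; simpa using ((le_iSup f x).trans hf1.le).trans h1
      have e2 : {x | ENNReal.ofReal t < g x} = ∅ := by
        ext x; simpa using ((le_iSup g x).trans hg1.le).trans h1
      simp [e1, e2]
  · refine Measurable.aemeasurable ?_
    exact measurable_measure_prodMk_left (ν := (volume : Measure ℝ))
      (s := {p : ℝ × ℝ | ENNReal.ofReal p.1 < f p.2})
      (measurableSet_lt (by fun_prop) (hf.comp measurable_snd))

theorem lintegral_mul_lintegral_le_of_bounded {f g h : ℝ → ℝ≥0∞} (hf : Measurable f)
    (hg : Measurable g) (hh : Measurable h) (hf1 : ⨆ x, f x ≠ ⊤) (hg1 : ⨆ x, g x ≠ ⊤)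
    (H : ∀ x y, f x * g y ≤ h ((2⁻¹ : ℝ) • (x + y)) ^ 2) :
    (∫⁻ x, f x) * (∫⁻ x, g x) ≤ (∫⁻ x, h x) ^ 2 := by
  set M := ⨆ x, f x with hM
  set N := ⨆ x, g x with hN
  rcases eq_or_ne M 0 with h0 | hM0
  · have : ∀ x, f x = 0 := fun x => le_antisymm ((le_iSup f x).trans h0.le) zero_le
    simp [this]
  rcases eq_or_ne N 0 with h0 | hN0
  · have : ∀ x, g x = 0 := fun x => le_antisymm ((le_iSup g x).trans h0.le) zero_le
    simp [this]
  set c : ℝ≥0∞ := (M⁻¹ * N⁻¹) ^ (2⁻¹ : ℝ) with hc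
  have hc2 : c ^ 2 = M⁻¹ * N⁻¹ := by
    rw [hc, ← ENNReal.rpow_natCast, ← ENNReal.rpow_mul]; norm_num
  have key := lintegral_mul_lintegral_le_of_iSup_eq_one (f := fun x => M⁻¹ * f x)
    (g := fun x => N⁻¹ * g x) (h := fun x => c * h x) (by fun_prop) (by fun_prop) (by fun_prop)
    (by rw [← ENNReal.mul_iSup, ← hM, ENNReal.inv_mul_cancel hM0 hf1])
    (by rw [← ENNReal.mul_iSup, ← hN, ENNReal.inv_mul_cancel hN0 hg1])
    (fun x y => by
      rw [mul_pow, hc2]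
      calc M⁻¹ * f x * (N⁻¹ * g y) = M⁻¹ * N⁻¹ * (f x * g y) := by ring
        _ ≤ _ := by gcongr; exact H x y)
  rw [lintegral_const_mul _ hf, lintegral_const_mul _ hg, lintegral_const_mul _ hh, mul_pow, hc2]
    at key
  have hMN : M * N * (M⁻¹ * N⁻¹) = 1 := by
    rw [mul_mul_mul_comm, ENNReal.mul_inv_cancel hM0 hf1, ENNReal.mul_inv_cancel hN0 hg1, one_mul]
  calc (∫⁻ x, f x) * (∫⁻ x, g x)
      = M * N * (M⁻¹ * N⁻¹) * ((∫⁻ x, f x) * (∫⁻ x, g x)) := by rw [hMN, one_mul]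
    _ = M * N * (M⁻¹ * (∫⁻ x, f x) * (N⁻¹ * (∫⁻ x, g x))) := by ring
    _ ≤ M * N * (M⁻¹ * N⁻¹ * (∫⁻ x, h x) ^ 2) := by gcongr
    _ = M * N * (M⁻¹ * N⁻¹) * (∫⁻ x, h x) ^ 2 := by ring
    _ = _ := by rw [hMN, one_mul]

theorem lintegral_eq_iSup_lintegral_min {α : Type*} [MeasurableSpace α] (μ : Measure α)
    {f : α → ℝ≥0∞} (hf : Measurable f) :
    ∫⁻ x, f x ∂μ = ⨆ N : ℕ, ∫⁻ x, min (f x) N ∂μ := by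
  rw [← lintegral_iSup (fun N => hf.min measurable_const)]
  · refine lintegral_congr fun x => ?_
    rw [← inf_iSup_eq, ENNReal.iSup_natCast, inf_top_eq]
  · intro i j hij x
    exact min_le_min le_rfl (by exact_mod_cast hij)

theorem hasMidpointPrekopaLeindler_real : HasMidpointPrekopaLeindler ℝ := by
  intro f g h hf hg hh H
  rw [lintegral_eq_iSup_lintegral_min _ hf, lintegral_eq_iSup_lintegral_min _ hg,
    ENNReal.iSup_mul]
  refine iSup_le fun N => ?_
  rw [ENNReal.mul_iSup]
  refine iSup_le fun N' => ?_
  refine lintegral_mul_lintegral_le_of_bounded (hf.min measurable_const)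
    (hg.min measurable_const) hh ?_ ?_ fun x y => ?_
  · exact ne_top_of_le_ne_top (ENNReal.natCast_ne_top N) (iSup_le fun x => min_le_right _ _)
  · exact ne_top_of_le_ne_top (ENNReal.natCast_ne_top N') (iSup_le fun x => min_le_right _ _)
  · exact (mul_le_mul' (min_le_left _ _) (min_le_left _ _)).trans (H x y)

theorem HasMidpointPrekopaLeindler.prod {α β : Type*} [AddCommGroup α] [Module ℝ α] [MeasureSpace α]
    [AddCommGroup β] [Module ℝ β] [MeasureSpace β] [SFinite (volume : Measure β)]
    (hα : HasMidpointPrekopaLeindler α) (hβ : HasMidpointPrekopaLeindler β) :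
    HasMidpointPrekopaLeindler (α × β) := by
  intro f g h hf hg hh H
  rw [Measure.volume_eq_prod, lintegral_prod _ hf.aemeasurable, lintegral_prod _ hg.aemeasurable,
    lintegral_prod _ hh.aemeasurable]
  refine hα _ _ _ hf.lintegral_prod_right' hg.lintegral_prod_right' hh.lintegral_prod_right'
    fun x y => ?_
  refine hβ _ _ _ (by fun_prop) (by fun_prop) (by fun_prop) fun x' y' => ?_
  simpa using H (x, x') (y, y')

theorem HasMidpointPrekopaLeindler.of_measurePreserving {α β : Type*} [AddCommGroup α] [Module ℝ α]
    [MeasureSpace α] [AddCommGroup β] [Module ℝ β] [MeasureSpace β] (e : α ≃ₗ[ℝ] β)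
    (he : MeasurePreserving e) (hα : HasMidpointPrekopaLeindler α) :
    HasMidpointPrekopaLeindler β := by
  intro f g h hf hg hh H
  rw [← he.lintegral_comp hf, ← he.lintegral_comp hg, ← he.lintegral_comp hh]
  refine hα _ _ _ (hf.comp he.measurable) (hg.comp he.measurable) (hh.comp he.measurable)
    fun x y => ?_
  simpa using H (e x) (e y)

theorem hasMidpointPrekopaLeindler_pi (k : ℕ) : HasMidpointPrekopaLeindler (Fin k → ℝ) := by
  induction k with
  | zero =>
    intro f g h hf hg hh H
    have := H 0 0
    simp only [volume_pi, Measure.pi_of_empty _ 0, lintegral_dirac]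
    simpa using this
  | succ k ih =>
    refine HasMidpointPrekopaLeindler.of_measurePreserving
      (Fin.consLinearEquiv ℝ (fun _ => ℝ)) ?_ (hasMidpointPrekopaLeindler_real.prod ih)
    have := (volume_preserving_piFinSuccAbove (fun _ : Fin (k + 1) => ℝ) 0).symm
    have e : (⇑(Fin.consLinearEquiv ℝ fun _ : Fin (k + 1) => ℝ) :
        ℝ × (Fin k → ℝ) → Fin (k + 1) → ℝ) =
        ⇑(MeasurableEquiv.piFinSuccAbove (fun _ : Fin (k + 1) => ℝ) 0).symm := by
      funext x
      simp [Fin.consLinearEquiv, MeasurableEquiv.piFinSuccAbove, Fin.insertNthEquiv]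
      rfl
    exact e ▸ this

theorem hasMidpointPrekopaLeindler_euclideanSpace (k : ℕ) :
    HasMidpointPrekopaLeindler (EuclideanSpace ℝ (Fin k)) :=
  HasMidpointPrekopaLeindler.of_measurePreserving (WithLp.linearEquiv 2 ℝ (Fin k → ℝ)).symm
    (PiLp.volume_preserving_toLp (Fin k)) (hasMidpointPrekopaLeindler_pi k)

/-- The multiplicative Brunn–Minkowski inequality for two sets of measure at least `m`. -/
theorem le_volume_of_midpoint {k : ℕ} {A B C : Set (EuclideanSpace ℝ (Fin k))}
    (mA : MeasurableSet A)
    (mB : MeasurableSet B) (mC : MeasurableSet C) {m : ℝ≥0∞} (hA : m ≤ volume A)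
    (hB : m ≤ volume B) (h : ∀ a ∈ A, ∀ b ∈ B, (2⁻¹ : ℝ) • (a + b) ∈ C) : m ≤ volume C := by
  have := hasMidpointPrekopaLeindler_euclideanSpace k (A.indicator 1) (B.indicator 1)
      (C.indicator 1)
    (measurable_one.indicator mA) (measurable_one.indicator mB) (measurable_one.indicator mC)
    fun x y => by
      by_cases hx : x ∈ A <;> by_cases hy : y ∈ B <;> simp [hx, hy]
      have := h x hx y hy
      rw [smul_add] at this
      simp [this]
  simp only [lintegral_indicator_one, mA, mB, mC] at this
  have h2 : m ^ 2 ≤ volume C ^ 2 := by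
    rw [sq]; exact (mul_le_mul' hA hB).trans this
  refine le_of_not_gt fun hlt => absurd h2 (not_le_of_gt ?_)
  rw [sq, sq]
  exact ENNReal.mul_lt_mul hlt hlt

/-! ### The splitting of coordinates -/

/-- The last `n - k` coordinates of a point. -/
def lastCoords {n : ℕ} (k : ℕ) (x : EuclideanSpace ℝ (Fin n)) : EuclideanSpace ℝ (Fin (n - k)) :=
  WithLp.toLp 2 fun i => x ⟨i.val + k, by have := i.isLt; omega⟩

/-- The splitting of the index set into the first `k` and the last `n - k` indices. -/
def finSplitEquiv {n k : ℕ} (h : k ≤ n) : Fin k ⊕ Fin (n - k) ≃ Fin n :=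
  finSumFinEquiv.trans (finCongr (by omega))

theorem joinCoords_finSplitEquiv_inl {n k : ℕ} (h : k ≤ n) (y : EuclideanSpace ℝ (Fin k))
    (z : EuclideanSpace ℝ (Fin (n - k))) (i : Fin k) :
    joinCoords y z (finSplitEquiv h (Sum.inl i)) = y i := by
  simp [joinCoords, finSplitEquiv]

theorem joinCoords_finSplitEquiv_inr {n k : ℕ} (h : k ≤ n) (y : EuclideanSpace ℝ (Fin k))
    (z : EuclideanSpace ℝ (Fin (n - k))) (i : Fin (n - k)) :
    joinCoords y z (finSplitEquiv h (Sum.inr i)) = z i := by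
  simp [joinCoords, finSplitEquiv]

theorem lastCoords_joinCoords {n k : ℕ} (y : EuclideanSpace ℝ (Fin k))
    (z : EuclideanSpace ℝ (Fin (n - k))) : lastCoords k (joinCoords (n := n) y z) = z := by
  ext i
  simp [lastCoords, joinCoords]

theorem measurable_lastCoords {n k : ℕ} :
    Measurable (lastCoords k : EuclideanSpace ℝ (Fin n) → EuclideanSpace ℝ (Fin (n - k))) := by
  unfold lastCoords
  fun_prop

theorem measurePreserving_joinCoords {n k : ℕ} (h : k ≤ n) :
    MeasurePreserving (fun p : EuclideanSpace ℝ (Fin k) × EuclideanSpace ℝ (Fin (n - k)) =>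
      joinCoords (n := n) p.1 p.2) (volume.prod volume) volume := by
  have h1 := (PiLp.volume_preserving_ofLp (Fin k)).prod (PiLp.volume_preserving_ofLp (Fin (n - k)))
  have h2 := (volume_measurePreserving_sumPiEquivProdPi
    (fun _ : Fin k ⊕ Fin (n - k) => ℝ)).symm
  have h3 := volume_measurePreserving_piCongrLeft (fun _ : Fin n => ℝ) (finSplitEquiv h)
  have h4 := ((PiLp.volume_preserving_toLp (Fin n)).comp h3).comp (h2.comp h1)
  refine cast (congrArg (fun f => MeasurePreserving f _ _) ?_) h4
  funext p
  symm
  ext i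
  obtain ⟨i, rfl⟩ := (finSplitEquiv h).surjective i
  rcases i with i | i
  · rw [joinCoords_finSplitEquiv_inl h]
    simp [MeasurableEquiv.piCongrLeft, Equiv.piCongrLeft_apply_apply,
      MeasurableEquiv.sumPiEquivProdPi]
  · rw [joinCoords_finSplitEquiv_inr h]
    simp [MeasurableEquiv.piCongrLeft, Equiv.piCongrLeft_apply_apply,
      MeasurableEquiv.sumPiEquivProdPi]

theorem measurable_joinCoords {n k : ℕ} :
    Measurable (fun p : EuclideanSpace ℝ (Fin k) × EuclideanSpace ℝ (Fin (n - k)) =>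
      joinCoords (n := n) p.1 p.2) := by
  unfold joinCoords
  refine (PiLp.volume_preserving_toLp (Fin n)).measurable.comp (measurable_pi_lambda _ fun i => ?_)
  split_ifs <;> fun_prop

theorem joinCoords_combo {n k : ℕ} (y y' : EuclideanSpace ℝ (Fin k))
    (z : EuclideanSpace ℝ (Fin (n - k))) {a b : ℝ} (hab : a + b = 1) :
    joinCoords (n := n) (a • y + b • y') z = a • joinCoords y z + b • joinCoords y' z := by
  ext i
  simp only [joinCoords, PiLp.add_apply, PiLp.smul_apply, smul_eq_mul]
  split_ifs
  · rfl
  · rw [← add_mul, hab, one_mul]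

theorem norm_joinCoords_sq {n k : ℕ} (h : k ≤ n) (y : EuclideanSpace ℝ (Fin k))
    (z : EuclideanSpace ℝ (Fin (n - k))) :
    ‖joinCoords (n := n) y z‖ ^ 2 = ‖y‖ ^ 2 + ‖z‖ ^ 2 := by
  simp only [EuclideanSpace.norm_sq_eq]
  rw [← (finSplitEquiv h).sum_comp, Fintype.sum_sum_type]
  simp [joinCoords_finSplitEquiv_inl, joinCoords_finSplitEquiv_inr]

theorem norm_le_norm_joinCoords {n k : ℕ} (h : k ≤ n) (y : EuclideanSpace ℝ (Fin k))
    (z : EuclideanSpace ℝ (Fin (n - k))) : ‖y‖ ≤ ‖joinCoords (n := n) y z‖ := by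
  refine (sq_le_sq₀ (norm_nonneg _) (norm_nonneg _)).1 ?_
  rw [norm_joinCoords_sq h]
  nlinarith [sq_nonneg ‖z‖]

theorem joinCoords_injective_left {n k : ℕ} (h : k ≤ n) (z : EuclideanSpace ℝ (Fin (n - k))) :
    Function.Injective (fun y : EuclideanSpace ℝ (Fin k) => joinCoords (n := n) y z) := by
  intro y y' hy
  ext i
  have := congrArg (fun x : EuclideanSpace ℝ (Fin n) => x (finSplitEquiv h (Sum.inl i))) hy
  simpa [joinCoords_finSplitEquiv_inl] using this

theorem lintegral_joinCoords {n k : ℕ} (h : k ≤ n) {F : EuclideanSpace ℝ (Fin n) → ℝ≥0∞}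
    (hF : Measurable F) :
    ∫⁻ x, F x = ∫⁻ z : EuclideanSpace ℝ (Fin (n - k)), ∫⁻ y, F (joinCoords y z) := by
  rw [← (measurePreserving_joinCoords h).lintegral_comp hF]
  exact lintegral_prod_symm _ (hF.comp measurable_joinCoords).aemeasurable

/-! ### Kernels -/

/-- The kernel `|x| ^ (-n - 2 s)` of the fractional Laplacian. -/
noncomputable def fracKernel (n : ℕ) (s : ℝ) (x : EuclideanSpace ℝ (Fin n)) : ℝ≥0 :=
  (‖x‖₊) ^ (-(n : ℝ) - 2 * s)

theorem measurable_fracKernel (n : ℕ) (s : ℝ) : Measurable (fracKernel n s) := by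
  unfold fracKernel; fun_prop

theorem coe_fracKernel (n : ℕ) (s : ℝ) (x : EuclideanSpace ℝ (Fin n)) :
    (fracKernel n s x : ℝ) = ‖x‖ ^ (-(n : ℝ) - 2 * s) := by
  simp [fracKernel]

theorem lt_fracKernel_iff {n : ℕ} {s : ℝ} (hs : 0 < s) {r : ℝ} (hr : 0 < r)
    (x : EuclideanSpace ℝ (Fin n)) :
    r ^ (-(n : ℝ) - 2 * s) < (fracKernel n s x : ℝ) ↔ x ≠ 0 ∧ ‖x‖ < r := by
  have hneg : -(n : ℝ) - 2 * s < 0 := by have := n.cast_nonneg (α := ℝ); linarith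
  rw [coe_fracKernel]
  rcases eq_or_ne x 0 with rfl | hx
  · simp [Real.zero_rpow hneg.ne, Real.rpow_nonneg hr.le]
  · rw [Real.rpow_lt_rpow_iff_of_neg hr (norm_pos_iff.2 hx) hneg]
    simp [hx]

theorem norm_joinCoords_lt_iff {n k : ℕ} (h : k ≤ n) (y : EuclideanSpace ℝ (Fin k))
    (z : EuclideanSpace ℝ (Fin (n - k))) {r : ℝ} (hr : 0 < r) :
    ‖joinCoords (n := n) y z‖ < r ↔ ‖z‖ < r ∧ ‖y‖ < Real.sqrt (r ^ 2 - ‖z‖ ^ 2) := by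
  rw [← sq_lt_sq₀ (norm_nonneg _) hr.le, norm_joinCoords_sq h, Real.lt_sqrt (norm_nonneg _)]
  constructor
  · intro H
    refine ⟨?_, by linarith⟩
    rw [← sq_lt_sq₀ (norm_nonneg _) hr.le]
    nlinarith [sq_nonneg ‖y‖]
  · rintro ⟨-, H⟩; linarith

theorem fracKernel_mem {n k : ℕ} {s : ℝ} (hk : 1 ≤ k) (h : k ≤ n) (hs : 0 < s) :
    fracKernel n s ∈ admissibleKernels n k s := by
  refine ⟨measurable_fracKernel n s, fun z r hr => ?_⟩
  have : Nonempty (Fin k) := ⟨⟨0, hk⟩⟩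
  simp_rw [lt_fracKernel_iff hs hr, norm_joinCoords_lt_iff h _ z hr]
  split_ifs with hz
  · rw [← measure_sdiff_null (s := Metric.ball (0 : EuclideanSpace ℝ (Fin k)) _)
      (t := {y | joinCoords (n := n) y z = 0})]
    · congr 1
      ext y
      simp [hz, and_comm]
    · refine Set.Subsingleton.measure_zero (fun a ha b hb => ?_) _
      exact joinCoords_injective_left h z (ha.trans hb.symm)
  · simp [hz]

/-- The minimal energy `inf_K ∫ W K` over the admissible kernels. -/
noncomputable def kernelInf (n k : ℕ) (s : ℝ) (W : EuclideanSpace ℝ (Fin n) → ℝ) : ℝ≥0∞ :=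
  ⨅ K ∈ admissibleKernels n k s, ∫⁻ x, ENNReal.ofReal (W x) * (K x : ℝ≥0∞)

theorem kernelInf_mono {n k : ℕ} {s : ℝ} {W W' : EuclideanSpace ℝ (Fin n) → ℝ}
    (h : ∀ x, W x ≤ W' x) : kernelInf n k s W ≤ kernelInf n k s W' :=
  iInf₂_mono fun _ _ => lintegral_mono fun x => by gcongr; exact h x

/-- The weight `min (|x|², |x|)`, which controls `u (x₀ + x) - u x₀ - x · p` for a function `u` in
`C^{1,1}` with bounded gradient, and which is integrable against the fractional kernel. -/
noncomputable def quadLin {E : Type*} [Norm E] (x : E) : ℝ := min (‖x‖ ^ 2) ‖x‖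

theorem quadLin_nonneg {E : Type*} [SeminormedAddGroup E] (x : E) : 0 ≤ quadLin x :=
  le_min (by positivity) (norm_nonneg _)

theorem measurable_quadLin {n : ℕ} :
    Measurable (quadLin : EuclideanSpace ℝ (Fin n) → ℝ) := by unfold quadLin; fun_prop

theorem lintegral_quadLin_mul_fracKernel_lt_top {n : ℕ} (hn : 1 ≤ n) {s : ℝ} (hs : 1 / 2 < s)
    (hs' : s < 1) :
    ∫⁻ x : EuclideanSpace ℝ (Fin n), ENNReal.ofReal (quadLin x) * (fracKernel n s x : ℝ≥0∞)
      < ⊤ := by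
  have : Nonempty (Fin n) := ⟨⟨0, hn⟩⟩
  set f : ℝ → ℝ := fun r => min (r ^ 2) r * r ^ (-(n : ℝ) - 2 * s) with hf
  have hint : Integrable (fun x : EuclideanSpace ℝ (Fin n) => f ‖x‖) := by
    rw [integrable_fun_norm_addHaar volume (f := f), finrank_euclideanSpace, Fintype.card_fin,
      ← Ioc_union_Ioi_eq_Ioi zero_le_one, integrableOn_union]
    have e : ∀ r : ℝ, 0 < r → r ^ (n - 1) • f r = min (r ^ 2) r * r ^ (-1 - 2 * s) := by
      intro r hr
      rw [hf, smul_eq_mul, ← Real.rpow_natCast, mul_left_comm, ← Real.rpow_add hr, Nat.cast_sub hn]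
      congr 2
      push_cast
      ring
    constructor
    · have : IntegrableOn (fun r : ℝ => r ^ (1 - 2 * s)) (Ioc 0 1) := by
        rw [← intervalIntegrable_iff_integrableOn_Ioc_of_le zero_le_one]
        exact intervalIntegral.intervalIntegrable_rpow' (by linarith)
      refine this.congr_fun (fun r hr => ?_) measurableSet_Ioc
      beta_reduce
      rw [e r hr.1, min_eq_left (by nlinarith [hr.1, hr.2]), ← Real.rpow_natCast,
        ← Real.rpow_add hr.1]
      congr 1
      push_cast
      ring
    · have : IntegrableOn (fun r : ℝ => r ^ (- 2 * s)) (Ioi 1) :=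
        integrableOn_Ioi_rpow_of_lt (by linarith) zero_lt_one
      refine this.congr_fun (fun r (hr : 1 < r) => ?_) measurableSet_Ioi
      beta_reduce
      have hr0 : 0 < r := by linarith
      rw [e r hr0, min_eq_right (by nlinarith)]
      nth_rewrite 2 [← Real.rpow_one r]
      rw [← Real.rpow_add hr0]
      congr 1
      ring
  refine lt_of_eq_of_lt (lintegral_congr fun x => ?_) hint.lintegral_lt_top
  change _ = ENNReal.ofReal (quadLin x * ‖x‖ ^ (-(n : ℝ) - 2 * s))
  rw [ENNReal.ofReal_mul (quadLin_nonneg x), ← coe_fracKernel, ENNReal.ofReal_coe_nnreal]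

/-- The energy of `min (|x|², |x|)` for the fractional kernel is absolutely continuous near
`{z = 0}`. -/
theorem tendsto_lintegral_quadLin_slab {n k : ℕ} (hk : k < n) {s : ℝ} (hs : 1 / 2 < s)
    (hs' : s < 1) :
    Tendsto (fun j : ℕ => ∫⁻ x in {x : EuclideanSpace ℝ (Fin n) | ‖lastCoords k x‖ ≤ 1 / (j + 1)},
      ENNReal.ofReal (quadLin x) * (fracKernel n s x : ℝ≥0∞)) atTop (𝓝 0) := by
  set F : EuclideanSpace ℝ (Fin n) → ℝ≥0∞ :=
    fun x => ENNReal.ofReal (quadLin x) * (fracKernel n s x : ℝ≥0∞) with hFdef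
  have hF : Measurable F := by
    have := measurable_quadLin (n := n)
    have := measurable_fracKernel n s
    fun_prop
  have hm : ∀ j : ℕ, MeasurableSet
      {x : EuclideanSpace ℝ (Fin n) | ‖lastCoords k x‖ ≤ 1 / (j + 1)} :=
    fun j => measurableSet_le measurable_lastCoords.norm measurable_const
  have hfin := lintegral_quadLin_mul_fracKernel_lt_top (n := n) (by omega) hs hs'
  have h0 : volume.withDensity F {x : EuclideanSpace ℝ (Fin n) | lastCoords k x = 0} = 0 := by
    refine withDensity_absolutelyContinuous _ _ ?_
    have hne : Nonempty (Fin (n - k)) := ⟨⟨0, by omega⟩⟩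
    have hms : MeasurableSet {x : EuclideanSpace ℝ (Fin n) | lastCoords k x = 0} :=
      measurable_lastCoords (measurableSet_singleton 0)
    rw [← (measurePreserving_joinCoords hk.le).measure_preimage hms.nullMeasurableSet]
    simp only [preimage_ofPred_eq, lastCoords_joinCoords]
    have : {p : EuclideanSpace ℝ (Fin k) × EuclideanSpace ℝ (Fin (n - k)) | p.2 = 0} =
        univ ×ˢ {0} := by ext; simp
    rw [this, Measure.prod_prod]
    simp
  have hlim := tendsto_measure_iInter_atTop (μ := volume.withDensity F)
    (s := fun j : ℕ => {x : EuclideanSpace ℝ (Fin n) | ‖lastCoords k x‖ ≤ 1 / (j + 1)})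
    (fun j => (hm j).nullMeasurableSet) ?_ ⟨0, ?_⟩
  · have hI : ⋂ j : ℕ, {x : EuclideanSpace ℝ (Fin n) | ‖lastCoords k x‖ ≤ 1 / ((j : ℝ) + 1)} =
        {x | lastCoords k x = 0} := by
      ext x
      simp only [mem_iInter, mem_ofPred_eq]
      constructor
      · intro hx
        have := ge_of_tendsto' (tendsto_one_div_add_atTop_nhds_zero_nat (𝕜 := ℝ)) hx
        exact norm_le_zero_iff.1 this
      · intro hx j
        rw [hx, norm_zero]
        positivity
    rw [hI, h0] at hlim
    refine hlim.congr fun j => ?_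
    rw [Function.comp_apply, withDensity_apply _ (hm j)]
  · intro i j hij x hx
    refine le_trans (α := ℝ) hx ?_
    exact Nat.one_div_le_one_div hij
  · rw [withDensity_apply _ (hm 0)]
    exact ((setLIntegral_le_lintegral _ _).trans_lt hfin).ne

/-- Replacing an admissible kernel by the fractional kernel on the slab `{|z| ≤ δ}` gives an
admissible kernel. -/
theorem ite_fracKernel_mem {n k : ℕ} {s : ℝ} (hk : 1 ≤ k) (h : k ≤ n) (hs : 0 < s)
    {K : EuclideanSpace ℝ (Fin n) → ℝ≥0} (hK : K ∈ admissibleKernels n k s) (δ : ℝ)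
    [DecidablePred fun x : EuclideanSpace ℝ (Fin n) => ‖lastCoords k x‖ ≤ δ] :
    (fun x => if ‖lastCoords k x‖ ≤ δ then fracKernel n s x else K x) ∈
      admissibleKernels n k s := by
  refine ⟨Measurable.ite (measurableSet_le measurable_lastCoords.norm measurable_const)
    (measurable_fracKernel n s) hK.1, fun z r hr => ?_⟩
  by_cases hz : ‖z‖ ≤ δ
  · simpa only [lastCoords_joinCoords, hz, if_true] using (fracKernel_mem hk h hs).2 z r hr
  · simpa only [lastCoords_joinCoords, hz, if_false] using hK.2 z r hr

theorem ae_le_of_mem_admissibleKernels {n k : ℕ} {s : ℝ} (h : k ≤ n)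
    {K : EuclideanSpace ℝ (Fin n) → ℝ≥0} (hK : K ∈ admissibleKernels n k s) {δ : ℝ} (hδ : 0 < δ) :
    ∀ᵐ x, δ < ‖lastCoords k x‖ → (K x : ℝ) ≤ δ ^ (-(n : ℝ) - 2 * s) := by
  set S : Set (EuclideanSpace ℝ (Fin n)) :=
    {x | δ < ‖lastCoords k x‖ ∧ δ ^ (-(n : ℝ) - 2 * s) < (K x : ℝ)} with hS
  have mS : MeasurableSet S :=
    (measurableSet_lt measurable_const measurable_lastCoords.norm).inter
      (measurableSet_lt measurable_const hK.1.coe_nnreal_real)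
  have : volume S = 0 := by
    rw [← (measurePreserving_joinCoords h).measure_preimage mS.nullMeasurableSet,
      Measure.prod_apply_symm (measurable_joinCoords mS)]
    refine lintegral_eq_zero_of_ae_eq_zero (Eventually.of_forall fun z => ?_)
    have h1 := hK.2 z δ hδ
    by_cases hz : ‖z‖ < δ
    · refine measure_mono_null (t := ∅) (fun y hy => ?_) (by simp)
      have : δ < ‖lastCoords k (joinCoords (n := n) y z)‖ := hy.1
      rw [lastCoords_joinCoords] at this
      exact absurd this hz.not_gt
    · rw [if_neg hz] at h1
      exact measure_mono_null (fun y hy => hy.2) h1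
  filter_upwards [measure_eq_zero_iff_ae_notMem.1 this] with x hx hδx
  exact le_of_not_gt fun hlt => hx ⟨hδx, hlt⟩

/-- Upper bound for the minimal energy of a function dominated by another one up to an error, by
cutting a kernel at the slab `{|z| ≤ δ}`: there the fractional kernel is used, and outside every
admissible kernel is bounded. -/
theorem kernelInf_le_of_le_add {n k : ℕ} {s : ℝ} (hk : 1 ≤ k) (h : k ≤ n) (hs : 0 < s)
    {W W' : EuclideanSpace ℝ (Fin n) → ℝ} (hW'm : Measurable W')
    {C θ η δ R : ℝ} (hC : 0 ≤ C) (hθ : 0 ≤ θ)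
    (hδ : 0 < δ) (hWC : ∀ x, W x ≤ C * quadLin x)
    (hWW : ∀ x, W x ≤ (1 + θ) * W' x + (Metric.closedBall 0 R).indicator (fun _ => η) x) :
    kernelInf n k s W ≤ ENNReal.ofReal (1 + θ) * kernelInf n k s W' +
      (ENNReal.ofReal C * (∫⁻ x in {x : EuclideanSpace ℝ (Fin n) | ‖lastCoords k x‖ ≤ δ},
        ENNReal.ofReal (quadLin x) * (fracKernel n s x : ℝ≥0∞)) +
      ENNReal.ofReal η * (ENNReal.ofReal (δ ^ (-(n : ℝ) - 2 * s)) *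
        volume (Metric.closedBall (0 : EuclideanSpace ℝ (Fin n)) R))) := by
  classical
  have hθ1 : 0 < 1 + θ := by linarith
  rw [kernelInf, kernelInf, ENNReal.mul_iInf_of_ne (by simpa using hθ1) (by simp), ENNReal.iInf_add]
  refine le_iInf fun K => ?_
  rw [ENNReal.mul_iInf_of_ne (by simpa using hθ1) (by simp), ENNReal.iInf_add]
  refine le_iInf fun hK => ?_
  have mT : MeasurableSet {x : EuclideanSpace ℝ (Fin n) | ‖lastCoords k x‖ ≤ δ} :=
    measurableSet_le measurable_lastCoords.norm measurable_const
  have mK := hK.1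
  have mF := measurable_fracKernel n s
  have mQ := measurable_quadLin (n := n)
  refine (iInf₂_le _ (ite_fracKernel_mem hk h hs hK δ)).trans ?_
  rw [← lintegral_add_compl _ mT, add_left_comm]
  refine add_le_add ?_ ?_
  · rw [← lintegral_const_mul _ (by fun_prop)]
    refine setLIntegral_mono (by fun_prop) fun x hx => ?_
    have hx' : ‖lastCoords k x‖ ≤ δ := hx
    simp only [if_pos hx']
    rw [← mul_assoc, ← ENNReal.ofReal_mul hC]
    gcongr
    exact hWC x
  · have e1 : ∫⁻ x in {x : EuclideanSpace ℝ (Fin n) | ‖lastCoords k x‖ ≤ δ}ᶜ,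
        ENNReal.ofReal (W x) *
          ((if ‖lastCoords k x‖ ≤ δ then fracKernel n s x else K x : ℝ≥0) : ℝ≥0∞)
        ≤ ∫⁻ x in {x : EuclideanSpace ℝ (Fin n) | ‖lastCoords k x‖ ≤ δ}ᶜ,
          (ENNReal.ofReal (1 + θ) * (ENNReal.ofReal (W' x) * (K x : ℝ≥0∞)) +
          (Metric.closedBall 0 R).indicator
            (fun _ => ENNReal.ofReal η * ENNReal.ofReal (δ ^ (-(n : ℝ) - 2 * s))) x) := by
      refine setLIntegral_mono_ae' mT.compl ?_
      filter_upwards [ae_le_of_mem_admissibleKernels h hK hδ] with x hx hxT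
      have hxT' : ¬ ‖lastCoords k x‖ ≤ δ := hxT
      have hKx := hx (not_le.1 hxT')
      rw [if_neg hxT', ← mul_assoc, ← ENNReal.ofReal_mul hθ1.le]
      calc ENNReal.ofReal (W x) * (K x : ℝ≥0∞)
          ≤ ENNReal.ofReal ((1 + θ) * W' x + (Metric.closedBall 0 R).indicator (fun _ => η) x) *
            (K x : ℝ≥0∞) := by gcongr; exact hWW x
        _ ≤ (ENNReal.ofReal ((1 + θ) * W' x) +
            ENNReal.ofReal ((Metric.closedBall 0 R).indicator (fun _ => η) x)) * (K x : ℝ≥0∞) := by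
            gcongr; exact ENNReal.ofReal_add_le
        _ ≤ _ := by
            rw [add_mul]
            gcongr
            by_cases hxR : x ∈ Metric.closedBall (0 : EuclideanSpace ℝ (Fin n)) R
            · simp only [indicator_of_mem hxR]
              gcongr
              rw [← ENNReal.ofReal_coe_nnreal]
              exact ENNReal.ofReal_le_ofReal hKx
            · simp [indicator_of_notMem hxR]
    refine e1.trans ((setLIntegral_le_lintegral _ _).trans ?_)
    rw [lintegral_add_left (by fun_prop), lintegral_const_mul _ (by fun_prop),
      lintegral_indicator_const measurableSet_closedBall, mul_assoc (ENNReal.ofReal η)]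

theorem kernelInf_le_const {n k : ℕ} {s : ℝ} (hk : 1 ≤ k) (h : k ≤ n) (hs : 0 < s)
    {W : EuclideanSpace ℝ (Fin n) → ℝ} {C : ℝ} (hC : 0 ≤ C) (hWC : ∀ x, W x ≤ C * quadLin x) :
    kernelInf n k s W ≤ ENNReal.ofReal C *
      ∫⁻ x : EuclideanSpace ℝ (Fin n), ENNReal.ofReal (quadLin x) * (fracKernel n s x : ℝ≥0∞) := by
  have mF := measurable_fracKernel n s
  have mQ := measurable_quadLin (n := n)
  refine (iInf₂_le _ (fracKernel_mem hk h hs)).trans ?_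
  rw [← lintegral_const_mul _ (by fun_prop)]
  refine lintegral_mono fun x => ?_
  rw [← mul_assoc, ← ENNReal.ofReal_mul hC]
  gcongr
  exact hWC x

/-- Semicontinuity of the minimal energy along functions which grow linearly at infinity and are
`C^{1,1}` at the origin. The linear growth of `W'` absorbs the error `η (1 + |x|)` for large `x`
into a factor close to `1`, so that only an error supported in a ball remains. -/
theorem exists_kernelInf_le_add {n k : ℕ} {s : ℝ} (hk : 1 ≤ k) (hkn : k < n) (hs : 1 / 2 < s)
    (hs' : s < 1) {a R C : ℝ} (ha : 0 < a) (hR : 1 ≤ R) (hC : 0 ≤ C) {κ : ℝ≥0∞} (hκ : 0 < κ) :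
    ∃ η > 0, ∀ W W' : EuclideanSpace ℝ (Fin n) → ℝ, Measurable W' → (∀ x, 0 ≤ W' x) →
      (∀ x, R ≤ ‖x‖ → a * ‖x‖ ≤ W' x) → (∀ x, W x ≤ C * quadLin x) →
      (∀ x, W x ≤ W' x + η * (1 + ‖x‖)) → kernelInf n k s W ≤ kernelInf n k s W' + κ := by
  set I := ∫⁻ x : EuclideanSpace ℝ (Fin n), ENNReal.ofReal (quadLin x) * (fracKernel n s x : ℝ≥0∞)
    with hI
  have hI' : I < ⊤ := lintegral_quadLin_mul_fracKernel_lt_top (by omega) hs hs'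
  obtain ⟨j, hj⟩ : ∃ j : ℕ, ENNReal.ofReal C * (∫⁻ x in {x : EuclideanSpace ℝ (Fin n) |
      ‖lastCoords k x‖ ≤ 1 / ((j : ℝ) + 1)},
      ENNReal.ofReal (quadLin x) * (fracKernel n s x : ℝ≥0∞)) < κ := by
    have := ENNReal.Tendsto.const_mul (a := ENNReal.ofReal C)
      (tendsto_lintegral_quadLin_slab hkn hs hs') (Or.inr (by simp))
    rw [mul_zero] at this
    exact (this.eventually (gt_mem_nhds hκ)).exists
  set δ : ℝ := 1 / ((j : ℝ) + 1) with hδ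
  have hδ0 : 0 < δ := by positivity
  set T := ENNReal.ofReal C * (∫⁻ x in {x : EuclideanSpace ℝ (Fin n) | ‖lastCoords k x‖ ≤ δ},
      ENNReal.ofReal (quadLin x) * (fracKernel n s x : ℝ≥0∞)) with hT
  set G := ENNReal.ofReal (δ ^ (-(n : ℝ) - 2 * s)) *
        volume (Metric.closedBall (0 : EuclideanSpace ℝ (Fin n)) R) with hG
  have hGt : G ≠ ⊤ := ENNReal.mul_ne_top (by simp) measure_closedBall_lt_top.ne
  have hlim : Tendsto (fun η : ℝ => ENNReal.ofReal (2 * η / a) * (ENNReal.ofReal C * I) +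
      (T + ENNReal.ofReal (η * (1 + R)) * G)) (𝓝[>] 0) (𝓝 T) := by
    have h1 : Tendsto (fun η : ℝ => ENNReal.ofReal (2 * η / a)) (𝓝[>] 0) (𝓝 0) := by
      have : Continuous fun η : ℝ => ENNReal.ofReal (2 * η / a) :=
        ENNReal.continuous_ofReal.comp (by fun_prop)
      simpa using (this.tendsto 0).mono_left nhdsWithin_le_nhds
    have h2 : Tendsto (fun η : ℝ => ENNReal.ofReal (η * (1 + R))) (𝓝[>] 0) (𝓝 0) := by
      have : Continuous fun η : ℝ => ENNReal.ofReal (η * (1 + R)) :=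
        ENNReal.continuous_ofReal.comp (by fun_prop)
      simpa using (this.tendsto 0).mono_left nhdsWithin_le_nhds
    have h3 := (ENNReal.Tendsto.mul_const h1 (b := ENNReal.ofReal C * I)
      (Or.inr (ENNReal.mul_ne_top (by simp) hI'.ne))).add
      (tendsto_const_nhds (x := T).add (ENNReal.Tendsto.mul_const h2 (b := G) (Or.inr hGt)))
    simpa using h3
  obtain ⟨η, hη1, hη0⟩ := ((hlim.eventually (gt_mem_nhds hj)).and self_mem_nhdsWithin).exists
  have hη0 : 0 < η := hη0
  refine ⟨η, hη0, fun W W' mW' hW'0 hW'a hWC hWW => ?_⟩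
  rcases le_total (ENNReal.ofReal C * I) (kernelInf n k s W') with hle | hle
  · exact ((kernelInf_le_const hk hkn.le (by linarith) hC hWC).trans hle).trans le_self_add
  have hθ : 0 ≤ 2 * η / a := by positivity
  refine (kernelInf_le_of_le_add hk hkn.le (by linarith) mW' (R := R) (δ := δ) (θ := 2 * η / a)
    (η := η * (1 + R)) hC hθ hδ0 hWC fun x => ?_).trans ?_
  · refine (hWW x).trans ?_
    have hx0 := norm_nonneg x
    have hW0 := hW'0 x
    have hpos : 0 ≤ 2 * η / a * W' x := by positivity
    by_cases hx : ‖x‖ ≤ R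
    · rw [indicator_of_mem (by simpa using hx)]
      nlinarith
    · rw [indicator_of_notMem (by simpa using hx)]
      push Not at hx
      have h1 := hW'a x hx.le
      have h2 : 2 * η / a * (a * ‖x‖) ≤ 2 * η / a * W' x := by gcongr
      have h3 : 2 * η / a * (a * ‖x‖) = 2 * η * ‖x‖ := by field_simp
      nlinarith
  · rw [ENNReal.ofReal_add zero_le_one hθ, ENNReal.ofReal_one, add_mul, one_mul, add_assoc]
    gcongr
    refine le_trans ?_ hη1.le
    gcongr

/-! ### Rearrangements and the midpoint inequality for the minimal energy -/

/-- If the level sets of `f ≥ 0` are null and its sublevel sets have finite measure, then the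
function `y ↦ |{f < f y}|` is equidistributed on `(0, ∞)`. -/
theorem measure_setOf_measure_lt_lt {Y : Type*} [MeasurableSpace Y] {μ : Measure Y} {f : Y → ℝ}
    (hf : Measurable f) (hf0 : ∀ y, 0 ≤ f y) (hlev : ∀ t, μ {y | f y = t} = 0)
    (hfin : ∀ t, μ {y | f y < t} < ⊤) (huniv : μ univ = ⊤) {m : ℝ≥0∞} (hm0 : 0 < m) (hm : m < ⊤) :
    μ {y | μ {y' | f y' < f y} < m} = m := by
  have mlt : ∀ t, MeasurableSet {y | f y < t} := fun t => measurableSet_lt hf measurable_const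
  have hle : ∀ t, μ {y | f y ≤ t} = μ {y | f y < t} := by
    intro t
    have : {y | f y ≤ t} = {y | f y < t} ∪ {y | f y = t} := by
      ext y; exact le_iff_lt_or_eq (a := f y)
    rw [this]
    exact le_antisymm ((measure_union_le _ _).trans (by rw [hlev t, add_zero]))
      (measure_mono subset_union_left)
  have mono : ∀ {s t}, s ≤ t → μ {y | f y < s} ≤ μ {y | f y < t} := fun hst =>
    measure_mono fun y hy => lt_of_lt_of_le (show f y < _ from hy) hst
  set T : Set ℝ := {t | μ {y | f y < t} < m} with hT
  have hne : T.Nonempty := ⟨0, by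
    have : {y | f y < 0} = ∅ := by ext y; simpa using hf0 y
    simpa [hT, this] using hm0⟩
  have hbdd : BddAbove T := by
    have hlim := tendsto_measure_iUnion_atTop (μ := μ) (s := fun j : ℕ => {y | f y < j})
      (fun i j hij y hy => lt_of_lt_of_le (show f y < i from hy) (by exact_mod_cast hij))
    have hU : ⋃ j : ℕ, {y | f y < j} = univ := by
      ext y; simpa using exists_nat_gt (f y)
    rw [hU, huniv] at hlim
    obtain ⟨N, hN⟩ := (hlim.eventually (lt_mem_nhds hm)).exists
    exact ⟨N, fun t ht => le_of_not_gt fun hlt =>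
      absurd ((show μ {y | f y < t} < m from ht).trans hN) (mono hlt.le).not_gt⟩
  set τ := sSup T with hτ
  have h1 : μ {y | f y < τ} ≤ m := by
    have hlim := tendsto_measure_iUnion_atTop (μ := μ)
      (s := fun j : ℕ => {y | f y < τ - 1 / ((j : ℝ) + 1)})
      (fun i j hij y hy => lt_of_lt_of_le (show f y < _ from hy)
        (by have := Nat.one_div_le_one_div (α := ℝ) hij; linarith))
    have hU : ⋃ j : ℕ, {y | f y < τ - 1 / ((j : ℝ) + 1)} = {y | f y < τ} := by
      ext y
      simp only [mem_iUnion, mem_ofPred_eq]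
      constructor
      · rintro ⟨j, hj⟩
        exact hj.trans (by have : 0 < 1 / ((j : ℝ) + 1) := by positivity
                           linarith)
      · intro hy
        obtain ⟨j, hj⟩ := exists_nat_one_div_lt (sub_pos.2 hy)
        exact ⟨j, by linarith⟩
    rw [hU] at hlim
    refine le_of_tendsto' hlim fun j => ?_
    obtain ⟨t, ht, htj⟩ := exists_lt_of_lt_csSup hne
      (show τ - 1 / ((j : ℝ) + 1) < τ by have : 0 < 1 / ((j : ℝ) + 1) := by positivity
                                         linarith)
    exact (mono htj.le).trans (show μ {y | f y < t} < m from ht).le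
  have h2 : m ≤ μ {y | f y ≤ τ} := by
    have hlim := tendsto_measure_iInter_atTop (μ := μ)
      (s := fun j : ℕ => {y | f y < τ + 1 / ((j : ℝ) + 1)})
      (fun j => (mlt _).nullMeasurableSet)
      (fun i j hij y hy => lt_of_lt_of_le (show f y < _ from hy)
        (by have := Nat.one_div_le_one_div (α := ℝ) hij; linarith))
      ⟨0, (hfin _).ne⟩
    have hI : ⋂ j : ℕ, {y | f y < τ + 1 / ((j : ℝ) + 1)} = {y | f y ≤ τ} := by
      ext y
      simp only [mem_iInter, mem_ofPred_eq]
      constructor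
      · intro hy
        refine le_of_forall_pos_lt_add fun ε hε => ?_
        obtain ⟨j, hj⟩ := exists_nat_one_div_lt hε
        exact (hy j).trans (by linarith)
      · intro hy j
        have : 0 < 1 / ((j : ℝ) + 1) := by positivity
        linarith
    rw [hI] at hlim
    refine ge_of_tendsto' hlim fun j => ?_
    by_contra! hlt
    have := le_csSup hbdd (show τ + 1 / ((j : ℝ) + 1) ∈ T from hlt)
    have : 0 < 1 / ((j : ℝ) + 1) := by positivity
    linarith
  refine le_antisymm ?_ ?_
  · refine le_trans (measure_mono fun y hy => ?_) ((hle τ).le.trans h1)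
    exact le_csSup hbdd (show f y ∈ T from hy)
  · refine h2.trans ((hle τ).le.trans (measure_mono fun y hy => ?_))
    obtain ⟨t, ht, hyt⟩ := exists_lt_of_lt_csSup hne (show f y < τ from hy)
    exact (mono hyt.le).trans_lt ht

theorem lintegral_ofReal_mul_eq {Y : Type*} [MeasurableSpace Y] {μ : Measure Y} [SFinite μ]
    {f : Y → ℝ} {K : Y → ℝ≥0} (hf : Measurable f) (hK : Measurable K) :
    ∫⁻ y, ENNReal.ofReal (f y) * (K y : ℝ≥0∞) ∂μ =
      ∫⁻ a in Ioi (0 : ℝ), ∫⁻ b in Ioi (0 : ℝ), μ ({y | b < f y} ∩ {y | a < (K y : ℝ)}) := by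
  have h1 := lintegral_withDensity_eq_lintegral_mul μ (f := fun y => ENNReal.ofReal (f y))
    (by fun_prop) (g := fun y => (K y : ℝ≥0∞)) (by fun_prop)
  simp only [Pi.mul_apply] at h1
  rw [← h1, lintegral_eq_lintegral_Ioi_measure_lt _ (by fun_prop)]
  refine setLIntegral_congr_fun measurableSet_Ioi fun a (ha : 0 < a) => ?_
  have hset : {y | ENNReal.ofReal a < (K y : ℝ≥0∞)} = {y | a < (K y : ℝ)} := by
    ext y
    simp only [mem_ofPred_eq]
    rw [← ENNReal.ofReal_coe_nnreal, ENNReal.ofReal_lt_ofReal_iff_of_nonneg ha.le]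
  have hms : MeasurableSet {y | a < (K y : ℝ)} :=
    measurableSet_lt measurable_const hK.coe_nnreal_real
  rw [hset, withDensity_apply _ hms, lintegral_eq_lintegral_Ioi_measure_lt _ (by fun_prop)]
  refine setLIntegral_congr_fun measurableSet_Ioi fun b (hb : 0 < b) => ?_
  have hset' : {y | ENNReal.ofReal b < ENNReal.ofReal (f y)} = {y | b < f y} := by
    ext y
    simp only [mem_ofPred_eq]
    rw [ENNReal.ofReal_lt_ofReal_iff_of_nonneg hb.le]
  rw [hset', Measure.restrict_apply (measurableSet_lt measurable_const hf)]

theorem measure_sub_le_measure_inter {Y : Type*} [MeasurableSpace Y] {μ : Measure Y} (f : Y → ℝ)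
    (b : ℝ) (S : Set Y) : μ S - μ {y | f y ≤ b} ≤ μ ({y | b < f y} ∩ S) := by
  refine tsub_le_iff_right.2 (le_trans (measure_mono fun y hy => ?_) (measure_union_le _ _))
  rcases le_or_gt (f y) b with h | h
  · exact Or.inr h
  · exact Or.inl ⟨h, hy⟩

/-- The bathtub principle: the bound is attained when `S` and `{f ≤ b}` are nested. -/
theorem measure_inter_eq_of_nested {Y : Type*} [MeasurableSpace Y] {μ : Measure Y} {f : Y → ℝ}
    (hf : Measurable f) {b : ℝ} {S : Set Y} (hS : μ S ≠ ⊤)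
    (h : S ⊆ {y | f y ≤ b} ∨ {y | f y ≤ b} ⊆ S) :
    μ ({y | b < f y} ∩ S) = μ S - μ {y | f y ≤ b} := by
  rcases h with h | h
  · rw [tsub_eq_zero_of_le (measure_mono h)]
    refine measure_mono_null (t := ∅) (fun y hy => ?_) measure_empty
    exact absurd (show b < f y from hy.1) (not_lt.2 (h hy.2))
  · rw [← measure_sdiff h (measurableSet_le hf measurable_const).nullMeasurableSet
      (ne_top_of_le_ne_top hS (measure_mono h))]
    congr 1
    ext y
    simp [and_comm]

theorem lintegral_sub_measure_eq (V : ℝ → ℝ≥0∞) (hV : Measurable V) {m : ℝ≥0∞} (hm : m ≠ ⊤) :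
    ∫⁻ b in Ioi (0 : ℝ), (m - V b) =
      ∫⁻ σ in Ioi (0 : ℝ), (if ENNReal.ofReal σ < m then
        volume {b : ℝ | 0 < b ∧ V b < ENNReal.ofReal σ} else 0) := by
  have hS : MeasurableSet {p : ℝ × ℝ | 0 < p.1 ∧ 0 < p.2 ∧ V p.1 < ENNReal.ofReal p.2 ∧
      ENNReal.ofReal p.2 < m} := by
    refine (measurableSet_lt measurable_const measurable_fst).inter
      ((measurableSet_lt measurable_const measurable_snd).inter
      ((measurableSet_lt (hV.comp measurable_fst) (measurable_snd.ennreal_ofReal)).inter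
      (measurableSet_lt measurable_snd.ennreal_ofReal measurable_const)))
  have h1 := Measure.prod_apply (μ := (volume : Measure ℝ)) (ν := (volume : Measure ℝ)) hS
  have h2 := Measure.prod_apply_symm (μ := (volume : Measure ℝ)) (ν := (volume : Measure ℝ)) hS
  rw [← lintegral_indicator measurableSet_Ioi, ← lintegral_indicator measurableSet_Ioi]
  refine Eq.trans (lintegral_congr fun b => ?_) ((h1.symm.trans h2).trans
    (lintegral_congr fun σ => ?_))
  · by_cases hb : 0 < b
    · rw [indicator_of_mem (show b ∈ Ioi (0 : ℝ) from hb)]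
      simp only [preimage_ofPred_eq, hb, true_and]
      rcases eq_or_ne (V b) ⊤ with hV' | hV'
      · simp [hV']
      · have : {σ : ℝ | 0 < σ ∧ V b < ENNReal.ofReal σ ∧ ENNReal.ofReal σ < m} =
            Ioo (V b).toReal m.toReal := by
          ext σ
          simp only [mem_ofPred_eq, mem_Ioo]
          constructor
          · rintro ⟨h0, h1, h2⟩
            exact ⟨(ENNReal.lt_ofReal_iff_toReal_lt hV').1 h1,
              (ENNReal.ofReal_lt_iff_lt_toReal h0.le hm).1 h2⟩
          · rintro ⟨h1, h2⟩
            have h0 : 0 < σ := ENNReal.toReal_nonneg.trans_lt h1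
            exact ⟨h0, (ENNReal.lt_ofReal_iff_toReal_lt hV').2 h1,
              (ENNReal.ofReal_lt_iff_lt_toReal h0.le hm).2 h2⟩
        rw [this, Real.volume_Ioo, ENNReal.ofReal_sub _ ENNReal.toReal_nonneg,
          ENNReal.ofReal_toReal hV', ENNReal.ofReal_toReal hm]
    · simp [hb]
  · by_cases hσ : 0 < σ
    · rw [indicator_of_mem (show σ ∈ Ioi (0 : ℝ) from hσ)]
      by_cases hσm : ENNReal.ofReal σ < m <;> simp [hσ, hσm]
    · simp [hσ]

/-- The increasing rearrangement is midpoint convex, by the Brunn–Minkowski inequality. -/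
theorem two_mul_volume_setOf_le {k : ℕ} {f f₁ f₂ : EuclideanSpace ℝ (Fin k) → ℝ}
    (hf : Measurable f) (hf₁ : Measurable f₁) (hf₂ : Measurable f₂)
    (H : ∀ x y, f ((2⁻¹ : ℝ) • (x + y)) ≤ 2⁻¹ * (f₁ x + f₂ y)) (σ : ℝ≥0∞) :
    2 * volume {b : ℝ | 0 < b ∧ volume {y | f y ≤ b} < σ} ≤
      volume {b : ℝ | 0 < b ∧ volume {y | f₁ y ≤ b} < σ} +
      volume {b : ℝ | 0 < b ∧ volume {y | f₂ y ≤ b} < σ} := by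
  have mono : ∀ (g : EuclideanSpace ℝ (Fin k) → ℝ) {a b : ℝ}, a ≤ b →
      volume {y | g y ≤ a} ≤ volume {y | g y ≤ b} := fun g a b hab =>
    measure_mono fun y hy => le_trans (show g y ≤ a from hy) hab
  have aux : ∀ (g : EuclideanSpace ℝ (Fin k) → ℝ) (t : ℝ), 0 < t →
      volume {b : ℝ | 0 < b ∧ volume {y | g y ≤ b} < σ} < ENNReal.ofReal t →
      σ ≤ volume {y | g y ≤ t} := by
    intro g t ht hlt
    by_contra! hcon
    have : Ioc 0 t ⊆ {b : ℝ | 0 < b ∧ volume {y | g y ≤ b} < σ} :=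
      fun b hb => ⟨hb.1, (mono g hb.2).trans_lt hcon⟩
    have := measure_mono (μ := volume) this
    rw [Real.volume_Ioc, sub_zero] at this
    exact absurd hlt this.not_gt
  set T₁ := volume {b : ℝ | 0 < b ∧ volume {y | f₁ y ≤ b} < σ}
  set T₂ := volume {b : ℝ | 0 < b ∧ volume {y | f₂ y ≤ b} < σ}
  rcases eq_or_ne T₁ ⊤ with h1 | h1
  · simp [h1]
  rcases eq_or_ne T₂ ⊤ with h2 | h2
  · simp [h2]
  refine ENNReal.le_of_forall_pos_le_add fun ε hε _ => ?_
  set t₁ : ℝ := T₁.toReal + ε / 2 with ht₁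
  set t₂ : ℝ := T₂.toReal + ε / 2 with ht₂
  have hε' : (0 : ℝ) < ε := hε
  have p1 : 0 < t₁ := by have := ENNReal.toReal_nonneg (a := T₁); linarith
  have p2 : 0 < t₂ := by have := ENNReal.toReal_nonneg (a := T₂); linarith
  have s1 := aux f₁ t₁ p1 ((ENNReal.lt_ofReal_iff_toReal_lt h1).2 (by linarith))
  have s2 := aux f₂ t₂ p2 ((ENNReal.lt_ofReal_iff_toReal_lt h2).2 (by linarith))
  have s0 : σ ≤ volume {y | f y ≤ 2⁻¹ * (t₁ + t₂)} :=
    le_volume_of_midpoint (measurableSet_le hf₁ measurable_const)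
      (measurableSet_le hf₂ measurable_const) (measurableSet_le hf measurable_const) s1 s2
      fun a ha b hb => (H a b).trans (by
        have ha' : f₁ a ≤ t₁ := ha
        have hb' : f₂ b ≤ t₂ := hb
        linarith)
  have hsub : {b : ℝ | 0 < b ∧ volume {y | f y ≤ b} < σ} ⊆ Ioo 0 (2⁻¹ * (t₁ + t₂)) :=
    fun b hb => ⟨hb.1, lt_of_not_ge fun hle => absurd hb.2 (s0.trans (mono f hle)).not_gt⟩
  calc 2 * volume {b : ℝ | 0 < b ∧ volume {y | f y ≤ b} < σ}
      ≤ 2 * volume (Ioo 0 (2⁻¹ * (t₁ + t₂))) := by gcongr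
    _ = ENNReal.ofReal (T₁.toReal + T₂.toReal + ε) := by
        rw [Real.volume_Ioo, sub_zero, ← ENNReal.ofReal_ofNat, ← ENNReal.ofReal_mul (by norm_num)]
        congr 1
        rw [ht₁, ht₂]; ring
    _ = T₁ + T₂ + ε := by
        rw [ENNReal.ofReal_add (by positivity) (by positivity),
          ENNReal.ofReal_add (by positivity) (by positivity), ENNReal.ofReal_toReal h1,
          ENNReal.ofReal_toReal h2, ENNReal.ofReal_coe_nnreal]

theorem measurable_volume_setOf_le {k : ℕ} (f : EuclideanSpace ℝ (Fin k) → ℝ) :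
    Measurable fun b : ℝ => volume {y | f y ≤ b} :=
  Monotone.measurable fun _ _ hab => measure_mono fun _ hy => le_trans (b := _) hy hab

/-- The midpoint inequality on a slice. The kernel `K` is nested with `f`, so `∫ f K` is minimal
among the kernels with the same distribution function. -/
theorem two_mul_lintegral_le_of_nested {k : ℕ} {f f₁ f₂ : EuclideanSpace ℝ (Fin k) → ℝ}
    {K K₁ K₂ : EuclideanSpace ℝ (Fin k) → ℝ≥0}
    (hf : Measurable f) (hf₁ : Measurable f₁) (hf₂ : Measurable f₂)
    (hK : Measurable K) (hK₁ : Measurable K₁) (hK₂ : Measurable K₂)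
    (H : ∀ x y, f ((2⁻¹ : ℝ) • (x + y)) ≤ 2⁻¹ * (f₁ x + f₂ y))
    (hfin : ∀ a : ℝ, 0 < a → volume {y | a < (K y : ℝ)} ≠ ⊤)
    (e₁ : ∀ a : ℝ, 0 < a → volume {y | a < (K₁ y : ℝ)} = volume {y | a < (K y : ℝ)})
    (e₂ : ∀ a : ℝ, 0 < a → volume {y | a < (K₂ y : ℝ)} = volume {y | a < (K y : ℝ)})
    (hnest : ∀ y y', f y ≤ f y' → K y' ≤ K y) :
    2 * ∫⁻ y, ENNReal.ofReal (f y) * (K y : ℝ≥0∞) ≤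
      (∫⁻ y, ENNReal.ofReal (f₁ y) * (K₁ y : ℝ≥0∞)) +
        ∫⁻ y, ENNReal.ofReal (f₂ y) * (K₂ y : ℝ≥0∞) := by
  have low : ∀ {g : EuclideanSpace ℝ (Fin k) → ℝ} {L : EuclideanSpace ℝ (Fin k) → ℝ≥0},
      Measurable g → Measurable L →
      (∀ a : ℝ, 0 < a → volume {y | a < (L y : ℝ)} = volume {y | a < (K y : ℝ)}) →
      ∫⁻ a in Ioi (0 : ℝ), ∫⁻ b in Ioi (0 : ℝ),
        (volume {y | a < (K y : ℝ)} - volume {y | g y ≤ b}) ≤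
      ∫⁻ y, ENNReal.ofReal (g y) * (L y : ℝ≥0∞) := by
    intro g L hg hL hLK
    rw [lintegral_ofReal_mul_eq hg hL]
    refine setLIntegral_mono' measurableSet_Ioi fun a ha => lintegral_mono fun b => ?_
    rw [← hLK a ha]
    exact measure_sub_le_measure_inter g b _
  have eq0 : ∫⁻ y, ENNReal.ofReal (f y) * (K y : ℝ≥0∞) =
      ∫⁻ a in Ioi (0 : ℝ), ∫⁻ b in Ioi (0 : ℝ),
        (volume {y | a < (K y : ℝ)} - volume {y | f y ≤ b}) := by
    rw [lintegral_ofReal_mul_eq hf hK]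
    refine setLIntegral_congr_fun measurableSet_Ioi fun a ha => lintegral_congr fun b => ?_
    refine measure_inter_eq_of_nested hf (hfin a ha) ?_
    by_contra! hcon
    obtain ⟨h1, h2⟩ := hcon
    obtain ⟨y, hy, hyb⟩ := not_subset.1 h1
    obtain ⟨y', hy', hya⟩ := not_subset.1 h2
    have h3 : f y' ≤ f y := le_trans (show f y' ≤ b from hy') (not_le.1 hyb).le
    have h4 : (K y : ℝ) ≤ K y' := by exact_mod_cast hnest _ _ h3
    exact hya (lt_of_lt_of_le (show a < (K y : ℝ) from hy) h4)
  refine le_trans ?_ (add_le_add (low hf₁ hK₁ e₁) (low hf₂ hK₂ e₂))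
  rw [eq0, ← lintegral_const_mul' _ _ (by simp)]
  have hanti : Antitone fun a : ℝ => ∫⁻ b in Ioi (0 : ℝ),
      (volume {y | a < (K y : ℝ)} - volume {y | f₁ y ≤ b}) := fun a a' haa' =>
    lintegral_mono fun b => tsub_le_tsub_right
      (measure_mono fun y hy => lt_of_le_of_lt haa' (show a' < (K y : ℝ) from hy)) _
  rw [← lintegral_add_left hanti.measurable]
  refine setLIntegral_mono' measurableSet_Ioi fun a ha => ?_
  have hm := hfin a ha
  rw [lintegral_sub_measure_eq _ (measurable_volume_setOf_le f) hm,
    lintegral_sub_measure_eq _ (measurable_volume_setOf_le f₁) hm,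
    lintegral_sub_measure_eq _ (measurable_volume_setOf_le f₂) hm,
    ← lintegral_const_mul' _ _ (by simp)]
  have hmono : Monotone fun σ : ℝ =>
      volume {b : ℝ | 0 < b ∧ volume {y | f₁ y ≤ b} < ENNReal.ofReal σ} := fun σ σ' h =>
    measure_mono fun b hb => ⟨hb.1, hb.2.trans_le (ENNReal.ofReal_le_ofReal h)⟩
  rw [← lintegral_add_left (Measurable.ite (measurableSet_lt (by fun_prop) measurable_const)
    hmono.measurable measurable_const)]
  refine lintegral_mono fun σ => ?_
  by_cases hσ : ENNReal.ofReal σ < volume {y | a < (K y : ℝ)}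
  · simpa only [hσ, if_true] using two_mul_volume_setOf_le hf hf₁ hf₂ H (ENNReal.ofReal σ)
  · simp [hσ]

/-- The radius of the ball of `ℝᵏ` of volume `v`. -/
noncomputable def radiusOfVolume (k : ℕ) (v : ℝ≥0∞) : ℝ :=
  ((v / volume (Metric.ball (0 : EuclideanSpace ℝ (Fin k)) 1)).toReal) ^ ((k : ℝ)⁻¹)

theorem radiusOfVolume_lt_iff {k : ℕ} (hk : 1 ≤ k) {v : ℝ≥0∞} (hv : v ≠ ⊤) {R : ℝ} (hR : 0 < R) :
    radiusOfVolume k v < R ↔ v < volume (Metric.ball (0 : EuclideanSpace ℝ (Fin k)) R) := by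
  have hk0 : (0 : ℝ) < k := by exact_mod_cast hk
  set ω := volume (Metric.ball (0 : EuclideanSpace ℝ (Fin k)) 1) with hω
  have hω0 : ω ≠ 0 := (Metric.measure_ball_pos _ _ one_pos).ne'
  have hωt : ω ≠ ⊤ := measure_ball_lt_top.ne
  rw [Measure.addHaar_ball_of_pos _ _ hR, finrank_euclideanSpace, Fintype.card_fin,
    radiusOfVolume, ← hω, Real.rpow_inv_lt_iff_of_pos ENNReal.toReal_nonneg hR.le hk0,
    Real.rpow_natCast, ← ENNReal.lt_ofReal_iff_toReal_lt (ENNReal.div_ne_top hv hω0),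
    ENNReal.div_lt_iff (Or.inl hω0) (Or.inl hωt)]

theorem radiusOfVolume_nonneg (k : ℕ) (v : ℝ≥0∞) : 0 ≤ radiusOfVolume k v :=
  Real.rpow_nonneg ENNReal.toReal_nonneg _

theorem radiusOfVolume_mono {k : ℕ} {v w : ℝ≥0∞} (hw : w ≠ ⊤) (h : v ≤ w) :
    radiusOfVolume k v ≤ radiusOfVolume k w := by
  have hω0 : volume (Metric.ball (0 : EuclideanSpace ℝ (Fin k)) 1) ≠ 0 :=
    (Metric.measure_ball_pos _ _ one_pos).ne'
  refine Real.rpow_le_rpow ENNReal.toReal_nonneg ?_ (by positivity)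
  exact ENNReal.toReal_mono (ENNReal.div_ne_top hw hω0) (by gcongr)

open Classical in
/-- An optimal kernel for a function with null level sets on slices: on the slice of height
`z ≠ 0`, its value at `y` is the value of `|(y', z)| ^ (-n - 2 s)` at a point `y'` for which the
ball of radius `|y'|` has the measure of the sublevel set of `y`. -/
noncomputable def rearrangedKernel (n k : ℕ) (s : ℝ) (W : EuclideanSpace ℝ (Fin n) → ℝ)
    (x : EuclideanSpace ℝ (Fin n)) : ℝ≥0 :=
  if lastCoords k x = 0 then fracKernel n s x else
    Real.toNNReal (Real.sqrt ((radiusOfVolume k (volume {y : EuclideanSpace ℝ (Fin k) |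
      W (joinCoords y (lastCoords k x)) < W x})) ^ 2 + ‖lastCoords k x‖ ^ 2) ^ (-(n : ℝ) - 2 * s))

theorem measurable_rearrangedKernel {n k : ℕ} {s : ℝ} {W : EuclideanSpace ℝ (Fin n) → ℝ}
    (hW : Measurable W) : Measurable (rearrangedKernel n k s W) := by
  have hl := measurable_lastCoords (n := n) (k := k)
  refine Measurable.ite (hl (measurableSet_singleton 0)) (measurable_fracKernel n s) ?_
  have hV : Measurable fun x : EuclideanSpace ℝ (Fin n) => volume {y : EuclideanSpace ℝ (Fin k) |
      W (joinCoords y (lastCoords k x)) < W x} := by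
    refine measurable_measure_prodMk_left (ν := (volume : Measure (EuclideanSpace ℝ (Fin k))))
      (s := {p : EuclideanSpace ℝ (Fin n) × EuclideanSpace ℝ (Fin k) |
        W (joinCoords p.2 (lastCoords k p.1)) < W p.1}) ?_
    refine measurableSet_lt (hW.comp (measurable_joinCoords.comp
      (f := fun p : EuclideanSpace ℝ (Fin n) × EuclideanSpace ℝ (Fin k) =>
        (p.2, lastCoords k p.1)) ?_)) (hW.comp measurable_fst)
    exact measurable_snd.prodMk (hl.comp measurable_fst)
  have : Measurable (radiusOfVolume k) := by unfold radiusOfVolume; fun_prop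
  fun_prop

theorem rearrangedKernel_joinCoords {n k : ℕ} {s : ℝ} {W : EuclideanSpace ℝ (Fin n) → ℝ}
    {z : EuclideanSpace ℝ (Fin (n - k))} (hz : z ≠ 0) (y : EuclideanSpace ℝ (Fin k)) :
    (rearrangedKernel n k s W (joinCoords y z) : ℝ) =
      Real.sqrt ((radiusOfVolume k (volume {y' : EuclideanSpace ℝ (Fin k) |
      W (joinCoords y' z) < W (joinCoords y z)})) ^ 2 + ‖z‖ ^ 2) ^ (-(n : ℝ) - 2 * s) := by
  rw [rearrangedKernel, lastCoords_joinCoords, if_neg hz, Real.coe_toNNReal _ (by positivity)]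

theorem rearrangedKernel_anti {n k : ℕ} {s : ℝ} (hs : 0 < s) {W : EuclideanSpace ℝ (Fin n) → ℝ}
    {z : EuclideanSpace ℝ (Fin (n - k))} (hz : z ≠ 0)
    (hfin : ∀ t, volume {y : EuclideanSpace ℝ (Fin k) | W (joinCoords y z) < t} < ⊤)
    {y y' : EuclideanSpace ℝ (Fin k)} (h : W (joinCoords y z) ≤ W (joinCoords y' z)) :
    rearrangedKernel n k s W (joinCoords y' z) ≤ rearrangedKernel n k s W (joinCoords y z) := by
  rw [← NNReal.coe_le_coe, rearrangedKernel_joinCoords hz, rearrangedKernel_joinCoords hz]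
  have hz' : 0 < ‖z‖ := norm_pos_iff.2 hz
  have hneg : -(n : ℝ) - 2 * s ≤ 0 := by have := n.cast_nonneg (α := ℝ); linarith
  refine Real.rpow_le_rpow_of_nonpos (by positivity) ?_ hneg
  refine Real.sqrt_le_sqrt ?_
  gcongr
  · exact radiusOfVolume_nonneg _ _
  · refine radiusOfVolume_mono (hfin _).ne (measure_mono fun w hw => ?_)
    exact lt_of_lt_of_le (show W (joinCoords w z) < _ from hw) h

theorem rearrangedKernel_mem {n k : ℕ} {s : ℝ} (hk : 1 ≤ k) (hkn : k ≤ n) (hs : 0 < s)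
    {W : EuclideanSpace ℝ (Fin n) → ℝ} (hW : Measurable W) (hW0 : ∀ x, 0 ≤ W x)
    (hfin : ∀ z t, volume {y : EuclideanSpace ℝ (Fin k) | W (joinCoords y z) < t} < ⊤)
    (hlev : ∀ z t, volume {y : EuclideanSpace ℝ (Fin k) | W (joinCoords y z) = t} = 0) :
    rearrangedKernel n k s W ∈ admissibleKernels n k s := by
  refine ⟨measurable_rearrangedKernel hW, fun z r hr => ?_⟩
  rcases eq_or_ne z 0 with rfl | hz
  · rw [← (fracKernel_mem hk hkn hs).2 0 r hr]
    simp [rearrangedKernel, lastCoords_joinCoords]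
  have hz' : 0 < ‖z‖ := norm_pos_iff.2 hz
  have hne : Nonempty (Fin k) := ⟨⟨0, hk⟩⟩
  have hneg : -(n : ℝ) - 2 * s < 0 := by have := n.cast_nonneg (α := ℝ); linarith
  simp_rw [rearrangedKernel_joinCoords hz]
  have hiff : ∀ ρ : ℝ, r ^ (-(n : ℝ) - 2 * s) < Real.sqrt (ρ ^ 2 + ‖z‖ ^ 2) ^ (-(n : ℝ) - 2 * s) ↔
      ρ ^ 2 + ‖z‖ ^ 2 < r ^ 2 := by
    intro ρ
    rw [Real.rpow_lt_rpow_iff_of_neg hr (by positivity) hneg, Real.sqrt_lt' hr]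
  simp_rw [hiff]
  split_ifs with hzr
  · have hpos : 0 < r ^ 2 - ‖z‖ ^ 2 := by nlinarith
    have hR : 0 < Real.sqrt (r ^ 2 - ‖z‖ ^ 2) := Real.sqrt_pos.2 hpos
    have hset : ∀ y : EuclideanSpace ℝ (Fin k), (radiusOfVolume k (volume
        {y' : EuclideanSpace ℝ (Fin k) | W (joinCoords y' z) < W (joinCoords y z)})) ^ 2 + ‖z‖ ^ 2
        < r ^ 2 ↔ volume {y' : EuclideanSpace ℝ (Fin k) | W (joinCoords y' z) < W (joinCoords y z)}
          < volume (Metric.ball (0 : EuclideanSpace ℝ (Fin k)) (Real.sqrt (r ^ 2 - ‖z‖ ^ 2))) := by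
      intro y
      rw [← radiusOfVolume_lt_iff hk (hfin _ _).ne hR, Real.lt_sqrt (radiusOfVolume_nonneg _ _),
        lt_sub_iff_add_lt]
    simp_rw [hset]
    exact measure_setOf_measure_lt_lt
      (hW.comp (measurable_joinCoords.comp (measurable_id.prodMk measurable_const)))
      (fun y => hW0 _) (hlev z) (hfin z) (by simp)
      (Metric.measure_ball_pos _ _ hR) measure_ball_lt_top
  · refine measure_mono_null (t := ∅) (fun y hy => ?_) measure_empty
    have hy' : (radiusOfVolume k (volume {y' : EuclideanSpace ℝ (Fin k) |
      W (joinCoords y' z) < W (joinCoords y z)})) ^ 2 + ‖z‖ ^ 2 < r ^ 2 := hy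
    have : r ≤ ‖z‖ := not_lt.1 hzr
    nlinarith [sq_nonneg (radiusOfVolume k (volume {y' : EuclideanSpace ℝ (Fin k) |
      W (joinCoords y' z) < W (joinCoords y z)}))]

/-- All admissible kernels have the same distribution functions on slices. -/
theorem volume_setOf_lt_eq {n k : ℕ} {s : ℝ} (hs : 0 < s) {K K' : EuclideanSpace ℝ (Fin n) → ℝ≥0}
    (hK : K ∈ admissibleKernels n k s) (hK' : K' ∈ admissibleKernels n k s)
    (z : EuclideanSpace ℝ (Fin (n - k))) {a : ℝ} (ha : 0 < a) :
    volume {y : EuclideanSpace ℝ (Fin k) | a < (K (joinCoords y z) : ℝ)} =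
      volume {y : EuclideanSpace ℝ (Fin k) | a < (K' (joinCoords y z) : ℝ)} ∧
    volume {y : EuclideanSpace ℝ (Fin k) | a < (K (joinCoords y z) : ℝ)} ≠ ⊤ := by
  have hneg : -(n : ℝ) - 2 * s < 0 := by have := n.cast_nonneg (α := ℝ); linarith
  have hr : 0 < a ^ (-(n : ℝ) - 2 * s)⁻¹ := Real.rpow_pos_of_pos ha _
  have e : (a ^ (-(n : ℝ) - 2 * s)⁻¹) ^ (-(n : ℝ) - 2 * s) = a := by
    rw [← Real.rpow_mul ha.le, inv_mul_cancel₀ hneg.ne, Real.rpow_one]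
  have h1 := hK.2 z _ hr
  have h2 := hK'.2 z _ hr
  rw [e] at h1 h2
  refine ⟨h1.trans h2.symm, ?_⟩
  rw [h1]
  split_ifs
  · exact measure_ball_lt_top.ne
  · simp

/-- The midpoint inequality for the minimal energy. -/
theorem two_mul_kernelInf_le {n k : ℕ} {s : ℝ} (hk : 1 ≤ k) (hkn : k < n) (hs : 0 < s)
    {W W₁ W₂ : EuclideanSpace ℝ (Fin n) → ℝ} (hW : Measurable W) (hW₁ : Measurable W₁)
    (hW₂ : Measurable W₂) (hW0 : ∀ x, 0 ≤ W x)
    (hfin : ∀ z t, volume {y : EuclideanSpace ℝ (Fin k) | W (joinCoords y z) < t} < ⊤)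
    (hlev : ∀ z t, volume {y : EuclideanSpace ℝ (Fin k) | W (joinCoords y z) = t} = 0)
    (H : ∀ p q, W ((2⁻¹ : ℝ) • (p + q)) ≤ 2⁻¹ * (W₁ p + W₂ q)) :
    2 * kernelInf n k s W ≤ kernelInf n k s W₁ + kernelInf n k s W₂ := by
  have hmem := rearrangedKernel_mem hk hkn.le hs hW hW0 hfin hlev
  have mR := hmem.1
  have hmeas : ∀ z : EuclideanSpace ℝ (Fin (n - k)),
      Measurable fun y : EuclideanSpace ℝ (Fin k) => joinCoords (n := n) y z := fun z =>
    measurable_joinCoords.comp (measurable_id.prodMk measurable_const)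
  have key : ∀ K₁ ∈ admissibleKernels n k s, ∀ K₂ ∈ admissibleKernels n k s,
      2 * kernelInf n k s W ≤ (∫⁻ x, ENNReal.ofReal (W₁ x) * (K₁ x : ℝ≥0∞)) +
        ∫⁻ x, ENNReal.ofReal (W₂ x) * (K₂ x : ℝ≥0∞) := by
    intro K₁ hK₁ K₂ hK₂
    have mK₁ := hK₁.1
    have mK₂ := hK₂.1
    have m1 : Measurable fun x => ENNReal.ofReal (W₁ x) * (K₁ x : ℝ≥0∞) := by fun_prop
    have m2 : Measurable fun x => ENNReal.ofReal (W₂ x) * (K₂ x : ℝ≥0∞) := by fun_prop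
    refine (mul_le_mul_right (iInf₂_le _ hmem) 2).trans ?_
    rw [lintegral_joinCoords hkn.le (by fun_prop), lintegral_joinCoords hkn.le m1,
      lintegral_joinCoords hkn.le m2, ← lintegral_const_mul' _ _ (by simp)]
    have m3 : Measurable fun z : EuclideanSpace ℝ (Fin (n - k)) => ∫⁻ y : EuclideanSpace ℝ (Fin k),
        ENNReal.ofReal (W₁ (joinCoords y z)) * (K₁ (joinCoords y z) : ℝ≥0∞) :=
      (m1.comp measurable_joinCoords).lintegral_prod_left'
    rw [← lintegral_add_left m3]
    have hne : Nonempty (Fin (n - k)) := ⟨⟨0, by omega⟩⟩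
    have hae : ∀ᵐ z : EuclideanSpace ℝ (Fin (n - k)), z ≠ 0 := by
      simp [ae_iff]
    refine lintegral_mono_ae (hae.mono fun z hz => ?_)
    refine two_mul_lintegral_le_of_nested (f := fun y => W (joinCoords y z))
      (f₁ := fun y => W₁ (joinCoords y z)) (f₂ := fun y => W₂ (joinCoords y z))
      (K := fun y => rearrangedKernel n k s W (joinCoords y z))
      (K₁ := fun y => K₁ (joinCoords y z)) (K₂ := fun y => K₂ (joinCoords y z))
      (hW.comp (hmeas z)) (hW₁.comp (hmeas z)) (hW₂.comp (hmeas z)) (mR.comp (hmeas z))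
      (mK₁.comp (hmeas z)) (mK₂.comp (hmeas z)) (fun x y => ?_)
      (fun a ha => (volume_setOf_lt_eq hs hmem hmem z ha).2)
      (fun a ha => (volume_setOf_lt_eq hs hK₁ hmem z ha).1)
      (fun a ha => (volume_setOf_lt_eq hs hK₂ hmem z ha).1)
      (fun y y' h => rearrangedKernel_anti hs hz (hfin z) h)
    have := H (joinCoords x z) (joinCoords y z)
    rwa [smul_add, ← joinCoords_combo _ _ _ (by norm_num), ← smul_add] at this
  have h1 : ∀ K₁ ∈ admissibleKernels n k s, 2 * kernelInf n k s W ≤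
      (∫⁻ x, ENNReal.ofReal (W₁ x) * (K₁ x : ℝ≥0∞)) + kernelInf n k s W₂ := by
    intro K₁ hK₁
    conv_rhs => rw [kernelInf]
    simp only [ENNReal.add_iInf]
    exact le_iInf₂ fun K₂ hK₂ => key K₁ hK₁ K₂ hK₂
  conv_rhs => rw [kernelInf]
  simp only [ENNReal.iInf_add]
  exact le_iInf₂ fun K₁ hK₁ => h1 K₁ hK₁

/-! ### Subgradients of convex functions -/

theorem mem_subdifferentialAt_iff {n : ℕ} {u : EuclideanSpace ℝ (Fin n) → ℝ}
    {x p : EuclideanSpace ℝ (Fin n)} :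
    p ∈ subdifferentialAt u x ↔ ∀ h, u x + inner ℝ h p ≤ u (x + h) := by
  constructor
  · rintro ⟨b, hb, H⟩ h
    have := H (x + h)
    rw [inner_add_left] at this
    linarith
  · intro H
    refine ⟨u x - inner ℝ x p, by ring, fun y => ?_⟩
    have := H (y - x)
    rw [inner_sub_left, add_sub_cancel] at this
    linarith

theorem subdifferentialAt_nonempty {n : ℕ} {u : EuclideanSpace ℝ (Fin n) → ℝ}
    (hc : Continuous u) (hu : ConvexOn ℝ univ u) (x : EuclideanSpace ℝ (Fin n)) :
    (subdifferentialAt u x).Nonempty := by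
  have hopen : IsOpen {q : EuclideanSpace ℝ (Fin n) × ℝ | q.1 ∈ univ ∧ u q.1 < q.2} := by
    simp only [mem_univ, true_and]
    exact isOpen_lt (by fun_prop) (by fun_prop)
  obtain ⟨f, hf⟩ := geometric_hahn_banach_open_point hu.convex_strict_epigraph hopen
    (x := (x, u x)) (by simp)
  set l : EuclideanSpace ℝ (Fin n) →L[ℝ] ℝ := f.comp (.inl ℝ _ ℝ) with hl
  set c : ℝ := f (0, 1) with hc'
  have hsplit : ∀ (y : EuclideanSpace ℝ (Fin n)) (t : ℝ), f (y, t) = l y + c * t := by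
    intro y t
    have : ((y, t) : EuclideanSpace ℝ (Fin n) × ℝ) =
        (y, 0) + t • ((0 : EuclideanSpace ℝ (Fin n)), (1 : ℝ)) := by
      simp
    rw [this, map_add, map_smul, smul_eq_mul, mul_comm]
    rfl
  have hcneg : c < 0 := by
    have := hf (x, u x + 1) (by simp)
    rw [hsplit, hsplit] at this
    linarith
  have key : ∀ y, l y + c * u y ≤ l x + c * u x := by
    intro y
    have hlim : Tendsto (fun ε : ℝ => l y + c * (u y + ε)) (𝓝[>] 0) (𝓝 (l y + c * (u y + 0))) := by
      have : Continuous fun ε : ℝ => l y + c * (u y + ε) := by fun_prop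
      exact (this.tendsto 0).mono_left nhdsWithin_le_nhds
    rw [add_zero] at hlim
    refine le_of_tendsto hlim (eventually_mem_nhdsWithin.mono fun ε (hε : 0 < ε) => ?_)
    have := hf (y, u y + ε) (by simpa using hε)
    rw [hsplit, hsplit] at this
    exact this.le
  refine ⟨(InnerProductSpace.toDual ℝ _).symm ((-c)⁻¹ • l), mem_subdifferentialAt_iff.2 fun h => ?_⟩
  rw [real_inner_comm, InnerProductSpace.toDual_symm_apply]
  have h1 := key (x + h)
  rw [map_add] at h1
  have h2 : l h ≤ (-c) * (u (x + h) - u x) := by linarith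
  have hc2 : 0 < -c := by linarith
  have h3 : (-c)⁻¹ * l h ≤ u (x + h) - u x := by
    rw [inv_mul_le_iff₀ hc2]; exact h2
  simp only [smul_apply, smul_eq_mul]
  linarith

theorem norm_le_of_mem_subdifferentialAt {n : ℕ} {u : EuclideanSpace ℝ (Fin n) → ℝ} {A : ℝ}
    (hA : ∀ x, u x ≤ A * (1 + ‖x‖)) {x p : EuclideanSpace ℝ (Fin n)}
    (hp : p ∈ subdifferentialAt u x) (hA0 : 0 ≤ A) : ‖p‖ ≤ A := by
  rw [mem_subdifferentialAt_iff] at hp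
  by_contra! hlt
  have h1 : ∀ t : ℝ, 0 ≤ t → t * (‖p‖ * (‖p‖ - A)) ≤ A * (1 + ‖x‖) - u x := by
    intro t ht
    have h2 := hp (t • p)
    have h3 := hA (x + t • p)
    rw [inner_smul_left, real_inner_self_eq_norm_sq] at h2
    simp only [RCLike.conj_to_real] at h2
    have h4 : ‖x + t • p‖ ≤ ‖x‖ + t * ‖p‖ := by
      refine (norm_add_le _ _).trans ?_
      rw [norm_smul, Real.norm_of_nonneg ht]
    nlinarith
  have hpos : 0 < ‖p‖ * (‖p‖ - A) := mul_pos (by linarith) (by linarith)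
  set M := A * (1 + ‖x‖) - u x
  have h5 := h1 ((|M| + 1) / (‖p‖ * (‖p‖ - A))) (by positivity)
  rw [div_mul_cancel₀ _ hpos.ne'] at h5
  linarith [le_abs_self M]

theorem abs_sub_le_of_growth {n : ℕ} {u : EuclideanSpace ℝ (Fin n) → ℝ} (hc : Continuous u)
    (hu : ConvexOn ℝ univ u) {A : ℝ} (hA : ∀ x, u x ≤ A * (1 + ‖x‖)) (hA0 : 0 ≤ A)
    (x y : EuclideanSpace ℝ (Fin n)) : |u x - u y| ≤ A * ‖x - y‖ := by
  have key : ∀ a b, u a - u b ≤ A * ‖a - b‖ := by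
    intro a b
    obtain ⟨p, hp⟩ := subdifferentialAt_nonempty hc hu a
    have h1 := norm_le_of_mem_subdifferentialAt hA hp hA0
    have h2 := mem_subdifferentialAt_iff.1 hp (b - a)
    rw [add_sub_cancel] at h2
    have h3 := abs_le.1 (abs_real_inner_le_norm (b - a) p)
    rw [norm_sub_rev] at h3
    nlinarith [norm_nonneg (a - b)]
  rw [abs_sub_le_iff]
  refine ⟨key x y, ?_⟩
  rw [norm_sub_rev]
  exact key y x

/-- The difference `u (x + h) - u x - h · p` between `u` and an affine function. -/
noncomputable def affineGap {n : ℕ} (u : EuclideanSpace ℝ (Fin n) → ℝ)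
    (x p h : EuclideanSpace ℝ (Fin n)) : ℝ :=
  u (x + h) - u x - inner ℝ h p

theorem affineGap_nonneg {n : ℕ} {u : EuclideanSpace ℝ (Fin n) → ℝ}
    {x p : EuclideanSpace ℝ (Fin n)} (hp : p ∈ subdifferentialAt u x)
    (h : EuclideanSpace ℝ (Fin n)) : 0 ≤ affineGap u x p h := by
  have := mem_subdifferentialAt_iff.1 hp h
  unfold affineGap; linarith

theorem affineGap_zero {n : ℕ} (u : EuclideanSpace ℝ (Fin n) → ℝ)
    (x p : EuclideanSpace ℝ (Fin n)) : affineGap u x p 0 = 0 := by simp [affineGap]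

theorem continuous_affineGap {n : ℕ} {u : EuclideanSpace ℝ (Fin n) → ℝ} (hu : Continuous u)
    (x p : EuclideanSpace ℝ (Fin n)) : Continuous (affineGap u x p) := by
  unfold affineGap; fun_prop

theorem convexOn_affineGap {n : ℕ} {u : EuclideanSpace ℝ (Fin n) → ℝ} (hu : ConvexOn ℝ univ u)
    (x p : EuclideanSpace ℝ (Fin n)) : ConvexOn ℝ univ (affineGap u x p) := by
  refine ⟨convex_univ, fun y _ z _ a b ha hb hab => ?_⟩
  have h1 := hu.2 (mem_univ (x + y)) (mem_univ (x + z)) ha hb hab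
  have e : a • (x + y) + b • (x + z) = x + (a • y + b • z) := by
    have : x = a • x + b • x := by rw [← add_smul, hab, one_smul]
    nth_rewrite 3 [this]
    rw [smul_add, smul_add]; abel
  rw [e] at h1
  simp only [affineGap, inner_add_left, inner_smul_left, smul_eq_mul, RCLike.conj_to_real] at *
  have hb' : b = 1 - a := by linarith
  subst hb'
  linarith

/-- A bound on the second differences of `u`, with constant `L`. -/
def HasSecondDifferenceBound {n : ℕ} (L : ℝ) (u : EuclideanSpace ℝ (Fin n) → ℝ) : Prop :=
  ∀ x h, u (x + h) + u (x - h) - 2 * u x ≤ L * ‖h‖ ^ 2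

theorem HasSecondDifferenceBound.affineGap_le {n : ℕ} {L : ℝ} {u : EuclideanSpace ℝ (Fin n) → ℝ}
    (hL : HasSecondDifferenceBound L u) {x p : EuclideanSpace ℝ (Fin n)}
    (hp : p ∈ subdifferentialAt u x) (h : EuclideanSpace ℝ (Fin n)) :
    affineGap u x p h ≤ L / 2 * ‖h‖ ^ 2 := by
  -- By the doubling inequality `f (2 t) ≤ 2 f t + L t² |h|²`, the quantity
  -- `2 ^ j * f (2 ^ (-j)) - (L / 2) * 2 ^ (-j) * |h|²` increases with `j`, and it tends to `0`.
  set f : ℝ → ℝ := fun t => affineGap u x p (t • h) with hf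
  have hdouble : ∀ t : ℝ, f (2 * t) ≤ 2 * f t + L * t ^ 2 * ‖h‖ ^ 2 := by
    intro t
    have := hL (x + t • h) (t • h)
    rw [add_sub_cancel_right, norm_smul, mul_pow, Real.norm_eq_abs, sq_abs, add_assoc,
      ← two_smul ℝ (t • h),
      smul_smul] at this
    simp only [hf, affineGap, inner_smul_left, RCLike.conj_to_real]
    nlinarith
  have hcrude : ∀ t : ℝ, f t ≤ L * t ^ 2 * ‖h‖ ^ 2 := by
    intro t
    have h1 := hL x (t • h)
    have h2 := mem_subdifferentialAt_iff.1 hp (-(t • h))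
    rw [← sub_eq_add_neg, inner_neg_left] at h2
    rw [norm_smul, mul_pow, Real.norm_eq_abs, sq_abs] at h1
    simp only [hf, affineGap]
    linarith
  have hind : ∀ j : ℕ, f 1 ≤ 2 ^ j * f (1 / 2 ^ j) + L / 2 * (1 - 1 / 2 ^ j) * ‖h‖ ^ 2 := by
    intro j
    induction j with
    | zero => simp
    | succ j ih =>
      refine ih.trans ?_
      have := hdouble (1 / 2 ^ (j + 1))
      have e : 2 * (1 / 2 ^ (j + 1) : ℝ) = 1 / 2 ^ j := by rw [pow_succ]; field_simp
      rw [e] at this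
      have h2 : (0 : ℝ) < 2 ^ j := by positivity
      have h3 := mul_le_mul_of_nonneg_left this h2.le
      have e2 : (2 : ℝ) ^ j * (2 * f (1 / 2 ^ (j + 1)) + L * (1 / 2 ^ (j + 1)) ^ 2 * ‖h‖ ^ 2) =
          2 ^ (j + 1) * f (1 / 2 ^ (j + 1)) + L / 2 * (1 / 2 ^ j - 1 / 2 ^ (j + 1)) * ‖h‖ ^ 2 := by
        rw [pow_succ]; field_simp; ring
      rw [e2] at h3
      linarith
  have hbd : ∀ j : ℕ, f 1 ≤ L * ‖h‖ ^ 2 * (1 / 2) ^ j + L / 2 * (1 - (1 / 2) ^ j) * ‖h‖ ^ 2 := by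
    intro j
    refine (hind j).trans ?_
    have h2 : (0 : ℝ) < 2 ^ j := by positivity
    have h3 := mul_le_mul_of_nonneg_left (hcrude (1 / 2 ^ j)) h2.le
    have e : (2 : ℝ) ^ j * (L * (1 / 2 ^ j) ^ 2 * ‖h‖ ^ 2) = L * ‖h‖ ^ 2 * (1 / 2) ^ j := by
      rw [div_pow, div_pow, one_pow, one_pow]; field_simp
    rw [e] at h3
    rw [div_pow, one_pow] at *
    linarith
  have hlim : Tendsto (fun j : ℕ => L * ‖h‖ ^ 2 * (1 / 2 : ℝ) ^ j +
      L / 2 * (1 - (1 / 2 : ℝ) ^ j) * ‖h‖ ^ 2) atTop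
      (𝓝 (L * ‖h‖ ^ 2 * 0 + L / 2 * (1 - 0) * ‖h‖ ^ 2)) := by
    have h0 := tendsto_pow_atTop_nhds_zero_of_lt_one (r := (1 / 2 : ℝ)) (by norm_num) (by norm_num)
    exact (h0.const_mul _).add (((h0.const_sub 1).const_mul _).mul_const _)
  have := ge_of_tendsto' hlim hbd
  simp only [hf, one_smul] at this
  linarith

theorem eq_of_forall_inner_sub_le {n : ℕ} {p q : EuclideanSpace ℝ (Fin n)} {C : ℝ}
    (H : ∀ h, inner ℝ h (p - q) ≤ C * ‖h‖ ^ 2) : p = q := by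
  by_contra hne
  have hpos : 0 < ‖p - q‖ ^ 2 := by
    have := norm_pos_iff.2 (sub_ne_zero.2 hne)
    positivity
  have h1 := H ((1 / (|C| + 1)) • (p - q))
  rw [inner_smul_left, real_inner_self_eq_norm_sq, norm_smul, mul_pow, Real.norm_eq_abs,
    sq_abs] at h1
  simp only [RCLike.conj_to_real] at h1
  have hC : 0 < |C| + 1 := by positivity
  have h2 : (1 / (|C| + 1)) ≤ C * (1 / (|C| + 1)) ^ 2 := by
    by_contra! hcon
    nlinarith
  rw [div_pow, one_pow, mul_one_div, div_le_div_iff₀ hC (by positivity)] at h2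
  nlinarith [le_abs_self C]

theorem HasSecondDifferenceBound.eq_of_mem {n : ℕ} {L : ℝ} {u : EuclideanSpace ℝ (Fin n) → ℝ}
    (hL : HasSecondDifferenceBound L u) {x p q : EuclideanSpace ℝ (Fin n)}
    (hp : p ∈ subdifferentialAt u x) (hq : q ∈ subdifferentialAt u x) : p = q := by
  refine eq_of_forall_inner_sub_le (C := L / 2) fun h => ?_
  have h1 := hL.affineGap_le hq h
  have h2 := mem_subdifferentialAt_iff.1 hp h
  unfold affineGap at h1
  rw [inner_sub_right]
  linarith

theorem HasSecondDifferenceBound.hasGradientAt {n : ℕ} {L : ℝ} {u : EuclideanSpace ℝ (Fin n) → ℝ}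
    (hL : HasSecondDifferenceBound L u) {x p : EuclideanSpace ℝ (Fin n)}
    (hp : p ∈ subdifferentialAt u x) : HasGradientAt u p x := by
  rw [hasGradientAt_iff_isLittleO_nhds_zero]
  have hO : (fun h : EuclideanSpace ℝ (Fin n) => u (x + h) - u x - inner ℝ p h) =O[𝓝 0]
      fun h => ‖h‖ ^ 2 := by
    refine Asymptotics.IsBigO.of_bound (L / 2) (Eventually.of_forall fun h => ?_)
    have h1 := hL.affineGap_le hp h
    have h2 := affineGap_nonneg hp h
    unfold affineGap at h1 h2
    rw [real_inner_comm, Real.norm_of_nonneg h2, Real.norm_of_nonneg (by positivity)]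
    exact h1
  refine hO.trans_isLittleO ?_
  exact Asymptotics.isLittleO_norm_pow_id one_lt_two

/-- The gradient of a convex function with second differences bounded by `L` is `L`-Lipschitz. -/
theorem HasSecondDifferenceBound.norm_sub_le {n : ℕ} {L : ℝ} (hL0 : 0 ≤ L)
    {u : EuclideanSpace ℝ (Fin n) → ℝ} (hL : HasSecondDifferenceBound L u)
    {x y p q : EuclideanSpace ℝ (Fin n)} (hp : p ∈ subdifferentialAt u x)
    (hq : q ∈ subdifferentialAt u y) : ‖p - q‖ ≤ L * ‖x - y‖ := by
  have key : ∀ t : ℝ, (2 * t - L * t ^ 2) * ‖p - q‖ ^ 2 ≤ ‖x - y‖ * ‖p - q‖ := by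
    intro t
    have h1 := mem_subdifferentialAt_iff.1 hp (y + t • (p - q) - x)
    have h2 := hL.affineGap_le hq (t • (p - q))
    have h3 := mem_subdifferentialAt_iff.1 hq (x + t • (q - p) - y)
    have h4 := hL.affineGap_le hp (t • (q - p))
    have h5 := real_inner_le_norm (x - y) (p - q)
    have e : ‖p - q‖ ^ 2 = inner ℝ p p - 2 * inner ℝ p q + inner ℝ q q := by
      rw [norm_sub_sq_real, real_inner_self_eq_norm_sq, real_inner_self_eq_norm_sq]
    have e' : ‖q - p‖ = ‖p - q‖ := norm_sub_rev q p
    rw [add_sub_cancel] at h1 h3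
    unfold affineGap at h2 h4
    rw [norm_smul, mul_pow, Real.norm_eq_abs, sq_abs] at h2 h4
    rw [e'] at h4
    simp only [inner_sub_left, inner_add_left, inner_smul_left, inner_sub_right,
      RCLike.conj_to_real, real_inner_comm p q] at *
    rw [e] at *
    nlinarith
  rcases eq_or_ne p q with rfl | hne
  · rw [sub_self, norm_zero]; positivity
  have hpos : 0 < ‖p - q‖ := norm_pos_iff.2 (sub_ne_zero.2 hne)
  have key' : ∀ t : ℝ, (2 * t - L * t ^ 2) * ‖p - q‖ ≤ ‖x - y‖ := by
    intro t
    have := key t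
    rw [sq ‖p - q‖, ← mul_assoc] at this
    exact le_of_mul_le_mul_right this hpos
  rcases hL0.eq_or_lt with rfl | hLpos
  · have := key' ((‖x - y‖ + 1) / ‖p - q‖)
    have e : (2 * ((‖x - y‖ + 1) / ‖p - q‖) - 0 * ((‖x - y‖ + 1) / ‖p - q‖) ^ 2) * ‖p - q‖ =
      2 * (‖x - y‖ + 1) := by field_simp; ring
    rw [e] at this
    linarith [norm_nonneg (x - y)]
  · have := key' (1 / L)
    have e : (2 * (1 / L) - L * (1 / L) ^ 2) * ‖p - q‖ = ‖p - q‖ / L := by field_simp; ring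
    rw [e, div_le_iff₀ hLpos] at this
    linarith

theorem lipschitzWith_gradient_of_secondDifference {n : ℕ} {L : ℝ≥0}
    {u : EuclideanSpace ℝ (Fin n) → ℝ}
    (hc : Continuous u) (hu : ConvexOn ℝ univ u) (hL : HasSecondDifferenceBound L u) :
    LipschitzWith L (gradient u) := by
  refine LipschitzWith.of_dist_le_mul fun x y => ?_
  obtain ⟨p, hp⟩ := subdifferentialAt_nonempty hc hu x
  obtain ⟨q, hq⟩ := subdifferentialAt_nonempty hc hu y
  rw [(hL.hasGradientAt hp).gradient, (hL.hasGradientAt hq).gradient, dist_eq_norm, dist_eq_norm]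
  exact hL.norm_sub_le L.2 hp hq

theorem hasSecondDifferenceBound_of_lipschitzWith_gradient {n : ℕ} {L : ℝ≥0}
    {u : EuclideanSpace ℝ (Fin n) → ℝ}
    (hd : Differentiable ℝ u) (hL : LipschitzWith L (gradient u)) :
    HasSecondDifferenceBound L u := by
  intro x h
  set q : ℝ → ℝ := fun t => u (x + t • h) + u (x - t • h) - L * t ^ 2 * ‖h‖ ^ 2 with hq
  have hder : ∀ t, HasDerivAt q
      (inner ℝ (gradient u (x + t • h)) h - inner ℝ (gradient u (x - t • h)) h
      - L * (2 * t) * ‖h‖ ^ 2) t := by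
    intro t
    have d1 : HasDerivAt (fun t : ℝ => x + t • h) h t := by
      simpa using ((hasDerivAt_id t).smul_const h).const_add x
    have d2 : HasDerivAt (fun t : ℝ => x - t • h) (-h) t := by
      simpa using ((hasDerivAt_id t).smul_const h).const_sub x
    have g1 := (hd (x + t • h)).hasGradientAt.hasFDerivAt.comp_hasDerivAt t d1
    have g2 := (hd (x - t • h)).hasGradientAt.hasFDerivAt.comp_hasDerivAt t d2
    have g3 : HasDerivAt (fun t : ℝ => (L : ℝ) * t ^ 2 * ‖h‖ ^ 2) (L * (2 * t) * ‖h‖ ^ 2) t := by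
      have := ((hasDerivAt_pow 2 t).const_mul (L : ℝ)).mul_const (‖h‖ ^ 2)
      simpa using this
    refine ((g1.add g2).sub g3).congr_deriv ?_
    simp only [InnerProductSpace.toDual_apply_apply, inner_neg_right]
    ring
  have hanti : AntitoneOn q (Icc 0 1) := by
    refine antitoneOn_of_deriv_nonpos (convex_Icc 0 1)
      (fun t _ => (hder t).continuousAt.continuousWithinAt)
      (fun t _ => (hder t).differentiableAt.differentiableWithinAt) fun t ht => ?_
    rw [interior_Icc] at ht
    rw [(hder t).deriv, ← inner_sub_left]
    have h1 := real_inner_le_norm (gradient u (x + t • h) - gradient u (x - t • h)) h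
    have h2 := hL.dist_le_mul (x + t • h) (x - t • h)
    rw [dist_eq_norm, dist_eq_norm, add_sub_sub_cancel, ← two_smul ℝ (t • h), smul_smul, norm_smul,
      Real.norm_of_nonneg (by linarith [ht.1])] at h2
    nlinarith [norm_nonneg h]
  have := hanti (left_mem_Icc.2 zero_le_one) (right_mem_Icc.2 zero_le_one) zero_le_one
  simp only [hq, one_smul, zero_smul, add_zero, sub_zero] at this
  linarith

theorem gradient_mem_subdifferentialAt {n : ℕ} {L : ℝ} {u : EuclideanSpace ℝ (Fin n) → ℝ}
    (hc : Continuous u) (hu : ConvexOn ℝ univ u) (hL : HasSecondDifferenceBound L u)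
    (x : EuclideanSpace ℝ (Fin n)) : gradient u x ∈ subdifferentialAt u x := by
  obtain ⟨p, hp⟩ := subdifferentialAt_nonempty hc hu x
  rwa [(hL.hasGradientAt hp).gradient]

theorem affineGap_le_quadLin {n : ℕ} {L A : ℝ} {u : EuclideanSpace ℝ (Fin n) → ℝ}
    (hc : Continuous u)
    (hu : ConvexOn ℝ univ u) (hL : HasSecondDifferenceBound L u)
    (hA : ∀ x, u x ≤ A * (1 + ‖x‖)) (hA0 : 0 ≤ A) {x p : EuclideanSpace ℝ (Fin n)}
    (hp : p ∈ subdifferentialAt u x) (h : EuclideanSpace ℝ (Fin n)) :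
    affineGap u x p h ≤ max (L / 2) (2 * A) * quadLin h := by
  have h1 := hL.affineGap_le hp h
  have h2 : affineGap u x p h ≤ 2 * A * ‖h‖ := by
    have h3 := abs_le.1 (abs_sub_le_of_growth hc hu hA hA0 (x + h) x)
    have h4 := norm_le_of_mem_subdifferentialAt hA hp hA0
    have h5 := abs_le.1 (abs_real_inner_le_norm h p)
    rw [add_sub_cancel_left] at h3
    unfold affineGap
    nlinarith [norm_nonneg h]
  unfold quadLin
  rcases min_cases (‖h‖ ^ 2) ‖h‖ with ⟨e, -⟩ | ⟨e, -⟩ <;> rw [e]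
  · exact h1.trans (by gcongr; exact le_max_left _ _)
  · exact h2.trans (by gcongr; exact le_max_right _ _)

/-! ### Coercivity -/

/-- A nonnegative convex function vanishing at the origin, but on no ray from the origin, grows
linearly. -/
theorem exists_mul_norm_le_of_no_ray {n : ℕ} {w : EuclideanSpace ℝ (Fin n) → ℝ} (hc : Continuous w)
    (hw : ConvexOn ℝ univ w) (h0 : w 0 = 0)
    (hray : ∀ e : EuclideanSpace ℝ (Fin n), ‖e‖ = 1 → ∃ t : ℝ, 0 < t ∧ 0 < w (t • e)) :
    ∃ a > 0, ∃ R ≥ 1, ∀ x, R ≤ ‖x‖ → a * ‖x‖ ≤ w x := by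
  have hscale : ∀ (t : ℝ) (x : EuclideanSpace ℝ (Fin n)), 0 ≤ t → t ≤ 1 → w (t • x) ≤ t * w x := by
    intro t x ht ht1
    have := hw.2 (mem_univ x) (mem_univ 0) ht (sub_nonneg.2 ht1) (by ring)
    simpa [h0] using this
  obtain ⟨N, hN⟩ : ∃ N : ℕ, ∀ x, (N : ℝ) + 1 ≤ ‖x‖ → 1 < w x := by
    by_contra! hcon
    choose x hx hwx using hcon
    have hxpos : ∀ j : ℕ, 0 < ‖x j‖ := fun j => by
      have := hx j
      have : (0 : ℝ) ≤ j := j.cast_nonneg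
      linarith
    have hmem : ∀ j, ‖x j‖⁻¹ • x j ∈ Metric.sphere (0 : EuclideanSpace ℝ (Fin n)) 1 := by
      intro j
      rw [mem_sphere_zero_iff_norm, norm_smul, norm_inv, norm_norm, inv_mul_cancel₀ (hxpos j).ne']
    obtain ⟨e, he, σ, hσ, hlim⟩ := (isCompact_sphere _ _).tendsto_subseq hmem
    obtain ⟨t, ht, hpos⟩ := hray e (mem_sphere_zero_iff_norm.1 he)
    have hl1 : Tendsto (fun j => w (t • (‖x (σ j)‖⁻¹ • x (σ j)))) atTop (𝓝 (w (t • e))) :=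
      (hc.tendsto _).comp (hlim.const_smul t)
    have hinv : Tendsto (fun j => t * ‖x (σ j)‖⁻¹) atTop (𝓝 0) := by
      rw [← mul_zero t]
      refine Tendsto.const_mul t (tendsto_inv_atTop_zero.comp ?_)
      refine tendsto_atTop_mono (fun j => ?_) (tendsto_natCast_atTop_atTop.comp hσ.tendsto_atTop)
      have := hx (σ j)
      simp only [Function.comp_apply]
      linarith
    have hle : ∀ᶠ j in atTop, w (t • (‖x (σ j)‖⁻¹ • x (σ j))) ≤ t * ‖x (σ j)‖⁻¹ := by
      filter_upwards [hinv.eventually (gt_mem_nhds zero_lt_one)] with j hj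
      have h1 : 0 ≤ t * ‖x (σ j)‖⁻¹ := by have := (hxpos (σ j)).le; positivity
      rw [smul_smul]
      refine (hscale _ _ h1 hj.le).trans ?_
      nlinarith [hwx (σ j)]
    have := le_of_tendsto_of_tendsto hl1 hinv hle
    linarith
  have hN0 : (0 : ℝ) ≤ N := N.cast_nonneg
  refine ⟨1 / ((N : ℝ) + 1), by positivity, N + 1, by linarith, fun x hx => ?_⟩
  have hxpos : 0 < ‖x‖ := by linarith
  have ht1 : ((N : ℝ) + 1) / ‖x‖ ≤ 1 := by rwa [div_le_one hxpos]
  have h1 := hscale (((N : ℝ) + 1) / ‖x‖) x (by positivity) ht1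
  have h2 := hN ((((N : ℝ) + 1) / ‖x‖) • x) (by
    rw [norm_smul, Real.norm_of_nonneg (by positivity), div_mul_cancel₀ _ hxpos.ne'])
  have h3 : 1 < ((N : ℝ) + 1) / ‖x‖ * w x := h2.trans_le h1
  have h4 : ((N : ℝ) + 1) / ‖x‖ * w x * ‖x‖ = (N + 1) * w x := by field_simp
  have h5 : ‖x‖ < (N + 1) * w x := by
    rw [← h4]; nlinarith
  rw [one_div, inv_mul_le_iff₀ (by positivity)]
  exact h5.le

/-! ### Slices of compact convex sets near extreme points -/

theorem IsCompact.isCompact_convexHull_of_finiteDimensional {E : Type*} [NormedAddCommGroup E]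
    [NormedSpace ℝ E] [FiniteDimensional ℝ E] {s : Set E} (hs : IsCompact s) :
    IsCompact (convexHull ℝ s) := by
  rcases s.eq_empty_or_nonempty with rfl | ⟨z₀, hz₀⟩
  · simp
  set d := Module.finrank ℝ E
  set Φ : (Fin (d + 1) → ℝ) × (Fin (d + 1) → E) → E := fun q => ∑ i, q.1 i • q.2 i with hΦ
  have hΦc : Continuous Φ := by rw [hΦ]; fun_prop
  have himg : convexHull ℝ s = Φ '' (stdSimplex ℝ (Fin (d + 1)) ×ˢ univ.pi fun _ => s) := by
    refine Subset.antisymm (fun x hx => ?_) ?_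
    · obtain ⟨ι, _, z, w, hz, haff, hw, hw1, hwz⟩ := eq_pos_convex_span_of_mem_convexHull hx
      have hcard : Fintype.card ι ≤ Fintype.card (Fin (d + 1)) := by
        rw [Fintype.card_fin]
        exact haff.card_le_finrank_succ.trans (Nat.succ_le_succ (Submodule.finrank_le _))
      obtain ⟨f⟩ := Function.Embedding.nonempty_of_card_le hcard
      refine ⟨(Function.extend f w 0, Function.extend f z fun _ => z₀), ⟨⟨fun j => ?_, ?_⟩, ?_⟩, ?_⟩
      · by_cases hj : ∃ i, f i = j
        · obtain ⟨i, rfl⟩ := hj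
          simp only [f.injective.extend_apply]
          exact (hw i).le
        · simp only [Function.extend_apply' _ _ _ hj]
          exact le_rfl
      · rw [← hw1]
        symm
        refine Fintype.sum_of_injective f f.injective _ _ (fun j hj => ?_) fun i => ?_
        · exact Function.extend_apply' _ _ _ hj
        · exact (f.injective.extend_apply _ _ _).symm
      · intro j _
        by_cases hj : ∃ i, f i = j
        · obtain ⟨i, rfl⟩ := hj
          simp only [f.injective.extend_apply]
          exact hz (mem_range_self i)
        · simp only [Function.extend_apply' _ _ _ hj]
          exact hz₀
      · rw [← hwz]
        symm
        refine Fintype.sum_of_injective f f.injective _ _ (fun j hj => ?_) fun i => ?_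
        · simp only [Function.extend_apply' _ _ _ hj, Pi.zero_apply, zero_smul]
        · simp only [f.injective.extend_apply]
    · rintro _ ⟨⟨w, z⟩, ⟨hw, hz⟩, rfl⟩
      exact (convex_convexHull ℝ s).sum_mem (fun i _ => hw.1 i) hw.2
        fun i _ => subset_convexHull ℝ s (hz i (mem_univ i))
  rw [himg]
  exact ((isCompact_stdSimplex ℝ _).prod (isCompact_univ_pi fun _ => hs)).image hΦc

/-- Extreme points of a compact convex set lie in arbitrarily small slices. -/
theorem exists_slice_of_mem_extremePoints {n : ℕ} {D : Set (EuclideanSpace ℝ (Fin n))}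
    (hD : IsCompact D) (hDc : Convex ℝ D) {e : EuclideanSpace ℝ (Fin n)}
    (he : e ∈ D.extremePoints ℝ) {ρ : ℝ} (hρ : 0 < ρ) :
    ∃ (a : EuclideanSpace ℝ (Fin n)) (β : ℝ), β < inner ℝ e a ∧
      ∀ x ∈ D, β ≤ inner ℝ x a → dist x e < ρ := by
  have hK : IsCompact (D \ Metric.ball e ρ) := hD.diff Metric.isOpen_ball
  have hH := hK.isCompact_convexHull_of_finiteDimensional
  have hnot : e ∉ convexHull ℝ (D \ Metric.ball e ρ) := by
    intro hmem
    have := (hDc.mem_extremePoints_iff_mem_sdiff_convexHull_sdiff.1 he).2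
    have hsub : D \ Metric.ball e ρ ⊆ D \ {e} := by
      rintro x ⟨hxD, hx⟩
      refine ⟨hxD, ?_⟩
      rintro rfl
      exact hx (Metric.mem_ball_self hρ)
    exact this (convexHull_mono hsub hmem)
  obtain ⟨f, c, hfc, hcf⟩ :=
    geometric_hahn_banach_point_closed (convex_convexHull ℝ _) hH.isClosed hnot
  refine ⟨(InnerProductSpace.toDual ℝ _).symm (-f), -c, ?_, fun x hx hβ => ?_⟩
  · rw [real_inner_comm, InnerProductSpace.toDual_symm_apply]
    simpa using hfc
  · rw [real_inner_comm, InnerProductSpace.toDual_symm_apply] at hβ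
    by_contra hcon
    have := hcf x (subset_convexHull ℝ _ ⟨hx, fun hb => hcon (Metric.mem_ball.1 hb)⟩)
    simp at hβ
    linarith

/-! ### The bracket function -/

/-- The function `(1 + |x|²)^{1/2}`. -/
noncomputable def bracket {n : ℕ} (x : EuclideanSpace ℝ (Fin n)) : ℝ := Real.sqrt (1 + ‖x‖ ^ 2)

theorem bracket_sq {n : ℕ} (x : EuclideanSpace ℝ (Fin n)) : bracket x ^ 2 = 1 + ‖x‖ ^ 2 :=
  Real.sq_sqrt (by positivity)

theorem one_le_bracket {n : ℕ} (x : EuclideanSpace ℝ (Fin n)) : 1 ≤ bracket x :=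
  Real.one_le_sqrt.2 (by nlinarith [sq_nonneg ‖x‖])

theorem norm_le_bracket {n : ℕ} (x : EuclideanSpace ℝ (Fin n)) : ‖x‖ ≤ bracket x :=
  Real.le_sqrt_of_sq_le (by linarith)

theorem bracket_zero {n : ℕ} : bracket (0 : EuclideanSpace ℝ (Fin n)) = 1 := by simp [bracket]

theorem continuous_bracket {n : ℕ} : Continuous (bracket : EuclideanSpace ℝ (Fin n) → ℝ) := by
  unfold bracket; fun_prop

theorem bracket_sq_add {n : ℕ} (x h : EuclideanSpace ℝ (Fin n)) :
    bracket (x + h) ^ 2 = bracket x ^ 2 + 2 * inner ℝ h x + ‖h‖ ^ 2 := by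
  rw [bracket_sq, bracket_sq, norm_add_sq_real, real_inner_comm]; ring

theorem abs_inner_le_bracket {n : ℕ} (x h : EuclideanSpace ℝ (Fin n)) :
    |inner ℝ h x| ≤ ‖h‖ * bracket x :=
  (abs_real_inner_le_norm h x).trans (by gcongr; exact norm_le_bracket x)

theorem bracket_mul_add_gt {n : ℕ} (x : EuclideanSpace ℝ (Fin n)) {h : EuclideanSpace ℝ (Fin n)}
    (hh : h ≠ 0) : bracket x ^ 2 + inner ℝ h x < bracket x * bracket (x + h) := by
  have h1 := one_le_bracket x
  have h2 := one_le_bracket (x + h)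
  have h3 := bracket_sq_add x h
  have h4 := bracket_sq x
  have h5 : inner ℝ h x ^ 2 ≤ ‖h‖ ^ 2 * ‖x‖ ^ 2 := by
    have := abs_real_inner_le_norm h x
    rw [← mul_pow, ← sq_abs]
    gcongr
  have h6 : 0 < ‖h‖ ^ 2 := by have := norm_pos_iff.2 hh; positivity
  refine lt_of_pow_lt_pow_left₀ 2 (by positivity) ?_
  rw [mul_pow, h3]
  nlinarith

theorem affineGap_bracket_pos {n : ℕ} (x : EuclideanSpace ℝ (Fin n)) {h : EuclideanSpace ℝ (Fin n)}
    (hh : h ≠ 0) : 0 < affineGap bracket x ((bracket x)⁻¹ • x) h := by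
  have h1 := one_le_bracket x
  have h2 := bracket_mul_add_gt x hh
  unfold affineGap
  rw [inner_smul_right, sub_sub, sub_pos, ← sub_pos]
  have e : bracket (x + h) - (bracket x + (bracket x)⁻¹ * inner ℝ h x) =
      (bracket x)⁻¹ * (bracket x * bracket (x + h) - (bracket x ^ 2 + inner ℝ h x)) := by
    field_simp
  rw [e]
  exact mul_pos (by positivity) (by linarith)

theorem mem_subdifferentialAt_bracket {n : ℕ} (x : EuclideanSpace ℝ (Fin n)) :
    (bracket x)⁻¹ • x ∈ subdifferentialAt bracket x := by
  rw [mem_subdifferentialAt_iff]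
  intro h
  rcases eq_or_ne h 0 with rfl | hh
  · simp
  · have := affineGap_bracket_pos x hh
    unfold affineGap at this
    linarith

theorem strictConvexOn_bracket {n : ℕ} :
    StrictConvexOn ℝ univ (bracket : EuclideanSpace ℝ (Fin n) → ℝ) := by
  refine ⟨convex_univ, fun x _ y _ hxy a b ha hb hab => ?_⟩
  set c := a • x + b • y with hc
  have e1 : c + b • (x - y) = x := by
    rw [hc, smul_sub, add_add_sub_cancel, ← add_smul, hab, one_smul]
  have e2 : c + a • (y - x) = y := by
    rw [hc, smul_sub, add_comm (a • x), add_add_sub_cancel, ← add_smul, add_comm b, hab, one_smul]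
  have h1 := affineGap_bracket_pos c (smul_ne_zero hb.ne' (sub_ne_zero.2 hxy))
  have h2 := affineGap_bracket_pos c (smul_ne_zero ha.ne' (sub_ne_zero.2 hxy.symm))
  unfold affineGap at h1 h2
  rw [e1, inner_smul_left] at h1
  rw [e2, inner_smul_left, ← neg_sub x y, inner_neg_left] at h2
  simp only [smul_eq_mul, RCLike.conj_to_real] at *
  have hb' : b = 1 - a := by linarith
  subst hb'
  nlinarith [mul_pos ha h1, mul_pos hb h2]

theorem abs_bracket_sub_le {n : ℕ} (x h : EuclideanSpace ℝ (Fin n)) :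
    |bracket (x + h) - bracket x| ≤ ‖h‖ := by
  have h1 := one_le_bracket x
  have h2 := one_le_bracket (x + h)
  have h3 := mem_subdifferentialAt_iff.1 (mem_subdifferentialAt_bracket x) h
  have h4 := mem_subdifferentialAt_iff.1 (mem_subdifferentialAt_bracket (x + h)) (-h)
  rw [inner_smul_right] at h3 h4
  rw [add_neg_cancel_right, inner_neg_left] at h4
  have h5 := abs_le.1 (abs_inner_le_bracket x h)
  have h6 := abs_le.1 (abs_inner_le_bracket (x + h) h)
  have h7 : -‖h‖ ≤ (bracket x)⁻¹ * inner ℝ h x := by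
    rw [le_inv_mul_iff₀ (by positivity)]; nlinarith
  have h8 : (bracket (x + h))⁻¹ * inner ℝ h (x + h) ≤ ‖h‖ := by
    rw [inv_mul_le_iff₀ (by positivity)]; nlinarith
  rw [abs_le]
  constructor <;> linarith

theorem affineGap_bracket_le {n : ℕ} (x h : EuclideanSpace ℝ (Fin n)) :
    affineGap bracket x ((bracket x)⁻¹ • x) h ≤ 2 * quadLin h := by
  have h1 := one_le_bracket x
  have h2 := one_le_bracket (x + h)
  have hq : affineGap bracket x ((bracket x)⁻¹ • x) h ≤ ‖h‖ ^ 2 := by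
    have h3 := bracket_sq_add x h
    unfold affineGap
    rw [inner_smul_right]
    have e : bracket (x + h) - bracket x - (bracket x)⁻¹ * inner ℝ h x =
      (bracket x)⁻¹ * (bracket x * bracket (x + h) - bracket x ^ 2 - inner ℝ h x) := by
      field_simp
    rw [e, inv_mul_le_iff₀ (by positivity)]
    nlinarith [sq_nonneg (bracket (x + h) - bracket x), sq_nonneg ‖h‖]
  have hl : affineGap bracket x ((bracket x)⁻¹ • x) h ≤ 2 * ‖h‖ := by
    have h3 := abs_le.1 (abs_bracket_sub_le x h)
    have h5 := abs_le.1 (abs_inner_le_bracket x h)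
    have h7 : -‖h‖ ≤ (bracket x)⁻¹ * inner ℝ h x := by
      rw [le_inv_mul_iff₀ (by positivity)]; nlinarith
    unfold affineGap
    rw [inner_smul_right]
    linarith
  unfold quadLin
  rcases min_cases (‖h‖ ^ 2) ‖h‖ with ⟨e, -⟩ | ⟨e, -⟩ <;> rw [e]
  · nlinarith [sq_nonneg ‖h‖]
  · exact hl

/-- The function `1 / bracket` is almost concave, with an error proportional to itself. This makes
it a building block for supersolutions. -/
theorem inv_bracket_add_le {n : ℕ} (x h : EuclideanSpace ℝ (Fin n)) :
    (bracket (x + h))⁻¹ ≤ (bracket x)⁻¹ - inner ℝ h x / bracket x ^ 3 +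
      (bracket x)⁻¹ * quadLin h := by
  have h1 := one_le_bracket x
  have h2 := one_le_bracket (x + h)
  set s := bracket x
  set t := bracket (x + h)
  have h3 : s ^ 2 + inner ℝ h x ≤ s * t := by
    rcases eq_or_ne h 0 with rfl | hh
    · simp [s, t, sq]
    · exact (bracket_mul_add_gt x hh).le
  have h4 := abs_bracket_sub_le x h
  change |t - s| ≤ ‖h‖ at h4
  have hd2 : (t - s) ^ 2 ≤ ‖h‖ ^ 2 := by rw [← sq_abs (t - s)]; gcongr
  have hmain : (t - s) ^ 2 / (s * t) ≤ quadLin h := by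
    refine le_min ?_ ?_
    · rw [div_le_iff₀ (by positivity)]
      have : 1 ≤ s * t := by nlinarith
      nlinarith [sq_nonneg ‖h‖]
    · rw [div_le_iff₀ (by positivity)]
      have h5 : |t - s| ≤ s * t := by
        rw [abs_le]; constructor <;> nlinarith
      calc (t - s) ^ 2 = |t - s| * |t - s| := by rw [abs_mul_abs_self, sq]
        _ ≤ ‖h‖ * (s * t) := by gcongr
  have e : t⁻¹ - (s⁻¹ - inner ℝ h x / s ^ 3) =
      s⁻¹ * ((t - s) ^ 2 / (s * t)) - (s * t - (s ^ 2 + inner ℝ h x)) / s ^ 3 := by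
    field_simp; ring
  have h6 : 0 ≤ (s * t - (s ^ 2 + inner ℝ h x)) / s ^ 3 := div_nonneg (by linarith) (by positivity)
  have h7 : s⁻¹ * ((t - s) ^ 2 / (s * t)) ≤ s⁻¹ * quadLin h := by gcongr
  linarith

/-! ### Functions asymptotic to a cone -/

theorem IsCone.zero {n : ℕ} {ψ : EuclideanSpace ℝ (Fin n) → ℝ} (hψ : IsCone ψ) : ψ 0 = 0 := by
  have := hψ.2 2 0 two_pos
  rw [smul_zero] at this
  linarith

theorem IsCone.exists_abs_le {n : ℕ} {ψ : EuclideanSpace ℝ (Fin n) → ℝ} (hψ : IsCone ψ) :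
    ∃ A ≥ 0, ∀ x, |ψ x| ≤ A * ‖x‖ := by
  obtain ⟨A, hA⟩ := (isCompact_sphere (0 : EuclideanSpace ℝ (Fin n)) 1).exists_bound_of_continuousOn
    hψ.1.continuousOn
  refine ⟨max A 0, le_max_right _ _, fun x => ?_⟩
  rcases eq_or_ne x 0 with rfl | hx
  · simp [hψ.zero]
  have hpos := norm_pos_iff.2 hx
  have h1 := hA (‖x‖⁻¹ • x) (by
    rw [mem_sphere_zero_iff_norm, norm_smul, norm_inv, norm_norm, inv_mul_cancel₀ hpos.ne'])
  have h2 := hψ.2 ‖x‖ (‖x‖⁻¹ • x) hpos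
  rw [smul_smul, mul_inv_cancel₀ hpos.ne', one_smul] at h2
  rw [h2, abs_mul, abs_of_pos hpos, mul_comm]
  gcongr
  exact (Real.norm_eq_abs _ ▸ h1).trans (le_max_left _ _)

theorem exists_abs_le_of_tendsto_zero {n : ℕ} {g : EuclideanSpace ℝ (Fin n) → ℝ} (hg : Continuous g)
    (h : Tendsto g (Bornology.cobounded _) (𝓝 0)) : ∃ M ≥ 0, ∀ x, |g x| ≤ M := by
  have h1 : ∀ᶠ x in Bornology.cobounded (EuclideanSpace ℝ (Fin n)), |g x| < 1 := by
    have := h.abs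
    rw [abs_zero] at this
    exact this.eventually (gt_mem_nhds one_pos)
  obtain ⟨R, -, hR⟩ := (hasBasis_cobounded_norm (E := EuclideanSpace ℝ (Fin n))).eventually_iff.1 h1
  obtain ⟨A, hA⟩ := (isCompact_closedBall
    (0 : EuclideanSpace ℝ (Fin n)) R).exists_bound_of_continuousOn hg.continuousOn
  refine ⟨max A 1, le_max_of_le_right zero_le_one, fun x => ?_⟩
  rcases le_total ‖x‖ R with hx | hx
  · exact (hA x (by simpa using hx)).trans (le_max_left _ _)
  · exact (hR hx).le.trans (le_max_right _ _)

theorem exists_linear_growth {n : ℕ} {φ ψ : EuclideanSpace ℝ (Fin n) → ℝ} (hφ : Continuous φ)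
    (hψ : IsCone ψ) (h : Tendsto (fun x => φ x - ψ x) (Bornology.cobounded _) (𝓝 0)) :
    ∃ A ≥ 0, ∀ x, φ x ≤ A * (1 + ‖x‖) := by
  obtain ⟨A, hA0, hA⟩ := hψ.exists_abs_le
  obtain ⟨M, hM0, hM⟩ := exists_abs_le_of_tendsto_zero (hφ.sub hψ.1) h
  refine ⟨A + M, by positivity, fun x => ?_⟩
  have h1 := le_of_abs_le (hA x)
  have h2 := le_of_abs_le (hM x)
  simp only [Pi.sub_apply] at h2
  nlinarith [norm_nonneg x]

/-- The second differences of a `C^{1,1}` convex function asymptotic to a cone decay: otherwise the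
cone would have a corner along a ray, which is impossible as the second differences of the function
are bounded quadratically. -/
theorem tendsto_second_difference {n : ℕ} {φ ψ : EuclideanSpace ℝ (Fin n) → ℝ} {L : ℝ}
    (hφ : Continuous φ) (hφv : ConvexOn ℝ univ φ) (hL0 : 0 ≤ L) (hL : HasSecondDifferenceBound L φ)
    (hψ : IsCone ψ) (h : Tendsto (fun x => φ x - ψ x) (Bornology.cobounded _) (𝓝 0))
    (y : EuclideanSpace ℝ (Fin n)) :
    Tendsto (fun x => φ (x + y) + φ (x - y) - 2 * φ x) (Bornology.cobounded _) (𝓝 0) := by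
  have hnonneg : ∀ x z, 0 ≤ φ (x + z) + φ (x - z) - 2 * φ x := by
    intro x z
    obtain ⟨p, hp⟩ := subdifferentialAt_nonempty hφ hφv x
    have h1 := mem_subdifferentialAt_iff.1 hp z
    have h2 := mem_subdifferentialAt_iff.1 hp (-z)
    rw [inner_neg_left, ← sub_eq_add_neg x] at h2
    linarith
  have hgrow : ∀ (x : EuclideanSpace ℝ (Fin n)) (t : ℝ), 1 ≤ t →
      t * (φ (x + y) + φ (x - y) - 2 * φ x) ≤ φ (x + t • y) + φ (x - t • y) - 2 * φ x := by
    intro x t ht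
    have ht0 : 0 < t := by linarith
    have hinv : t⁻¹ ≤ 1 := inv_le_one_of_one_le₀ ht
    have h1 := hφv.2 (mem_univ (x + t • y)) (mem_univ x) (inv_nonneg.2 ht0.le)
      (sub_nonneg.2 hinv) (by ring)
    have h2 := hφv.2 (mem_univ (x - t • y)) (mem_univ x) (inv_nonneg.2 ht0.le)
      (sub_nonneg.2 hinv) (by ring)
    have e1 : t⁻¹ • (x + t • y) + (1 - t⁻¹) • x = x + y := by
      rw [smul_add, smul_smul, inv_mul_cancel₀ ht0.ne', one_smul, sub_smul, one_smul]; abel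
    have e2 : t⁻¹ • (x - t • y) + (1 - t⁻¹) • x = x - y := by
      rw [smul_sub, smul_smul, inv_mul_cancel₀ ht0.ne', one_smul, sub_smul, one_smul]; abel
    rw [e1] at h1
    rw [e2] at h2
    simp only [smul_eq_mul] at h1 h2
    have h3 : φ (x + y) + φ (x - y) - 2 * φ x ≤
        t⁻¹ * (φ (x + t • y) + φ (x - t • y) - 2 * φ x) := by linarith
    rwa [le_inv_mul_iff₀ ht0] at h3
  obtain ⟨M, hM0, hM⟩ := exists_abs_le_of_tendsto_zero (hφ.sub hψ.1) h
  simp only [Pi.sub_apply] at hM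
  by_contra hnot
  obtain ⟨ε, hε, hfreq⟩ : ∃ ε > 0, ∀ N : ℕ, ∃ x, (N : ℝ) ≤ ‖x‖ ∧
      ε ≤ φ (x + y) + φ (x - y) - 2 * φ x := by
    by_contra! hcon
    apply hnot
    rw [Metric.tendsto_nhds]
    intro ε hε
    obtain ⟨N, hN⟩ := hcon ε hε
    refine (hasBasis_cobounded_norm (E := EuclideanSpace ℝ (Fin n))).eventually_iff.2
      ⟨N, trivial, fun x hx => ?_⟩
    rw [Real.dist_eq, sub_zero, abs_of_nonneg (hnonneg x y)]
    exact hN x hx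
  choose x hxN hxε using fun N : ℕ => hfreq (N + 1)
  have hxpos : ∀ j, 0 < ‖x j‖ := fun j => by
    have := hxN j
    push_cast at this
    have : (0 : ℝ) ≤ j := j.cast_nonneg
    linarith
  have hmem : ∀ j, ‖x j‖⁻¹ • x j ∈ Metric.sphere (0 : EuclideanSpace ℝ (Fin n)) 1 := by
    intro j
    rw [mem_sphere_zero_iff_norm, norm_smul, norm_inv, norm_norm, inv_mul_cancel₀ (hxpos j).ne']
  obtain ⟨e, he, σ, hσ, hlim⟩ := (isCompact_sphere _ _).tendsto_subseq hmem
  have he1 : ‖e‖ = 1 := mem_sphere_zero_iff_norm.1 he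
  have hnorm : Tendsto (fun j => ‖x (σ j)‖) atTop atTop := by
    refine tendsto_atTop_mono (fun j => ?_) (tendsto_natCast_atTop_atTop.comp hσ.tendsto_atTop)
    have := hxN (σ j)
    push_cast at this
    simp only [Function.comp_apply]
    linarith
  -- The cone has a corner at `e`.
  have hcorner : ∀ τ : ℝ, 0 < τ → τ * ε ≤ ψ (e + τ • y) + ψ (e - τ • y) - 2 * ψ e := by
    intro τ hτ
    have hl1 : Tendsto (fun j => ψ (‖x (σ j)‖⁻¹ • x (σ j) + τ • y) +
        ψ (‖x (σ j)‖⁻¹ • x (σ j) - τ • y) - 2 * ψ (‖x (σ j)‖⁻¹ • x (σ j))) atTop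
        (𝓝 (ψ (e + τ • y) + ψ (e - τ • y) - 2 * ψ e)) := by
      have : Continuous fun z => ψ (z + τ • y) + ψ (z - τ • y) - 2 * ψ z := by
        have := hψ.1
        fun_prop
      exact (this.tendsto e).comp hlim
    have hl2 : Tendsto (fun j => τ * ε - ‖x (σ j)‖⁻¹ * (4 * M)) atTop (𝓝 (τ * ε - 0 * (4 * M))) :=
      (tendsto_const_nhds).sub ((tendsto_inv_atTop_zero.comp hnorm).mul_const _)
    rw [zero_mul, sub_zero] at hl2
    refine le_of_tendsto_of_tendsto hl2 hl1 ?_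
    filter_upwards [hnorm.eventually_ge_atTop τ⁻¹] with j hj
    set r := ‖x (σ j)‖ with hr
    have hr0 : 0 < r := hxpos _
    have hτr : 1 ≤ r * τ := by rwa [inv_le_iff_one_le_mul₀ hτ] at hj
    have h1 := hgrow (x (σ j)) (r * τ) hτr
    have h2 := hxε (σ j)
    have b1 := abs_le.1 (hM (x (σ j) + (r * τ) • y))
    have b2 := abs_le.1 (hM (x (σ j) - (r * τ) • y))
    have b3 := abs_le.1 (hM (x (σ j)))
    have s1 : x (σ j) + (r * τ) • y = r • (r⁻¹ • x (σ j) + τ • y) := by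
      rw [smul_add, smul_smul, smul_smul, mul_inv_cancel₀ hr0.ne', one_smul]
    have s2 : x (σ j) - (r * τ) • y = r • (r⁻¹ • x (σ j) - τ • y) := by
      rw [smul_sub, smul_smul, smul_smul, mul_inv_cancel₀ hr0.ne', one_smul]
    have s3 : x (σ j) = r • (r⁻¹ • x (σ j)) := by
      rw [smul_smul, mul_inv_cancel₀ hr0.ne', one_smul]
    have c1 : ψ (x (σ j) + (r * τ) • y) = r * ψ (r⁻¹ • x (σ j) + τ • y) := by
      rw [s1, hψ.2 _ _ hr0]
    have c2 : ψ (x (σ j) - (r * τ) • y) = r * ψ (r⁻¹ • x (σ j) - τ • y) := by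
      rw [s2, hψ.2 _ _ hr0]
    have c3 : ψ (x (σ j)) = r * ψ (r⁻¹ • x (σ j)) := by
      conv_lhs => rw [s3, hψ.2 _ _ hr0]
    rw [c1] at b1
    rw [c2] at b2
    rw [c3] at b3
    have h3 : r * τ * ε - 4 * M ≤ r * (ψ (r⁻¹ • x (σ j) + τ • y) + ψ (r⁻¹ • x (σ j) - τ • y) -
        2 * ψ (r⁻¹ • x (σ j))) := by
      have : r * τ * ε ≤ r * τ * (φ (x (σ j) + y) + φ (x (σ j) - y) - 2 * φ (x (σ j))) := by
        gcongr
      linarith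
    have h4 : τ * ε - r⁻¹ * (4 * M) = r⁻¹ * (r * τ * ε - 4 * M) := by field_simp
    rw [h4, inv_mul_le_iff₀ hr0]
    exact h3
  have hsmall : ∀ t : ℝ, 0 < t → t * ε ≤ L * t ^ 2 * ‖y‖ ^ 2 := by
    intro t ht
    set E : EuclideanSpace ℝ (Fin n) → ℝ := fun x => φ x - ψ x with hE
    have hray : ∀ z : EuclideanSpace ℝ (Fin n),
        Tendsto (fun R : ℝ => E (R • e + z)) atTop (𝓝 0) := by
      intro z
      refine h.comp ?_
      rw [← tendsto_norm_atTop_iff_cobounded]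
      refine tendsto_atTop_mono' _ ?_ (tendsto_atTop_add_const_right atTop (-‖z‖) tendsto_id)
      filter_upwards [eventually_ge_atTop 0] with R hR
      have := norm_sub_norm_le (R • e) (-z)
      rw [sub_neg_eq_add, norm_neg, norm_smul, he1, Real.norm_of_nonneg hR, mul_one] at this
      simpa [sub_eq_add_neg] using this
    have hlimE : Tendsto (fun R : ℝ => E (R • e + t • y) + E (R • e + -(t • y)) - 2 * E (R • e + 0))
        atTop (𝓝 0) := by
      simpa using ((hray (t • y)).add (hray (-(t • y)))).sub ((hray 0).const_mul 2)
    have hlim2 : Tendsto (fun R : ℝ => L * t ^ 2 * ‖y‖ ^ 2 -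
        (E (R • e + t • y) + E (R • e + -(t • y)) - 2 * E (R • e + 0)))
        atTop (𝓝 (L * t ^ 2 * ‖y‖ ^ 2 - 0)) := hlimE.const_sub _
    rw [sub_zero] at hlim2
    refine ge_of_tendsto hlim2 ?_
    filter_upwards [eventually_gt_atTop 0] with R hR
    have h1 := hcorner (t / R) (by positivity)
    have h2 := hL (R • e) (t • y)
    rw [norm_smul, mul_pow, Real.norm_eq_abs, sq_abs] at h2
    have s1 : R • e + t • y = R • (e + (t / R) • y) := by
      rw [smul_add, smul_smul, mul_div_cancel₀ _ hR.ne']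
    have s2 : R • e - t • y = R • (e - (t / R) • y) := by
      rw [smul_sub, smul_smul, mul_div_cancel₀ _ hR.ne']
    have c1 : ψ (R • e + t • y) = R * ψ (e + (t / R) • y) := by rw [s1, hψ.2 _ _ hR]
    have c2 : ψ (R • e - t • y) = R * ψ (e - (t / R) • y) := by rw [s2, hψ.2 _ _ hR]
    have c3 : ψ (R • e) = R * ψ e := hψ.2 _ _ hR
    have h3 := mul_le_mul_of_nonneg_left h1 hR.le
    have h4 : R * (t / R * ε) = t * ε := by field_simp
    rw [h4] at h3
    simp only [hE, add_zero, ← sub_eq_add_neg]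
    rw [c1, c2, c3]
    linarith
  have hfinal := hsmall (ε / (2 * (L * ‖y‖ ^ 2 + 1))) (by positivity)
  have hden : 0 < 2 * (L * ‖y‖ ^ 2 + 1) := by positivity
  set t := ε / (2 * (L * ‖y‖ ^ 2 + 1)) with ht
  have ht0 : 0 < t := by positivity
  have h5 : t * (2 * (L * ‖y‖ ^ 2 + 1)) = ε := div_mul_cancel₀ _ hden.ne'
  have h6 : ε ≤ L * t * ‖y‖ ^ 2 := by
    have : t * ε ≤ t * (L * t * ‖y‖ ^ 2) := by linarith [hfinal]
    exact le_of_mul_le_mul_left this ht0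
  nlinarith [mul_nonneg hL0 (sq_nonneg ‖y‖)]

/-- The fractional Laplacian of `φ`, up to the constant. -/
noncomputable def fracEnergy {n : ℕ} (s : ℝ) (φ : EuclideanSpace ℝ (Fin n) → ℝ)
    (x : EuclideanSpace ℝ (Fin n)) : ℝ≥0∞ :=
  ∫⁻ h, ENNReal.ofReal (affineGap φ x (gradient φ x) h) * (fracKernel n s h : ℝ≥0∞)

theorem tendsto_fracEnergy {n : ℕ} (hn : 1 ≤ n) {s : ℝ} (hs : 1 / 2 < s) (hs' : s < 1)
    {φ ψ : EuclideanSpace ℝ (Fin n) → ℝ} {L A : ℝ}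
    (hφ : Continuous φ) (hφv : ConvexOn ℝ univ φ) (hL0 : 0 ≤ L) (hL : HasSecondDifferenceBound L φ)
    (hA : ∀ x, φ x ≤ A * (1 + ‖x‖)) (hA0 : 0 ≤ A)
    (hψ : IsCone ψ) (h : Tendsto (fun x => φ x - ψ x) (Bornology.cobounded _) (𝓝 0)) :
    Tendsto (fracEnergy s φ) (Bornology.cobounded _) (𝓝 0) := by
  have mF := measurable_fracKernel n s
  have mQ := measurable_quadLin (n := n)
  set C := max (L / 2) (2 * A) with hC
  have hC0 : 0 ≤ C := le_max_of_le_left (by positivity)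
  have hfin := lintegral_quadLin_mul_fracKernel_lt_top hn hs hs'
  have hgrad := gradient_mem_subdifferentialAt hφ hφv hL
  have : (Bornology.cobounded (EuclideanSpace ℝ (Fin n))).IsCountablyGenerated := by
    rw [← comap_norm_atTop]; infer_instance
  have := tendsto_lintegral_filter_of_dominated_convergence
    (μ := (volume : Measure (EuclideanSpace ℝ (Fin n))))
    (l := Bornology.cobounded (EuclideanSpace ℝ (Fin n)))
    (F := fun x h => ENNReal.ofReal (affineGap φ x (gradient φ x) h) * (fracKernel n s h : ℝ≥0∞))
    (f := fun _ => 0)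
    (fun h => ENNReal.ofReal C * (ENNReal.ofReal (quadLin h) * (fracKernel n s h : ℝ≥0∞)))
    (Eventually.of_forall fun x => by
      have := (continuous_affineGap hφ x (gradient φ x)).measurable
      fun_prop)
    (Eventually.of_forall fun x => Eventually.of_forall fun h => by
      rw [← mul_assoc, ← ENNReal.ofReal_mul hC0]
      gcongr
      exact affineGap_le_quadLin hφ hφv hL hA hA0 (hgrad x) h)
    (by
      rw [lintegral_const_mul _ (by fun_prop)]
      exact ENNReal.mul_ne_top (by simp) hfin.ne)
    (Eventually.of_forall fun y => by
      have h1 := ENNReal.tendsto_ofReal (tendsto_second_difference hφ hφv hL0 hL hψ h y)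
      have h2 := ENNReal.Tendsto.mul_const (b := (fracKernel n s y : ℝ≥0∞)) h1 (Or.inr (by simp))
      rw [ENNReal.ofReal_zero, zero_mul] at h2
      refine tendsto_of_tendsto_of_tendsto_of_le_of_le tendsto_const_nhds h2 (fun _ => zero_le)
        fun x => ?_
      beta_reduce
      gcongr
      have h3 := mem_subdifferentialAt_iff.1 (hgrad x) (-y)
      rw [inner_neg_left, ← sub_eq_add_neg x] at h3
      unfold affineGap
      linarith)
  rw [lintegral_zero] at this
  exact this

/-! ### Comparison -/

theorem EReal.coe_le_coe_ennreal_iff {a : ℝ} {F : ℝ≥0∞} :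
    (a : EReal) ≤ (F : EReal) ↔ ENNReal.ofReal a ≤ F := by
  rw [← EReal.coe_ennreal_le_coe_ennreal_iff, EReal.coe_ennreal_ofReal,
    EReal.coe_strictMono.monotone.map_max, max_le_iff]
  simpa using fun _ => EReal.coe_ennreal_nonneg F

theorem EReal.coe_ennreal_le_coe_iff {a : ℝ} {F : ℝ≥0∞} :
    (F : EReal) ≤ (a : EReal) ↔ F ≤ ENNReal.ofReal a ∧ 0 ≤ a := by
  constructor
  · intro h
    have h0 : 0 ≤ a := by
      have : ((0 : ℝ) : EReal) ≤ a := le_trans (EReal.coe_ennreal_nonneg F) h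
      exact_mod_cast this
    refine ⟨?_, h0⟩
    rw [← EReal.coe_ennreal_le_coe_ennreal_iff, EReal.coe_ennreal_ofReal, max_eq_left h0]
    exact h
  · rintro ⟨h, h0⟩
    rw [← EReal.coe_ennreal_le_coe_ennreal_iff, EReal.coe_ennreal_ofReal, max_eq_left h0] at h
    exact h

theorem nonlocalOp_eq {n : ℕ} (k : ℕ) (s : ℝ) (u : EuclideanSpace ℝ (Fin n) → ℝ)
    (x : EuclideanSpace ℝ (Fin n)) : nonlocalOp k s u x =
      ENNReal.ofReal (fracLaplacianConst n s) *
        ⨆ p ∈ subdifferentialAt u x, kernelInf n k s (affineGap u x p) := rfl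

/-- The operator is monotone at a point where one function touches another from below. -/
theorem nonlocalOp_mono_of_touch {n k : ℕ} {s : ℝ} {v u : EuclideanSpace ℝ (Fin n) → ℝ}
    {x : EuclideanSpace ℝ (Fin n)} (h : ∀ y, v y - v x ≤ u y - u x) :
    nonlocalOp k s v x ≤ nonlocalOp k s u x := by
  rw [nonlocalOp_eq, nonlocalOp_eq]
  refine mul_le_mul_right (iSup₂_le fun p hp => ?_) _
  have hp' : p ∈ subdifferentialAt u x := by
    rw [mem_subdifferentialAt_iff] at hp ⊢
    intro y
    linarith [hp y, h (x + y)]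
  refine le_trans (kernelInf_mono fun y => ?_)
    (le_iSup₂ (f := fun p _ => kernelInf n k s (affineGap u x p)) p hp')
  unfold affineGap
  linarith [h (x + y)]

theorem exists_max_of_eventually_nonpos {n : ℕ} {g : EuclideanSpace ℝ (Fin n) → ℝ}
    (hg : Continuous g)
    (hev : ∀ᶠ x in Bornology.cobounded _, g x ≤ 0) {x₁ : EuclideanSpace ℝ (Fin n)} (h1 : 0 < g x₁) :
    ∃ x₀, 0 < g x₀ ∧ ∀ x, g x ≤ g x₀ := by
  rw [Metric.cobounded_eq_cocompact] at hev
  obtain ⟨x₀, h⟩ := hg.exists_forall_ge' x₁ (hev.mono fun x hx => hx.trans h1.le)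
  exact ⟨x₀, h1.trans_le (h x₁), h⟩

/-- The comparison principle: at a positive maximum of `v - u`, a translate of `u` touches `v`
from above, so the operator is ordered there. -/
theorem IsSubsolution.le_of_isSupersolution {n k : ℕ} {s : ℝ} {φ v u : EuclideanSpace ℝ (Fin n) → ℝ}
    (hv : IsSubsolution k s φ v) (hu : IsSupersolution k s φ u)
    (hev : ∀ ε > 0, ∀ᶠ x in Bornology.cobounded _, v x - u x < ε) (x : EuclideanSpace ℝ (Fin n)) :
    v x ≤ u x := by
  by_contra! hlt
  have hg : Continuous fun y => v y - u y - (v x - u x) / 2 := by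
    have := hv.1
    have := hu.1
    fun_prop
  obtain ⟨x₀, hpos, hmax⟩ := exists_max_of_eventually_nonpos hg
    ((hev ((v x - u x) / 2) (by linarith)).mono fun y hy => by linarith) (x₁ := x) (by linarith)
  have h1 := hv.2.2 x₀
  have h2 := hu.2.2 x₀
  have h3 : nonlocalOp k s v x₀ ≤ nonlocalOp k s u x₀ :=
    nonlocalOp_mono_of_touch fun y => by linarith [hmax y]
  have h4 := (h1.trans (EReal.coe_ennreal_le_coe_ennreal_iff.2 h3)).trans h2
  rw [EReal.coe_le_coe_iff] at h4
  linarith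

/-- Barriers: every subsolution lying asymptotically below `φ` is below `φ + b`, for a function `b`
which is small at infinity. -/
theorem exists_barrier {n k : ℕ} (hk : 1 ≤ k) (hkn : k < n) {s : ℝ} (hs : 1 / 2 < s) (hs' : s < 1)
    {φ ψ : EuclideanSpace ℝ (Fin n) → ℝ} {L A : ℝ}
    (hφ : Continuous φ) (hφv : ConvexOn ℝ univ φ) (hL0 : 0 ≤ L) (hL : HasSecondDifferenceBound L φ)
    (hA : ∀ x, φ x ≤ A * (1 + ‖x‖)) (hA0 : 0 ≤ A)
    (hψ : IsCone ψ) (h : Tendsto (fun x => φ x - ψ x) (Bornology.cobounded _) (𝓝 0))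
    {ε : ℝ} (hε : 0 < ε) :
    ∃ b : EuclideanSpace ℝ (Fin n) → ℝ, (∀ᶠ x in Bornology.cobounded _, b x < 3 * ε) ∧
      ∀ v, IsSubsolution k s φ v → (∀ ε' > 0, ∀ᶠ x in Bornology.cobounded _, v x - φ x < ε') →
        ∀ x, v x ≤ φ x + b x := by
  have hn : 1 ≤ n := by omega
  have mF := measurable_fracKernel n s
  have mQ := measurable_quadLin (n := n)
  set c := ENNReal.ofReal (fracLaplacianConst n s) with hc
  set I := ∫⁻ x : EuclideanSpace ℝ (Fin n), ENNReal.ofReal (quadLin x) * (fracKernel n s x : ℝ≥0∞)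
    with hI
  have hI' : I < ⊤ := lintegral_quadLin_mul_fracKernel_lt_top hn hs hs'
  have hcI : c * I ≠ ⊤ := ENNReal.mul_ne_top (by simp [hc]) hI'.ne
  set J := (c * I).toReal with hJ
  have hJ0 : 0 ≤ J := ENNReal.toReal_nonneg
  have hJ' : c * I = ENNReal.ofReal J := (ENNReal.ofReal_toReal hcI).symm
  set C := max (L / 2) (2 * A) with hC
  have hC0 : 0 ≤ C := le_max_of_le_left (by positivity)
  have hgrad := gradient_mem_subdifferentialAt hφ hφv hL
  have hbound : ∀ x, c * fracEnergy s φ x ≤ ENNReal.ofReal (C * J) := by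
    intro x
    rw [ENNReal.ofReal_mul hC0, ← hJ', mul_left_comm]
    gcongr
    rw [fracEnergy, hI, ← lintegral_const_mul _ (by fun_prop)]
    refine lintegral_mono fun h => ?_
    rw [← mul_assoc, ← ENNReal.ofReal_mul hC0]
    gcongr
    exact affineGap_le_quadLin hφ hφv hL hA hA0 (hgrad x) h
  have hlim : Tendsto (fun x => c * fracEnergy s φ x) (Bornology.cobounded _) (𝓝 0) := by
    simpa using ENNReal.Tendsto.const_mul (a := c)
      (tendsto_fracEnergy hn hs hs' hφ hφv hL0 hL hA hA0 hψ h) (Or.inr (by simp [hc]))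
  obtain ⟨R, -, hR⟩ := (hasBasis_cobounded_norm (E := EuclideanSpace ℝ (Fin n))).eventually_iff.1
    (hlim.eventually (gt_mem_nhds (ENNReal.ofReal_pos.2 hε)))
  set ρ := max R (max 1 (2 * J)) with hρ
  have hρR : R ≤ ρ := le_max_left _ _
  have hρ1 : 1 ≤ ρ := (le_max_left _ _).trans (le_max_right _ _)
  have hρJ : 2 * J ≤ ρ := (le_max_right _ _).trans (le_max_right _ _)
  have hρ0 : 0 < ρ := by linarith
  set M := 4 * (C * J) with hM
  have hM0 : 0 ≤ M := by positivity
  set b : EuclideanSpace ℝ (Fin n) → ℝ := fun x => 2 * ε + M * (bracket (ρ⁻¹ • x))⁻¹ with hb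
  have hbc : Continuous b := by
    have h1 : Continuous fun x : EuclideanSpace ℝ (Fin n) => bracket (ρ⁻¹ • x) :=
      continuous_bracket.comp (by fun_prop)
    have h2 := h1.inv₀ fun x => by have := one_le_bracket (ρ⁻¹ • x); positivity
    exact continuous_const.add (continuous_const.mul h2)
  have hb0 : ∀ x, 2 * ε ≤ b x := fun x => by
    have := one_le_bracket (ρ⁻¹ • x)
    have : 0 ≤ M * (bracket (ρ⁻¹ • x))⁻¹ := by positivity
    simp only [hb]; linarith
  refine ⟨b, ?_, fun v hv hev => ?_⟩
  · refine (hasBasis_cobounded_norm (E := EuclideanSpace ℝ (Fin n))).eventually_iff.2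
      ⟨ρ * (M / ε + 1), trivial, fun x hx => ?_⟩
    have hx : ρ * (M / ε + 1) ≤ ‖x‖ := hx
    have h1 := norm_le_bracket (ρ⁻¹ • x)
    have h2 := one_le_bracket (ρ⁻¹ • x)
    rw [norm_smul, norm_inv, Real.norm_of_nonneg hρ0.le] at h1
    have h3 : M / ε + 1 ≤ ρ⁻¹ * ‖x‖ := by rwa [le_inv_mul_iff₀ hρ0]
    have h4 : M / ε < bracket (ρ⁻¹ • x) := by linarith
    rw [div_lt_iff₀ hε] at h4
    have h5 : M * (bracket (ρ⁻¹ • x))⁻¹ < ε := by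
      rw [mul_inv_lt_iff₀ (by linarith)]; linarith
    simp only [hb]; linarith
  · by_contra! hcon
    obtain ⟨x₁, hx₁⟩ := hcon
    have hg : Continuous fun y => v y - φ y - b y := by
      have := hv.1
      fun_prop
    obtain ⟨x₀, hpos, hmax⟩ := exists_max_of_eventually_nonpos hg
      ((hev (2 * ε) (by linarith)).mono fun y hy => by linarith [hb0 y]) (x₁ := x₁) (by linarith)
    set S := bracket (ρ⁻¹ • x₀) with hS
    have hS1 : 1 ≤ S := one_le_bracket _
    -- Second order expansion of the barrier at the touching point.
    set q : EuclideanSpace ℝ (Fin n) := -((M / (S ^ 3 * ρ ^ 2)) • x₀) with hq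
    have hbexp : ∀ h, b (x₀ + h) - b x₀ - inner ℝ h q ≤ M * S⁻¹ * ρ⁻¹ * quadLin h := by
      intro h
      have h1 := inv_bracket_add_le (ρ⁻¹ • x₀) (ρ⁻¹ • h)
      rw [← smul_add, inner_smul_left, inner_smul_right] at h1
      simp only [RCLike.conj_to_real] at h1
      have h2 : quadLin (ρ⁻¹ • h) ≤ ρ⁻¹ * quadLin h := by
        have hinv : ρ⁻¹ ≤ 1 := inv_le_one_of_one_le₀ hρ1
        have hinv0 : 0 < ρ⁻¹ := by positivity
        unfold quadLin
        rw [norm_smul, norm_inv, Real.norm_of_nonneg hρ0.le, mul_pow,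
          mul_min_of_nonneg _ _ hinv0.le]
        refine min_le_min ?_ le_rfl
        gcongr
        nlinarith
      have h3 : (bracket (ρ⁻¹ • x₀))⁻¹ * quadLin (ρ⁻¹ • h) ≤ S⁻¹ * (ρ⁻¹ * quadLin h) := by
        rw [← hS]; gcongr
      have h4 : M * (bracket (ρ⁻¹ • (x₀ + h)))⁻¹ ≤ M * (S⁻¹ - ρ⁻¹ * (ρ⁻¹ * inner ℝ h x₀) / S ^ 3 +
          S⁻¹ * (ρ⁻¹ * quadLin h)) := by
        gcongr
        linarith
      have h5 : inner ℝ h q = -(M * (ρ⁻¹ * (ρ⁻¹ * inner ℝ h x₀) / S ^ 3)) := by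
        rw [hq, inner_neg_right, inner_smul_right]
        field_simp
      rw [h5]
      simp only [hb, ← hS]
      linarith
    have hvexp : ∀ p h, affineGap v x₀ p h ≤ affineGap φ x₀ (gradient φ x₀) h +
        M * S⁻¹ * ρ⁻¹ * quadLin h + inner ℝ h (gradient φ x₀ + q - p) := by
      intro p h
      have h1 := hbexp h
      have h2 := hmax (x₀ + h)
      unfold affineGap
      rw [inner_sub_right, inner_add_right]
      linarith
    have hp_unique : ∀ p ∈ subdifferentialAt v x₀, p = gradient φ x₀ + q := by
      intro p hp
      refine eq_of_forall_inner_sub_le (C := L / 2 + M * S⁻¹ * ρ⁻¹) fun h => ?_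
      have h1 := hvexp p h
      have h2 := affineGap_nonneg hp h
      have h3 := hL.affineGap_le (hgrad x₀) h
      have h4 : M * S⁻¹ * ρ⁻¹ * quadLin h ≤ M * S⁻¹ * ρ⁻¹ * ‖h‖ ^ 2 := by
        gcongr; exact min_le_left _ _
      have h5 : inner ℝ h (p - (gradient φ x₀ + q)) = -inner ℝ h (gradient φ x₀ + q - p) := by
        rw [← inner_neg_right, neg_sub]
      rw [h5]
      linarith
    have hop : nonlocalOp k s v x₀ ≤ c * fracEnergy s φ x₀ + ENNReal.ofReal (M * S⁻¹ / 2) := by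
      have hQ : ⨆ p ∈ subdifferentialAt v x₀, kernelInf n k s (affineGap v x₀ p) ≤
          fracEnergy s φ x₀ + ENNReal.ofReal (M * S⁻¹ * ρ⁻¹) * I := by
        refine iSup₂_le fun p hp => ?_
        refine (iInf₂_le _ (fracKernel_mem hk hkn.le (by linarith))).trans ?_
        rw [fracEnergy, hI, ← lintegral_const_mul _ (by fun_prop),
          ← lintegral_add_right _ (by fun_prop)]
        refine lintegral_mono fun h => ?_
        rw [← mul_assoc, ← add_mul, ← ENNReal.ofReal_mul (by positivity)]
        gcongr
        refine le_trans (ENNReal.ofReal_le_ofReal ?_) ENNReal.ofReal_add_le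
        have := hvexp p h
        rw [hp_unique p hp, sub_self, inner_zero_right, add_zero] at this
        rwa [hp_unique p hp]
      rw [nonlocalOp_eq]
      refine (mul_le_mul_right hQ c).trans ?_
      rw [mul_add, mul_left_comm, hJ', ← ENNReal.ofReal_mul (by positivity)]
      gcongr
      rw [mul_assoc, div_eq_mul_inv]
      gcongr
      rw [inv_mul_le_iff₀ hρ0]
      linarith
    have hsub := EReal.coe_le_coe_ennreal_iff.1 (hv.2.2 x₀)
    have hstrict : 2 * ε + M * S⁻¹ < v x₀ - φ x₀ := by
      have : b x₀ = 2 * ε + M * S⁻¹ := rfl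
      linarith
    have hMS : 0 ≤ M * S⁻¹ := by positivity
    rcases le_or_gt R ‖x₀‖ with hx | hx
    · have h1 := (hsub.trans hop).trans (add_le_add_left (hR hx).le _)
      rw [← ENNReal.ofReal_add hε.le (by positivity),
        ENNReal.ofReal_le_ofReal_iff (by positivity)] at h1
      linarith
    · have h1 := (hsub.trans hop).trans (add_le_add_left (hbound x₀) _)
      rw [← ENNReal.ofReal_add (by positivity) (by positivity),
        ENNReal.ofReal_le_ofReal_iff (by positivity)] at h1
      have hS2 : S ≤ 2 := by
        have h2 := bracket_sq (ρ⁻¹ • x₀)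
        rw [norm_smul, norm_inv, Real.norm_of_nonneg hρ0.le, ← hS] at h2
        have h3 : ρ⁻¹ * ‖x₀‖ ≤ 1 := by rw [inv_mul_le_iff₀ hρ0]; linarith
        have h4 : 0 ≤ ρ⁻¹ * ‖x₀‖ := by positivity
        nlinarith
      have h5 : (2 : ℝ)⁻¹ ≤ S⁻¹ := by gcongr
      have h6 : M * 2⁻¹ ≤ M * S⁻¹ := by gcongr
      linarith

/-! ### The Perron solution -/

/-- The hypotheses on the right-hand side `φ`, with a bound `L` for its second differences and a
constant `A` for its linear growth. -/
structure IsConicDatum {n : ℕ} (k : ℕ) (s : ℝ) (φ ψ : EuclideanSpace ℝ (Fin n) → ℝ) (L A : ℝ) :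
    Prop where
  one_le : 1 ≤ k
  lt : k < n
  half_lt : 1 / 2 < s
  lt_one : s < 1
  continuous : Continuous φ
  strictConvex : StrictConvexOn ℝ univ φ
  L_nonneg : 0 ≤ L
  second : HasSecondDifferenceBound L φ
  A_nonneg : 0 ≤ A
  growth : ∀ x, φ x ≤ A * (1 + ‖x‖)
  cone : IsCone ψ
  asymptotic : Tendsto (fun x => φ x - ψ x) (Bornology.cobounded _) (𝓝 0)

/-- The subsolutions which are asymptotically below `φ`. -/
def subsolutionClass {n : ℕ} (k : ℕ) (s : ℝ) (φ : EuclideanSpace ℝ (Fin n) → ℝ) :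
    Set (EuclideanSpace ℝ (Fin n) → ℝ) :=
  {v | IsSubsolution k s φ v ∧ ∀ ε > 0, ∀ᶠ x in Bornology.cobounded _, v x - φ x < ε}

/-- The supremum of the subsolutions which are asymptotically below `φ`. -/
noncomputable def perronSolution {n : ℕ} (k : ℕ) (s : ℝ) (φ : EuclideanSpace ℝ (Fin n) → ℝ)
    (x : EuclideanSpace ℝ (Fin n)) : ℝ :=
  ⨆ v : subsolutionClass k s φ, v.1 x

namespace IsConicDatum

variable {n k : ℕ} {s : ℝ} {φ ψ : EuclideanSpace ℝ (Fin n) → ℝ} {L A : ℝ}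

theorem exists_barrier (H : IsConicDatum k s φ ψ L A) {ε : ℝ} (hε : 0 < ε) :
    ∃ b : EuclideanSpace ℝ (Fin n) → ℝ, (∀ᶠ x in Bornology.cobounded _, b x < 3 * ε) ∧
      ∀ v ∈ subsolutionClass k s φ, ∀ x, v x ≤ φ x + b x := by
  obtain ⟨b, hb, hv⟩ := _root_.exists_barrier H.one_le H.lt H.half_lt H.lt_one H.continuous
    H.strictConvex.convexOn H.L_nonneg H.second H.growth H.A_nonneg H.cone H.asymptotic hε
  exact ⟨b, hb, fun v h => hv v h.1 h.2⟩

theorem self_mem (H : IsConicDatum k s φ ψ L A) : φ ∈ subsolutionClass k s φ := by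
  refine ⟨⟨H.continuous, H.strictConvex.convexOn, fun x => ?_⟩, fun ε hε => ?_⟩
  · rw [sub_self, EReal.coe_zero]
    exact EReal.coe_ennreal_nonneg _
  · exact Eventually.of_forall fun x => by rwa [sub_self]

theorem le_perronSolution (H : IsConicDatum k s φ ψ L A) {v : EuclideanSpace ℝ (Fin n) → ℝ}
    (hv : v ∈ subsolutionClass k s φ) (x : EuclideanSpace ℝ (Fin n)) :
    v x ≤ perronSolution k s φ x := by
  obtain ⟨b, -, hb⟩ := H.exists_barrier one_pos
  exact le_ciSup (f := fun v : subsolutionClass k s φ => v.1 x)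
    ⟨φ x + b x, by rintro _ ⟨w, rfl⟩; exact hb w.1 w.2 x⟩ ⟨v, hv⟩

theorem self_le_perronSolution (H : IsConicDatum k s φ ψ L A) (x : EuclideanSpace ℝ (Fin n)) :
    φ x ≤ perronSolution k s φ x := H.le_perronSolution H.self_mem x

theorem perronSolution_le (H : IsConicDatum k s φ ψ L A) {x : EuclideanSpace ℝ (Fin n)} {c : ℝ}
    (h : ∀ v ∈ subsolutionClass k s φ, v x ≤ c) : perronSolution k s φ x ≤ c := by
  have : Nonempty (subsolutionClass k s φ) := ⟨⟨φ, H.self_mem⟩⟩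
  exact ciSup_le fun v => h v.1 v.2

theorem exists_lt_of_lt_perronSolution (H : IsConicDatum k s φ ψ L A)
    {x : EuclideanSpace ℝ (Fin n)} {c : ℝ}
    (h : c < perronSolution k s φ x) : ∃ v ∈ subsolutionClass k s φ, c < v x := by
  by_contra! hcon
  exact (H.perronSolution_le hcon).not_gt h

theorem tendsto_perronSolution_sub (H : IsConicDatum k s φ ψ L A) :
    Tendsto (fun x => perronSolution k s φ x - φ x) (Bornology.cobounded _) (𝓝 0) := by
  rw [Metric.tendsto_nhds]
  intro ε hε
  obtain ⟨b, hb, hv⟩ := H.exists_barrier (ε := ε / 3) (by positivity)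
  filter_upwards [hb] with x hx
  have h1 := H.self_le_perronSolution x
  have h2 := H.perronSolution_le fun v h => hv v h x
  rw [Real.dist_eq, sub_zero, abs_of_nonneg (by linarith)]
  linarith

theorem convexOn_perronSolution (H : IsConicDatum k s φ ψ L A) :
    ConvexOn ℝ univ (perronSolution k s φ) := by
  refine ⟨convex_univ, fun x _ y _ a b ha hb hab => H.perronSolution_le fun v hv => ?_⟩
  have h1 := hv.1.2.1.2 (mem_univ x) (mem_univ y) ha hb hab
  refine h1.trans ?_
  simp only [smul_eq_mul]
  gcongr
  · exact H.le_perronSolution hv x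
  · exact H.le_perronSolution hv y

theorem continuous_perronSolution (H : IsConicDatum k s φ ψ L A) :
    Continuous (perronSolution k s φ) :=
  continuousOn_univ.1 (H.convexOn_perronSolution.continuousOn isOpen_univ)

end IsConicDatum

theorem kernelInf_add_le {n k : ℕ} {s : ℝ} {W₁ W₂ W : EuclideanSpace ℝ (Fin n) → ℝ}
    (h₁ : Measurable W₁) (h : ∀ x, W₁ x + W₂ x ≤ 2 * W x) (h₁0 : ∀ x, 0 ≤ W₁ x)
    (h₂0 : ∀ x, 0 ≤ W₂ x) :
    kernelInf n k s W₁ + kernelInf n k s W₂ ≤ 2 * kernelInf n k s W := by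
  rw [kernelInf, kernelInf, kernelInf, ENNReal.mul_iInf_of_ne two_ne_zero ENNReal.ofNat_ne_top]
  refine le_iInf fun K => ?_
  rw [ENNReal.mul_iInf_of_ne two_ne_zero ENNReal.ofNat_ne_top]
  refine le_iInf fun hK => ?_
  have mK := hK.1
  refine (add_le_add (iInf₂_le K hK) (iInf₂_le K hK)).trans ?_
  rw [← lintegral_add_left (by fun_prop), ← lintegral_const_mul' _ _ ENNReal.ofNat_ne_top]
  refine lintegral_mono fun x => ?_
  rw [← add_mul, ← mul_assoc, ← ENNReal.ofReal_add (h₁0 x) (h₂0 x), ← ENNReal.ofReal_ofNat,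
    ← ENNReal.ofReal_mul zero_le_two]
  gcongr
  exact h x

theorem ENNReal.two_mul_ofReal (a : ℝ) : 2 * ENNReal.ofReal a = ENNReal.ofReal (2 * a) := by
  rw [ENNReal.ofReal_mul zero_le_two, ENNReal.ofReal_ofNat]

/-- The operator is concave under translated averages. -/
theorem nonlocalOp_add_le {n k : ℕ} {s : ℝ} {v₁ v₂ g : EuclideanSpace ℝ (Fin n) → ℝ}
    (hc₁ : Continuous v₁) (hv₁ : ConvexOn ℝ univ v₁) (hc₂ : Continuous v₂)
    (hv₂ : ConvexOn ℝ univ v₂) {x x₁ x₂ : EuclideanSpace ℝ (Fin n)}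
    (hg : ∀ h, 2 * (g (x + h) - g x) = (v₁ (x₁ + h) - v₁ x₁) + (v₂ (x₂ + h) - v₂ x₂)) :
    nonlocalOp k s v₁ x₁ + nonlocalOp k s v₂ x₂ ≤ 2 * nonlocalOp k s g x := by
  simp only [nonlocalOp_eq]
  rw [← mul_add, mul_left_comm]
  refine mul_le_mul_right ?_ _
  refine ENNReal.biSup_add_biSup_le' (subdifferentialAt_nonempty hc₁ hv₁ x₁)
    (subdifferentialAt_nonempty hc₂ hv₂ x₂) fun p₁ hp₁ p₂ hp₂ => ?_
  have hp : (2⁻¹ : ℝ) • (p₁ + p₂) ∈ subdifferentialAt g x := by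
    rw [mem_subdifferentialAt_iff] at *
    intro h
    rw [inner_smul_right, inner_add_right]
    linarith [hg h, hp₁ h, hp₂ h]
  refine le_trans (kernelInf_add_le (W := affineGap g x ((2⁻¹ : ℝ) • (p₁ + p₂)))
    (continuous_affineGap hc₁ x₁ p₁).measurable (fun h => ?_) (affineGap_nonneg hp₁)
    (affineGap_nonneg hp₂))
    (mul_le_mul_right (le_iSup₂ (f := fun p _ => kernelInf n k s (affineGap g x p)) _ hp) _)
  unfold affineGap
  rw [inner_smul_right, inner_add_right]
  linarith [hg h]

namespace IsConicDatum

variable {n k : ℕ} {s : ℝ} {φ ψ : EuclideanSpace ℝ (Fin n) → ℝ} {L A : ℝ}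

/-- Averages of translated subsolutions, lowered by the second difference bound of `φ`, are
subsolutions. -/
theorem average_mem (H : IsConicDatum k s φ ψ L A) {v₁ v₂ : EuclideanSpace ℝ (Fin n) → ℝ}
    (h₁ : v₁ ∈ subsolutionClass k s φ) (h₂ : v₂ ∈ subsolutionClass k s φ)
    (h : EuclideanSpace ℝ (Fin n)) :
    (fun x => 2⁻¹ * (v₁ (x + h) + v₂ (x - h) - L * ‖h‖ ^ 2)) ∈ subsolutionClass k s φ := by
  refine ⟨⟨?_, ?_, fun x => ?_⟩, fun ε hε => ?_⟩
  · have := h₁.1.1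
    have := h₂.1.1
    fun_prop
  · refine ⟨convex_univ, fun x _ y _ a b ha hb hab => ?_⟩
    have e1 := h₁.1.2.1.2 (mem_univ (x + h)) (mem_univ (y + h)) ha hb hab
    have e2 := h₂.1.2.1.2 (mem_univ (x - h)) (mem_univ (y - h)) ha hb hab
    have c1 : a • (x + h) + b • (y + h) = a • x + b • y + h := by
      have : h = a • h + b • h := by rw [← add_smul, hab, one_smul]
      nth_rewrite 3 [this]
      rw [smul_add, smul_add]; abel
    have c2 : a • (x - h) + b • (y - h) = a • x + b • y - h := by
      have : h = a • h + b • h := by rw [← add_smul, hab, one_smul]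
      nth_rewrite 3 [this]
      rw [smul_sub, smul_sub]; abel
    rw [c1] at e1
    rw [c2] at e2
    simp only [smul_eq_mul] at *
    have hb' : b = 1 - a := by linarith
    subst hb'
    linarith
  · rw [EReal.coe_le_coe_ennreal_iff]
    have f1 := EReal.coe_le_coe_ennreal_iff.1 (h₁.1.2.2 (x + h))
    have f2 := EReal.coe_le_coe_ennreal_iff.1 (h₂.1.2.2 (x - h))
    have f3 := nonlocalOp_add_le (k := k) (s := s) (x := x) (x₁ := x + h) (x₂ := x - h)
      (g := fun x => 2⁻¹ * (v₁ (x + h) + v₂ (x - h) - L * ‖h‖ ^ 2)) h₁.1.1 h₁.1.2.1 h₂.1.1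
      h₂.1.2.1 (fun y => by
        have e1 : x + y + h = x + h + y := by abel
        have e2 : x + y - h = x - h + y := by abel
        rw [e1, e2]; ring)
    have f4 : 2 * ENNReal.ofReal (2⁻¹ * (v₁ (x + h) + v₂ (x - h) - L * ‖h‖ ^ 2) - φ x) ≤
        ENNReal.ofReal (v₁ (x + h) - φ (x + h)) + ENNReal.ofReal (v₂ (x - h) - φ (x - h)) := by
      rw [ENNReal.two_mul_ofReal]
      refine le_trans (ENNReal.ofReal_le_ofReal ?_) ENNReal.ofReal_add_le
      have := H.second x h
      linarith
    have f5 := (f4.trans (add_le_add f1 f2)).trans f3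
    exact (ENNReal.mul_le_mul_iff_right two_ne_zero ENNReal.ofNat_ne_top).1 f5
  · have t1 : Tendsto (fun x : EuclideanSpace ℝ (Fin n) => x + h) (Bornology.cobounded _)
      (Bornology.cobounded _) := tendsto_add_const_cobounded h
    have t2 : Tendsto (fun x : EuclideanSpace ℝ (Fin n) => x - h) (Bornology.cobounded _)
      (Bornology.cobounded _) := by
      simpa only [sub_eq_add_neg] using tendsto_add_const_cobounded (-h)
    filter_upwards [t1.eventually (h₁.2 ε hε), t2.eventually (h₂.2 ε hε)] with x g1 g2
    linarith [H.second x h]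

/-- The Perron solution inherits the second difference bound of `φ`. -/
theorem second_perronSolution (H : IsConicDatum k s φ ψ L A) :
    HasSecondDifferenceBound L (perronSolution k s φ) := by
  intro x h
  have key : ∀ v₁ ∈ subsolutionClass k s φ, ∀ v₂ ∈ subsolutionClass k s φ,
      v₁ (x + h) + v₂ (x - h) - L * ‖h‖ ^ 2 ≤ 2 * perronSolution k s φ x := by
    intro v₁ h₁ v₂ h₂
    have := H.le_perronSolution (H.average_mem h₁ h₂ h) x
    linarith
  have h1 : ∀ v₂ ∈ subsolutionClass k s φ, perronSolution k s φ (x + h) ≤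
      2 * perronSolution k s φ x + L * ‖h‖ ^ 2 - v₂ (x - h) := fun v₂ h₂ =>
    H.perronSolution_le fun v₁ h₁ => by linarith [key v₁ h₁ v₂ h₂]
  have h2 : perronSolution k s φ (x - h) ≤
      2 * perronSolution k s φ x + L * ‖h‖ ^ 2 - perronSolution k s φ (x + h) :=
    H.perronSolution_le fun v₂ h₂ => by linarith [h1 v₂ h₂]
  linarith

theorem exists_growth_perronSolution (H : IsConicDatum k s φ ψ L A) :
    ∃ B ≥ 0, ∀ x, perronSolution k s φ x ≤ B * (1 + ‖x‖) := by
  obtain ⟨M, hM0, hM⟩ := exists_abs_le_of_tendsto_zero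
    (H.continuous_perronSolution.sub H.continuous) H.tendsto_perronSolution_sub
  refine ⟨A + M, add_nonneg H.A_nonneg hM0, fun x => ?_⟩
  have h1 := le_of_abs_le (hM x)
  have h2 := H.growth x
  simp only [Pi.sub_apply] at h1
  nlinarith [norm_nonneg x]

/-- The Perron solution is affine on no ray: it lies above the strictly convex function `φ`, and
is asymptotic to it. -/
theorem exists_coercive (H : IsConicDatum k s φ ψ L A) {x p : EuclideanSpace ℝ (Fin n)}
    (hp : p ∈ subdifferentialAt (perronSolution k s φ) x) :
    ∃ a > 0, ∃ R ≥ 1, ∀ h, R ≤ ‖h‖ → a * ‖h‖ ≤ affineGap (perronSolution k s φ) x p h := by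
  refine exists_mul_norm_le_of_no_ray (continuous_affineGap H.continuous_perronSolution x p)
    (convexOn_affineGap H.convexOn_perronSolution x p) (affineGap_zero _ _ _) fun e he => ?_
  by_contra! hcon
  set q : ℝ → ℝ := fun t => φ (x + t • e) - perronSolution k s φ x - t * inner ℝ e p with hq
  have hray : ∀ t : ℝ, 0 ≤ t → perronSolution k s φ (x + t • e) =
      perronSolution k s φ x + t * inner ℝ e p := by
    intro t ht
    rcases ht.eq_or_lt with rfl | ht
    · simp
    have h1 := le_antisymm (hcon t ht) (affineGap_nonneg hp _)
    unfold affineGap at h1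
    rw [inner_smul_left] at h1
    simp only [RCLike.conj_to_real] at h1
    linarith
  have hq0 : ∀ t : ℝ, 0 ≤ t → q t ≤ 0 := by
    intro t ht
    have := H.self_le_perronSolution (x + t • e)
    rw [hray t ht] at this
    simp only [hq]; linarith
  have hmid : ∀ t : ℝ, x + ((1 + t) / 2) • e =
      (1 / 2 : ℝ) • (x + (1 : ℝ) • e) + (1 / 2 : ℝ) • (x + t • e) := by
    intro t
    module
  have hq1 : q 1 < 0 := by
    have hne : x + (0 : ℝ) • e ≠ x + (2 : ℝ) • e := by
      intro heq
      have h0 : (2 : ℝ) • e = 0 := by simpa using heq.symm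
      have := congrArg norm h0
      rw [norm_smul, he] at this
      norm_num at this
    have h1 := H.strictConvex.2 (mem_univ (x + (0 : ℝ) • e)) (mem_univ (x + (2 : ℝ) • e)) hne
      (by norm_num : (0 : ℝ) < 1 / 2) (by norm_num : (0 : ℝ) < 1 / 2) (by norm_num)
    have e1 : (1 / 2 : ℝ) • (x + (0 : ℝ) • e) + (1 / 2 : ℝ) • (x + (2 : ℝ) • e) =
        x + (1 : ℝ) • e := by
      module
    rw [e1] at h1
    have h2 := hq0 0 le_rfl
    have h3 := hq0 2 zero_le_two
    simp only [hq, smul_eq_mul] at *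
    linarith
  have hq2 : ∀ t : ℝ, 0 ≤ t → q ((1 + t) / 2) ≤ q 1 / 2 := by
    intro t ht
    have h1 := H.strictConvex.convexOn.2 (mem_univ (x + (1 : ℝ) • e)) (mem_univ (x + t • e))
      (by norm_num : (0 : ℝ) ≤ 1 / 2) (by norm_num : (0 : ℝ) ≤ 1 / 2) (by norm_num)
    rw [← hmid] at h1
    have h2 := hq0 t ht
    simp only [hq, smul_eq_mul] at *
    linarith
  have hlim : Tendsto (fun t : ℝ => q ((1 + t) / 2)) atTop (𝓝 0) := by
    have hcob : Tendsto (fun t : ℝ => x + ((1 + t) / 2) • e) atTop (Bornology.cobounded _) := by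
      rw [← tendsto_norm_atTop_iff_cobounded]
      have : Tendsto (fun t : ℝ => (1 + t) / 2 + -‖x‖) atTop atTop :=
        tendsto_atTop_add_const_right _ _
          ((tendsto_atTop_add_const_left _ _ tendsto_id).atTop_div_const two_pos)
      refine tendsto_atTop_mono' _ ?_ this
      filter_upwards [eventually_ge_atTop 0] with t ht
      have := norm_sub_norm_le (((1 + t) / 2) • e) (-x)
      rw [sub_neg_eq_add, norm_neg, norm_smul, he,
        Real.norm_of_nonneg (by positivity), mul_one] at this
      rw [add_comm x]
      linarith
    have h1 := (H.tendsto_perronSolution_sub.comp hcob).neg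
    rw [neg_zero] at h1
    refine h1.congr' ?_
    filter_upwards [eventually_ge_atTop 0] with t ht
    simp only [Function.comp_apply, hq]
    rw [hray _ (by positivity)]
    ring
  have := le_of_tendsto hlim (by
    filter_upwards [eventually_ge_atTop 0] with t ht using hq2 t ht)
  linarith

end IsConicDatum

/-! ### The Perron solution is a subsolution -/

/-- The value `c_{n,s} inf_K ∫ W K` which the operator takes on a function whose affine gap at the
point in question is `W`. -/
noncomputable def kernelValue (n k : ℕ) (s : ℝ) (W : EuclideanSpace ℝ (Fin n) → ℝ) : ℝ≥0∞ :=
  ENNReal.ofReal (fracLaplacianConst n s) * kernelInf n k s W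

theorem exists_kernelValue_le_add {n k : ℕ} {s : ℝ} (hk : 1 ≤ k) (hkn : k < n) (hs : 1 / 2 < s)
    (hs' : s < 1) {a R C τ : ℝ} (ha : 0 < a) (hR : 1 ≤ R) (hC : 0 ≤ C) (hτ : 0 < τ) :
    ∃ η > 0, ∀ W W' : EuclideanSpace ℝ (Fin n) → ℝ, Measurable W' → (∀ x, 0 ≤ W' x) →
      (∀ x, R ≤ ‖x‖ → a * ‖x‖ ≤ W' x) → (∀ x, W x ≤ C * quadLin x) →
      (∀ x, W x ≤ W' x + η * (1 + ‖x‖)) →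
      kernelValue n k s W ≤ kernelValue n k s W' + ENNReal.ofReal τ := by
  set c := fracLaplacianConst n s with hc
  obtain ⟨η, hη, h⟩ := exists_kernelInf_le_add (s := s) hk hkn hs hs' ha hR hC
    (κ := ENNReal.ofReal (τ / (max c 0 + 1))) (ENNReal.ofReal_pos.2 (by positivity))
  refine ⟨η, hη, fun W W' h1 h2 h3 h4 h5 => ?_⟩
  unfold kernelValue
  refine (mul_le_mul_right (h W W' h1 h2 h3 h4 h5) _).trans ?_
  rw [mul_add, ← hc]
  gcongr
  rw [← ENNReal.ofReal_mul' (by positivity)]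
  refine ENNReal.ofReal_le_ofReal ?_
  rw [mul_div_assoc', div_le_iff₀ (by positivity)]
  nlinarith [le_max_left c 0]

theorem HasSecondDifferenceBound.nonlocalOp_eq_kernelValue {n k : ℕ} {s L : ℝ}
    {u : EuclideanSpace ℝ (Fin n) → ℝ} (hL : HasSecondDifferenceBound L u)
    {x p : EuclideanSpace ℝ (Fin n)} (hp : p ∈ subdifferentialAt u x) :
    nonlocalOp k s u x = kernelValue n k s (affineGap u x p) := by
  rw [nonlocalOp_eq, kernelValue]
  congr 1
  exact le_antisymm (iSup₂_le fun q hq => by rw [hL.eq_of_mem hq hp])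
    (le_iSup₂ (f := fun p _ => kernelInf n k s (affineGap u x p)) p hp)

namespace IsConicDatum

variable {n k : ℕ} {s : ℝ} {φ ψ : EuclideanSpace ℝ (Fin n) → ℝ} {L A : ℝ}

/-- Subsolutions which almost attain the supremum at `x₀` are touched from above, near `x₀`, by the
Perron solution plus a small multiple of `bracket (· - x₀)`. The affine gaps at the touching points
converge to that of the Perron solution at `x₀`, along which the operator is continuous. -/
theorem isSubsolution_perronSolution (H : IsConicDatum k s φ ψ L A) :
    IsSubsolution k s φ (perronSolution k s φ) := by
  set u := perronSolution k s φ with hu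
  have huc : Continuous u := H.continuous_perronSolution
  have huv : ConvexOn ℝ univ u := H.convexOn_perronSolution
  have hL : HasSecondDifferenceBound L u := H.second_perronSolution
  have hL0 := H.L_nonneg
  refine ⟨huc, huv, fun x₀ => ?_⟩
  rw [EReal.coe_le_coe_ennreal_iff]
  obtain ⟨p₀, hp₀⟩ := subdifferentialAt_nonempty huc huv x₀
  obtain ⟨B, hB0, hB⟩ := H.exists_growth_perronSolution
  obtain ⟨a, ha, R, hR, hcoer⟩ := H.exists_coercive hp₀
  rw [hL.nonlocalOp_eq_kernelValue hp₀]
  suffices hτ : ∀ τ : ℝ, 0 < τ → ENNReal.ofReal (u x₀ - φ x₀) ≤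
      kernelValue n k s (affineGap u x₀ p₀) + ENNReal.ofReal τ by
    refine ENNReal.le_of_forall_pos_le_add fun τ h _ => ?_
    simpa using hτ τ h
  intro τ hτ
  set C := max (L / 2) (2 * B) + 2 with hC
  have hC0 : 0 ≤ max (L / 2) (2 * B) := le_max_of_le_left (by positivity)
  obtain ⟨η, hη, hstab⟩ := exists_kernelValue_le_add (s := s) H.one_le H.lt H.half_lt H.lt_one ha
    hR (show 0 ≤ C by positivity) (half_pos hτ)
  have hf : Continuous fun x => u x - φ x := huc.sub H.continuous
  obtain ⟨r₁, hr₁, hr₁f⟩ := Metric.continuous_iff.1 hf x₀ (τ / 4) (by positivity)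
  set ε := min 1 (η / 4) with hε
  have hε0 : 0 < ε := by positivity
  have hε1 : ε ≤ 1 := min_le_left _ _
  have hεη : ε ≤ η / 4 := min_le_right _ _
  set r := min r₁ (η / (2 * (2 * B + L + 1))) with hr
  have hr0 : 0 < r := by positivity
  have hrr : r ≤ r₁ := min_le_left _ _
  have hrη : (2 * B + L) * r ≤ η / 2 := by
    have h1 : r ≤ η / (2 * (2 * B + L + 1)) := min_le_right _ _
    rw [le_div_iff₀ (by positivity)] at h1
    nlinarith
  have hsq : 1 < Real.sqrt (1 + r ^ 2) := by
    rw [Real.lt_sqrt zero_le_one]; nlinarith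
  set δ := min (τ / 4) (ε * (Real.sqrt (1 + r ^ 2) - 1) / 2) with hδ
  have hδ0 : 0 < δ := by
    have : 0 < Real.sqrt (1 + r ^ 2) - 1 := by linarith
    positivity
  have hδτ : δ ≤ τ / 4 := min_le_left _ _
  have hδε : 2 * δ ≤ ε * (Real.sqrt (1 + r ^ 2) - 1) := by
    have : δ ≤ ε * (Real.sqrt (1 + r ^ 2) - 1) / 2 := min_le_right _ _
    linarith
  obtain ⟨v, hv, hvx⟩ := H.exists_lt_of_lt_perronSolution (x := x₀) (c := u x₀ - δ) (by
    rw [← hu]; linarith)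
  have hvu : ∀ x, v x ≤ u x := H.le_perronSolution hv
  set G : EuclideanSpace ℝ (Fin n) → ℝ :=
    fun y => v y - u y - ε * (bracket (y - x₀) - 1) + δ with hG
  have hGc : Continuous G := by
    have h1 := hv.1.1
    have h2 : Continuous fun y : EuclideanSpace ℝ (Fin n) => bracket (y - x₀) :=
      continuous_bracket.comp (by fun_prop)
    fun_prop
  have hGfar : ∀ y, r ≤ ‖y - x₀‖ → G y ≤ 0 := by
    intro y hy
    have h1 : Real.sqrt (1 + r ^ 2) ≤ bracket (y - x₀) := by
      unfold bracket; gcongr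
    have h2 : ε * (Real.sqrt (1 + r ^ 2) - 1) ≤ ε * (bracket (y - x₀) - 1) := by gcongr
    simp only [hG]
    linarith [hvu y]
  have hev : ∀ᶠ y in Bornology.cobounded _, G y ≤ 0 :=
    ((tendsto_norm_cobounded_atTop.comp (tendsto_sub_const_cobounded x₀)).eventually_ge_atTop
      r).mono hGfar
  have hG1 : 0 < G x₀ := by
    simp only [hG, sub_self, bracket_zero, mul_zero]; linarith
  obtain ⟨x₁, hpos, hmax⟩ := exists_max_of_eventually_nonpos hGc hev hG1
  have hx₁ : ‖x₁ - x₀‖ < r := by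
    by_contra! h
    exact (hGfar x₁ h).not_gt hpos
  set z := x₁ - x₀ with hz
  set q := (bracket z)⁻¹ • z with hq
  obtain ⟨p₁, hp₁⟩ := subdifferentialAt_nonempty huc huv x₁
  set W : EuclideanSpace ℝ (Fin n) → ℝ :=
    fun h => affineGap u x₁ p₁ h + ε * affineGap bracket z q h with hW
  have htouch : ∀ p h, affineGap v x₁ p h ≤ W h + inner ℝ h (p₁ + ε • q - p) := by
    intro p h
    have h1 := hmax (x₁ + h)
    have h2 : x₁ + h - x₀ = z + h := by rw [hz]; abel
    simp only [hG, h2, ← hz] at h1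
    have h3 : inner ℝ h (p₁ + ε • q - p) = inner ℝ h p₁ + ε * inner ℝ h q - inner ℝ h p := by
      rw [inner_sub_right, inner_add_right, inner_smul_right h q]
    rw [h3]
    simp only [hW, affineGap]
    linarith
  have hbq : ∀ h, ε * affineGap bracket z q h ≤ 2 * ε * quadLin h := fun h => by
    have := affineGap_bracket_le z h
    nlinarith
  have hWC : ∀ h, W h ≤ C * quadLin h := by
    intro h
    have h1 := affineGap_le_quadLin huc huv hL hB hB0 hp₁ h
    have h2 := hbq h
    have h3 : 2 * ε * quadLin h ≤ 2 * quadLin h := by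
      have := quadLin_nonneg h
      nlinarith
    rw [hC, add_mul]
    exact add_le_add h1 (h2.trans h3)
  have hpu : ∀ p ∈ subdifferentialAt v x₁, p = p₁ + ε • q := by
    intro p hp
    refine eq_of_forall_inner_sub_le (C := C) fun h => ?_
    have h1 := affineGap_nonneg hp h
    have h2 := htouch p h
    have h3 : C * quadLin h ≤ C * ‖h‖ ^ 2 := by
      gcongr; exact min_le_left _ _
    have h4 : inner ℝ h (p - (p₁ + ε • q)) = -inner ℝ h (p₁ + ε • q - p) := by
      rw [← inner_neg_right, neg_sub]
    rw [h4]
    linarith [hWC h]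
  have hop : nonlocalOp k s v x₁ ≤ kernelValue n k s W := by
    rw [nonlocalOp_eq, kernelValue]
    refine mul_le_mul_right (iSup₂_le fun p hp => kernelInf_mono fun h => ?_) _
    have := htouch p h
    rwa [← hpu p hp, sub_self, inner_zero_right, add_zero] at this
  have hWW : ∀ h, W h ≤ affineGap u x₀ p₀ h + η * (1 + ‖h‖) := by
    intro h
    have h1 := (abs_le.1 (abs_sub_le_of_growth huc huv hB hB0 (x₁ + h) (x₀ + h))).2
    have h2 := (abs_le.1 (abs_sub_le_of_growth huc huv hB hB0 x₁ x₀)).1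
    rw [add_sub_add_right_eq_sub] at h1
    have h3 := hL.norm_sub_le hL0 hp₁ hp₀
    have h4 := (abs_le.1 (abs_real_inner_le_norm h (p₁ - p₀))).1
    have h5 : quadLin h ≤ ‖h‖ := min_le_right _ _
    have h6 := hbq h
    have h0 := norm_nonneg h
    rw [← hz] at h1 h2 h3
    have h7 : ‖h‖ * ‖p₁ - p₀‖ ≤ ‖h‖ * (L * r) := by
      gcongr; exact h3.trans (by gcongr)
    have h8 : B * ‖z‖ ≤ B * r := by gcongr
    have h9 : 2 * ε * quadLin h ≤ 2 * (η / 4) * ‖h‖ := by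
      have := quadLin_nonneg h
      gcongr
    have h10 : 0 ≤ L * r := by positivity
    have h11 : 0 ≤ B * r := by positivity
    have h12 : ‖h‖ * (L * r) ≤ ‖h‖ * (η / 2) := by
      gcongr; linarith
    rw [inner_sub_right] at h4
    simp only [hW]
    unfold affineGap at h6 ⊢
    linarith
  have h1 := hstab W (affineGap u x₀ p₀) (continuous_affineGap huc x₀ p₀).measurable
    (affineGap_nonneg hp₀) hcoer hWC hWW
  have h2 := (EReal.coe_le_coe_ennreal_iff.1 (hv.1.2.2 x₁)).trans (hop.trans h1)
  have h3 : u x₀ - φ x₀ ≤ (v x₁ - φ x₁) + τ / 2 := by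
    have e1 := hr₁f x₁ (by rw [dist_eq_norm]; exact hx₁.trans_le hrr)
    rw [Real.dist_eq] at e1
    have e2 := (abs_lt.1 e1).1
    have e3 : 0 ≤ ε * (bracket z - 1) := mul_nonneg hε0.le (by linarith [one_le_bracket z])
    simp only [hG, ← hz] at hpos
    linarith
  refine (ENNReal.ofReal_le_ofReal h3).trans (ENNReal.ofReal_add_le.trans ?_)
  refine (add_le_add_left h2 _).trans ?_
  rw [add_assoc, ← ENNReal.ofReal_add (by positivity) (by positivity), add_halves]

end IsConicDatum

/-! ### Gaps with a nontrivial zero set -/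

theorem StrictConvexOn.volume_eq_const {k : ℕ} (hk : 1 ≤ k) {f : EuclideanSpace ℝ (Fin k) → ℝ}
    (hf : StrictConvexOn ℝ univ f) (t : ℝ) : volume {y | f y = t} = 0 := by
  refine measure_mono_null (t := frontier {y | f y ≤ t}) (fun y hy => ?_) ?_
  · refine ⟨subset_closure (le_of_eq hy), fun hint => ?_⟩
    obtain ⟨ρ, hρ, hball⟩ := Metric.isOpen_iff.1 isOpen_interior y hint
    set d : EuclideanSpace ℝ (Fin k) := (ρ / 2) • EuclideanSpace.single ⟨0, hk⟩ 1 with hd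
    have hdn : ‖d‖ = ρ / 2 := by
      rw [hd, norm_smul, PiLp.norm_single, norm_one, mul_one,
        Real.norm_of_nonneg (by positivity)]
    have hd0 : d ≠ 0 := norm_pos_iff.1 (by rw [hdn]; positivity)
    have hsub : ∀ x ∈ Metric.ball y ρ, f x ≤ t := fun x hx =>
      interior_subset (s := {y | f y ≤ t}) (hball hx)
    have h1 : f (y + d) ≤ t := hsub _ (by
      rw [Metric.mem_ball, dist_eq_norm, add_sub_cancel_left, hdn]; linarith)
    have h2 : f (y - d) ≤ t := hsub _ (by
      rw [Metric.mem_ball, dist_eq_norm, sub_sub_cancel_left, norm_neg, hdn]; linarith)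
    have hne : y + d ≠ y - d := by
      intro h
      have h3 : (2 : ℝ) • d = 0 := by
        rw [two_smul]
        have := sub_eq_zero.2 h
        rwa [add_sub_sub_cancel] at this
      exact hd0 ((smul_eq_zero.1 h3).resolve_left two_ne_zero)
    have h3 := hf.2 (mem_univ (y + d)) (mem_univ (y - d)) hne (by norm_num : (0 : ℝ) < 1 / 2)
      (by norm_num : (0 : ℝ) < 1 / 2) (by norm_num)
    have h4 : (1 / 2 : ℝ) • (y + d) + (1 / 2 : ℝ) • (y - d) = y := by module
    have h5 : f y = t := hy
    rw [h4, h5] at h3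
    simp only [smul_eq_mul] at h3
    linarith
  · have hc : Convex ℝ {y | f y ≤ t} := by
      simpa using hf.convexOn.convex_le t
    exact hc.addHaar_frontier volume

/-- The properties of the affine gap `w` of the Perron solution used in the supersolution argument.
At each zero `y` of `w` the translate `w (y + ·)` is again an affine gap, with the same bounds. -/
structure IsConicGap {n : ℕ} (w : EuclideanSpace ℝ (Fin n) → ℝ) (a R C M : ℝ) : Prop where
  continuous : Continuous w
  convex : ConvexOn ℝ univ w
  nonneg : ∀ y, 0 ≤ w y
  a_pos : 0 < a
  one_le : 1 ≤ R
  C_nonneg : 0 ≤ C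
  M_nonneg : 0 ≤ M
  lipschitz : ∀ x y, w x ≤ w y + M * ‖x - y‖
  coercive : ∀ y, w y = 0 → ∀ h, R ≤ ‖h‖ → a * ‖h‖ ≤ w (y + h)
  quad : ∀ y, w y = 0 → ∀ h, w (y + h) ≤ C * quadLin h

namespace IsConicGap

variable {n k : ℕ} {s : ℝ} {w : EuclideanSpace ℝ (Fin n) → ℝ} {a R C M : ℝ}

theorem convex_zero (G : IsConicGap w a R C M) : Convex ℝ {y | w y = 0} := by
  have h : {y | w y = 0} = {y | w y ≤ 0} := by
    ext y
    exact ⟨le_of_eq, fun h => le_antisymm h (G.nonneg y)⟩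
  rw [h]
  simpa using G.convex.convex_le 0

theorem isCompact_zero (G : IsConicGap w a R C M) : IsCompact {y | w y = 0} := by
  refine Metric.isCompact_of_isClosed_isBounded (isClosed_eq G.continuous continuous_const) ?_
  rcases Set.eq_empty_or_nonempty {y | w y = 0} with h | ⟨y₀, hy₀⟩
  · rw [h]; exact Bornology.isBounded_empty
  · refine (Metric.isBounded_closedBall (x := y₀) (r := R)).subset fun y hy => ?_
    rw [Metric.mem_closedBall, dist_eq_norm]
    by_contra! hR
    have h1 := G.coercive y₀ hy₀ (y - y₀) hR.le
    rw [add_sub_cancel, show w y = 0 from hy] at h1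
    have h2 : 0 < ‖y - y₀‖ := by linarith [G.one_le]
    nlinarith [G.a_pos]

theorem kernelValue_ne_top (G : IsConicGap w a R C M) (hk : 1 ≤ k) (hkn : k < n) (hs : 1 / 2 < s)
    (hs' : s < 1) {y : EuclideanSpace ℝ (Fin n)} (hy : w y = 0) :
    kernelValue n k s (fun h => w (y + h)) ≠ ⊤ := by
  refine ENNReal.mul_ne_top ENNReal.ofReal_ne_top (ne_top_of_le_ne_top ?_
    (kernelInf_le_const hk hkn.le (by linarith) G.C_nonneg (G.quad y hy)))
  exact ENNReal.mul_ne_top ENNReal.ofReal_ne_top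
    (lintegral_quadLin_mul_fracKernel_lt_top (by omega) hs hs').ne

theorem exists_kernelValue_le_add_of_near (G : IsConicGap w a R C M) (hk : 1 ≤ k) (hkn : k < n)
    (hs : 1 / 2 < s) (hs' : s < 1) {y : EuclideanSpace ℝ (Fin n)} (hy : w y = 0) {τ : ℝ}
    (hτ : 0 < τ) : ∃ δ > 0, ∀ y', w y' = 0 → dist y' y < δ →
      kernelValue n k s (fun h => w (y' + h)) ≤
        kernelValue n k s (fun h => w (y + h)) + ENNReal.ofReal τ := by
  obtain ⟨η, hη, h⟩ := exists_kernelValue_le_add hk hkn hs hs' G.a_pos G.one_le G.C_nonneg hτ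
  have hM := G.M_nonneg
  refine ⟨η / (M + 1), by positivity, fun y' hy' hd => h _ _
    (G.continuous.comp (by fun_prop)).measurable (fun x => G.nonneg _) (G.coercive y hy)
    (G.quad y' hy') fun x => ?_⟩
  have h1 := G.lipschitz (y' + x) (y + x)
  rw [add_sub_add_right_eq_sub, ← dist_eq_norm] at h1
  rw [lt_div_iff₀ (by positivity)] at hd
  nlinarith [norm_nonneg x, dist_nonneg (x := y') (y := y)]

/-- Midpoint convexity of the operator along the zero set, by rearrangement. The auxiliary term
`ε (bracket - 1)` makes the sublevel sets of the gap bounded and its level sets negligible. -/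
theorem two_mul_kernelValue_midpoint_le (G : IsConicGap w a R C M) (hk : 1 ≤ k) (hkn : k < n)
    (hs : 1 / 2 < s) (hs' : s < 1) {y₁ y₂ : EuclideanSpace ℝ (Fin n)} (h₁ : w y₁ = 0)
    (h₂ : w y₂ = 0) :
    2 * kernelValue n k s (fun h => w ((2⁻¹ : ℝ) • (y₁ + y₂) + h)) ≤
      kernelValue n k s (fun h => w (y₁ + h)) + kernelValue n k s (fun h => w (y₂ + h)) := by
  refine ENNReal.le_of_forall_pos_le_add fun τ' hτ' _ => ?_
  obtain ⟨τ, hτ, hττ⟩ : ∃ τ : ℝ, 0 < τ ∧ (τ' : ℝ≥0∞) = ENNReal.ofReal τ := ⟨τ', hτ', by simp⟩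
  rw [hττ]
  have hC := G.C_nonneg
  obtain ⟨η, hη, hstab⟩ := exists_kernelValue_le_add (C := C + 2) hk hkn hs hs' G.a_pos G.one_le
    (by positivity) (half_pos hτ)
  set m := (2⁻¹ : ℝ) • (y₁ + y₂) with hm
  set ε := min η 1 with hε
  have hε0 : 0 < ε := by positivity
  have hεη : ε ≤ η := min_le_left _ _
  have hε1 : ε ≤ 1 := min_le_right _ _
  set N : EuclideanSpace ℝ (Fin n) → ℝ := fun h => ε * (bracket h - 1) with hN
  have hN0 : ∀ h, 0 ≤ N h := fun h => mul_nonneg hε0.le (by linarith [one_le_bracket h])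
  have hNq : ∀ h, N h ≤ 2 * quadLin h := by
    intro h
    have h1 := affineGap_bracket_le 0 h
    unfold affineGap at h1
    rw [smul_zero, inner_zero_right, zero_add, bracket_zero, sub_zero] at h1
    have := one_le_bracket h
    simp only [hN]
    nlinarith
  have hNn : ∀ h, N h ≤ η * (1 + ‖h‖) := by
    intro h
    have h1 := (abs_le.1 (abs_bracket_sub_le 0 h)).2
    rw [zero_add, bracket_zero] at h1
    have := one_le_bracket h
    simp only [hN]
    nlinarith [norm_nonneg h]
  have hNc : Continuous N := by
    have := continuous_bracket (n := n)
    fun_prop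
  have hNs : StrictConvexOn ℝ univ N := by
    refine ⟨convex_univ, fun x _ y _ hxy a b ha hb hab => ?_⟩
    have h1 := strictConvexOn_bracket.2 (mem_univ x) (mem_univ y) hxy ha hb hab
    simp only [hN, smul_eq_mul] at *
    have hb' : b = 1 - a := by linarith
    subst hb'
    nlinarith
  have hwc : ∀ y, Continuous fun h => w (y + h) := fun y => G.continuous.comp (by fun_prop)
  have hstab' : ∀ y, w y = 0 → kernelValue n k s (fun h => w (y + h) + N h) ≤
      kernelValue n k s (fun h => w (y + h)) + ENNReal.ofReal (τ / 2) := fun y hy =>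
    hstab _ _ (hwc y).measurable (fun x => G.nonneg _) (G.coercive y hy)
      (fun x => by linarith [G.quad y hy x, hNq x]) fun x => by linarith [hNn x]
  have hWs : StrictConvexOn ℝ univ fun h => w (m + h) + N h := by
    refine ⟨convex_univ, fun x _ y _ hxy a b ha hb hab => ?_⟩
    have h1 := hNs.2 (mem_univ x) (mem_univ y) hxy ha hb hab
    have h2 := G.convex.2 (mem_univ (m + x)) (mem_univ (m + y)) ha.le hb.le hab
    have h3 : a • (m + x) + b • (m + y) = m + (a • x + b • y) := by
      have h4 : m = a • m + b • m := by rw [← add_smul, hab, one_smul]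
      nth_rewrite 3 [h4]
      rw [smul_add, smul_add]; abel
    rw [h3] at h2
    simp only [smul_eq_mul] at *
    linarith
  have key : 2 * kernelInf n k s (fun h => w (m + h) + N h) ≤
      kernelInf n k s (fun h => w (y₁ + h) + N h) +
        kernelInf n k s (fun h => w (y₂ + h) + N h) := by
    refine two_mul_kernelInf_le hk hkn (by linarith) ((hwc m).add hNc).measurable
      ((hwc y₁).add hNc).measurable ((hwc y₂).add hNc).measurable
      (fun x => add_nonneg (G.nonneg _) (hN0 x)) (fun z t => ?_) (fun z t => ?_) fun p q => ?_
    · refine ((measure_mono (t := Metric.closedBall 0 (t / ε + 1)) fun y hy => ?_).trans_lt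
        measure_closedBall_lt_top)
      have hy' : w (m + joinCoords y z) + N (joinCoords y z) < t := hy
      have h1 := norm_le_norm_joinCoords hkn.le y z
      have h2 := norm_le_bracket (joinCoords (n := n) y z)
      have h3 := G.nonneg (m + joinCoords y z)
      have h4 : (‖y‖ - 1) * ε ≤ t := by
        simp only [hN] at hy'
        nlinarith
      rw [mem_closedBall_zero_iff]
      rw [← le_div_iff₀ hε0] at h4
      linarith
    · refine StrictConvexOn.volume_eq_const hk (f := fun y => w (m + joinCoords y z) +
        N (joinCoords y z)) ⟨convex_univ, fun y _ y' _ hne a b ha hb hab => ?_⟩ t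
      beta_reduce
      rw [joinCoords_combo y y' z hab]
      exact hWs.2 (mem_univ _) (mem_univ _) ((joinCoords_injective_left hkn.le z).ne hne) ha hb hab
    · have h1 := hNs.convexOn.2 (mem_univ p) (mem_univ q) (by norm_num : (0 : ℝ) ≤ 2⁻¹)
        (by norm_num : (0 : ℝ) ≤ 2⁻¹) (by norm_num)
      have h2 := G.convex.2 (mem_univ (y₁ + p)) (mem_univ (y₂ + q)) (by norm_num : (0 : ℝ) ≤ 2⁻¹)
        (by norm_num : (0 : ℝ) ≤ 2⁻¹) (by norm_num)
      have h3 : (2⁻¹ : ℝ) • (y₁ + p) + (2⁻¹ : ℝ) • (y₂ + q) = m + (2⁻¹ : ℝ) • (p + q) := by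
        rw [hm]; module
      rw [h3] at h2
      rw [← smul_add] at h1
      simp only [smul_eq_mul] at *
      linarith
  have h0 : kernelValue n k s (fun h => w (m + h)) ≤
      kernelValue n k s (fun h => w (m + h) + N h) :=
    mul_le_mul_right (kernelInf_mono fun h => by linarith [hN0 h]) _
  calc 2 * kernelValue n k s (fun h => w (m + h))
      ≤ 2 * kernelValue n k s (fun h => w (m + h) + N h) := by gcongr
    _ ≤ kernelValue n k s (fun h => w (y₁ + h) + N h) +
        kernelValue n k s (fun h => w (y₂ + h) + N h) := by
      unfold kernelValue
      rw [mul_left_comm, ← mul_add]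
      exact mul_le_mul_right key _
    _ ≤ (kernelValue n k s (fun h => w (y₁ + h)) + ENNReal.ofReal (τ / 2)) +
        (kernelValue n k s (fun h => w (y₂ + h)) + ENNReal.ofReal (τ / 2)) :=
      add_le_add (hstab' y₁ h₁) (hstab' y₂ h₂)
    _ = kernelValue n k s (fun h => w (y₁ + h)) + kernelValue n k s (fun h => w (y₂ + h)) +
        ENNReal.ofReal τ := by
      rw [add_add_add_comm, ← ENNReal.ofReal_add (by positivity) (by positivity), add_halves]

/-- A maximum over the zero set of the value of the operator minus a strictly concave function is
attained at an extreme point. -/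
theorem exists_extremePoint_max (G : IsConicGap w a R C M) (hk : 1 ≤ k) (hkn : k < n)
    (hs : 1 / 2 < s) (hs' : s < 1) (h0 : w 0 = 0) {g : EuclideanSpace ℝ (Fin n) → ℝ}
    (hg : Continuous g) (hgs : ∀ y₁ y₂, w y₁ = 0 → w y₂ = 0 → y₁ ≠ y₂ →
      g y₁ + g y₂ < 2 * g ((2⁻¹ : ℝ) • (y₁ + y₂))) :
    ∃ e ∈ {y | w y = 0}.extremePoints ℝ, ∀ y, w y = 0 →
      (kernelValue n k s (fun h => w (y + h))).toReal - g y ≤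
        (kernelValue n k s (fun h => w (e + h))).toReal - g e := by
  set K : EuclideanSpace ℝ (Fin n) → ℝ :=
    fun y => (kernelValue n k s (fun h => w (y + h))).toReal with hK
  have hfin : ∀ y, w y = 0 → kernelValue n k s (fun h => w (y + h)) ≠ ⊤ := fun y hy =>
    G.kernelValue_ne_top hk hkn hs hs' hy
  have husc : UpperSemicontinuousOn (fun y => K y - g y) {y | w y = 0} := by
    intro y hy c hc
    set τ := (c - (K y - g y)) / 2 with hτ
    have hτ0 : 0 < τ := by rw [hτ]; linarith
    obtain ⟨δ, hδ, h1⟩ := G.exists_kernelValue_le_add_of_near hk hkn hs hs' hy hτ0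
    obtain ⟨δ', hδ', h2⟩ := Metric.continuous_iff.1 hg y τ hτ0
    filter_upwards [inter_mem_nhdsWithin _ (Metric.ball_mem_nhds y (lt_min hδ hδ'))] with y' hy'
    have h3 := h1 y' hy'.1 (hy'.2.trans_le (min_le_left _ _))
    have h4 := (abs_lt.1 (h2 y' (hy'.2.trans_le (min_le_right _ _)))).1
    have h5 := ENNReal.toReal_mono (by simp [hfin y hy]) h3
    rw [ENNReal.toReal_add (hfin y hy) ENNReal.ofReal_ne_top, ENNReal.toReal_ofReal hτ0.le] at h5
    simp only [hK] at *
    linarith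
  obtain ⟨e, he, hmax⟩ := husc.exists_isMaxOn (s := {y | w y = 0}) ⟨0, h0⟩ G.isCompact_zero
  refine ⟨e, ⟨he, fun y₁ hy₁ y₂ hy₂ hseg => ?_⟩, fun y hy => hmax hy⟩
  obtain ⟨a, b, ha, hb, hab, rfl⟩ := hseg
  by_contra hne1
  have hne : y₁ ≠ y₂ := by
    rintro rfl
    rw [← add_smul, hab, one_smul] at hne1
    exact hne1 rfl
  -- A nontrivial segment inside the zero set, centred at the maximum point.
  set t := min a b with ht
  have ht0 : 0 < t := lt_min ha hb
  have hta : t ≤ a := min_le_left _ _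
  have htb : t ≤ b := min_le_right _ _
  set z₁ := (a - t) • y₁ + (b + t) • y₂ with hz₁
  set z₂ := (a + t) • y₁ + (b - t) • y₂ with hz₂
  have m₁ : w z₁ = 0 := G.convex_zero hy₁ hy₂ (by linarith) (by linarith) (by linarith)
  have m₂ : w z₂ = 0 := G.convex_zero hy₁ hy₂ (by linarith) (by linarith) (by linarith)
  have hzz : (2⁻¹ : ℝ) • (z₁ + z₂) = a • y₁ + b • y₂ := by rw [hz₁, hz₂]; module
  have hzne : z₁ ≠ z₂ := by
    intro h
    have h1 : (2 * t) • (y₁ - y₂) = 0 := by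
      rw [← sub_eq_zero.2 h.symm, hz₁, hz₂]; module
    rcases smul_eq_zero.1 h1 with h2 | h2
    · linarith
    · exact hne (sub_eq_zero.1 h2)
  have h1 := G.two_mul_kernelValue_midpoint_le hk hkn hs hs' m₁ m₂
  have h2 := hgs z₁ z₂ m₁ m₂ hzne
  rw [hzz] at h1 h2
  have h3 := ENNReal.toReal_mono (ENNReal.add_ne_top.2 ⟨hfin _ m₁, hfin _ m₂⟩) h1
  rw [ENNReal.toReal_add (hfin _ m₁) (hfin _ m₂), ENNReal.toReal_mul, ENNReal.toReal_ofNat] at h3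
  have h4 := hmax m₁
  have h5 := hmax m₂
  simp only [hK, mem_ofPred_eq] at *
  linarith

/-- Small affine functions which exceed the gap only near a given extreme point of its zero set. -/
theorem exists_affine_cap (G : IsConicGap w a R C M) {e : EuclideanSpace ℝ (Fin n)}
    (he : e ∈ {y | w y = 0}.extremePoints ℝ) {ρ σ : ℝ} (hρ : 0 < ρ) (hσ : 0 < σ) :
    ∃ (b : EuclideanSpace ℝ (Fin n)) (β : ℝ), ‖b‖ ≤ σ ∧ |β| ≤ σ ∧ 0 < inner ℝ e b - β ∧
      ∀ y, w y < inner ℝ y b - β → dist y e < ρ := by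
  obtain ⟨b, β, hβ, hslice⟩ :=
    exists_slice_of_mem_extremePoints G.isCompact_zero G.convex_zero he hρ
  have he0 : w e = 0 := he.1
  set S : Set (EuclideanSpace ℝ (Fin n)) :=
    (Metric.closedBall e R \ Metric.ball e ρ) ∩ {y | β ≤ inner ℝ y b} with hS
  have hSc : IsCompact S := ((isCompact_closedBall e R).diff Metric.isOpen_ball).inter_right
    (isClosed_le continuous_const (by fun_prop))
  obtain ⟨μ, hμ, hμS⟩ := hSc.exists_forall_le' (a := 0) G.continuous.continuousOn fun y hy => by
    refine lt_of_le_of_ne (G.nonneg y) fun h => hy.1.2 ?_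
    exact hslice y h.symm hy.2
  set N := ‖b‖ + |β| + 1 with hN
  have hN0 : 0 < N := by positivity
  have hR := G.one_le
  have ha := G.a_pos
  set Q := (‖e‖ + R + 1) * N with hQ
  have hQ0 : 0 < Q := by positivity
  set τ := min (σ / N) (min (μ / Q) (a / Q)) with hτ
  have hτ0 : 0 < τ := by positivity
  have hτσ : τ * N ≤ σ := (le_div_iff₀ hN0).1 (min_le_left _ _)
  have hτμ : τ * Q ≤ μ := (le_div_iff₀ hQ0).1 ((min_le_right _ _).trans (min_le_left _ _))
  have hτa : τ * Q ≤ a := (le_div_iff₀ hQ0).1 ((min_le_right _ _).trans (min_le_right _ _))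
  have hbN : ‖b‖ ≤ N := by rw [hN]; linarith [abs_nonneg β]
  have hβN : |β| ≤ N := by rw [hN]; linarith [norm_nonneg b]
  refine ⟨τ • b, τ * β, ?_, ?_, ?_, fun y hy => ?_⟩
  · rw [norm_smul, Real.norm_of_nonneg hτ0.le]
    exact (mul_le_mul_of_nonneg_left hbN hτ0.le).trans hτσ
  · rw [abs_mul, abs_of_pos hτ0]
    exact (mul_le_mul_of_nonneg_left hβN hτ0.le).trans hτσ
  · rw [inner_smul_right, ← mul_sub]
    exact mul_pos hτ0 (sub_pos.2 hβ)
  · rw [inner_smul_right, ← mul_sub] at hy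
    by_contra! hfar
    have hq : inner ℝ y b - β ≤ (‖y‖ + 1) * N := by
      have h1 := (abs_le.1 (abs_real_inner_le_norm y b)).2
      have h2 := neg_abs_le β
      have h3 : ‖y‖ * ‖b‖ ≤ ‖y‖ * N := by gcongr
      linarith
    have hyn : ‖y‖ ≤ ‖e‖ + ‖y - e‖ := by
      simpa using norm_add_le e (y - e)
    rcases le_or_gt R ‖y - e‖ with h | h
    · have h1 := G.coercive e he0 (y - e) h
      rw [add_sub_cancel] at h1
      have h2 : (‖y‖ + 1) * N ≤ Q * ‖y - e‖ := by
        have h3 : ‖y‖ + 1 ≤ (‖e‖ + R + 1) * ‖y - e‖ := by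
          nlinarith [norm_nonneg e]
        calc (‖y‖ + 1) * N ≤ (‖e‖ + R + 1) * ‖y - e‖ * N := by gcongr
          _ = Q * ‖y - e‖ := by rw [hQ]; ring
      have h4 : τ * (inner ℝ y b - β) ≤ τ * (Q * ‖y - e‖) := by gcongr; linarith
      have h5 : τ * Q * ‖y - e‖ ≤ a * ‖y - e‖ := by gcongr
      linarith
    · have hpos : 0 ≤ inner ℝ y b - β := by
        by_contra! hneg
        have := mul_neg_of_pos_of_neg hτ0 hneg
        linarith [G.nonneg y]
      have h1 := hμS y ⟨⟨by rw [Metric.mem_closedBall, dist_eq_norm]; exact h.le, by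
        rw [Metric.mem_ball, not_lt]; exact hfar⟩, by
          rw [mem_ofPred_eq]; linarith⟩
      have h2 : (‖y‖ + 1) * N ≤ Q := by rw [hQ]; gcongr; linarith
      have h4 : τ * (inner ℝ y b - β) ≤ τ * Q := by gcongr; linarith
      linarith

end IsConicGap

/-! ### The Perron solution is a supersolution -/

namespace IsConicDatum

variable {n k : ℕ} {s : ℝ} {φ ψ : EuclideanSpace ℝ (Fin n) → ℝ} {L A : ℝ}

theorem exists_isConicGap (H : IsConicDatum k s φ ψ L A) {x p : EuclideanSpace ℝ (Fin n)}
    (hp : p ∈ subdifferentialAt (perronSolution k s φ) x) :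
    ∃ a R C M, IsConicGap (affineGap (perronSolution k s φ) x p) a R C M := by
  obtain ⟨a, ha, R, hR, hcoer⟩ := H.exists_coercive hp
  obtain ⟨B, hB0, hB⟩ := H.exists_growth_perronSolution
  have huc := H.continuous_perronSolution
  have huv := H.convexOn_perronSolution
  have hL := H.second_perronSolution
  have hL0 := H.L_nonneg
  set u := perronSolution k s φ with hu
  refine ⟨a / 2, 3 * R, max (L / 2) (2 * B), 2 * B, continuous_affineGap huc x p,
    convexOn_affineGap huv x p, affineGap_nonneg hp, half_pos ha, by linarith,
    le_max_of_le_left (by positivity), by positivity, fun y z => ?_, fun y hy h hh => ?_,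
    fun y hy h => ?_⟩
  · have h1 := (abs_le.1 (abs_sub_le_of_growth huc huv hB hB0 (x + y) (x + z))).2
    rw [add_sub_add_left_eq_sub] at h1
    have h2 := (abs_le.1 (abs_real_inner_le_norm (y - z) p)).1
    have h3 : ‖y - z‖ * ‖p‖ ≤ ‖y - z‖ * B := by
      gcongr
      exact norm_le_of_mem_subdifferentialAt hB hp hB0
    rw [inner_sub_left] at h2
    unfold affineGap
    linarith
  · have hyR : ‖y‖ < R := by
      by_contra! hyR
      have h1 := hcoer y hyR
      rw [hy] at h1
      have : 0 < ‖y‖ := by linarith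
      nlinarith
    have h1 : ‖h‖ ≤ ‖y + h‖ + ‖y‖ := by
      simpa using norm_sub_le (y + h) y
    have h2 := hcoer (y + h) (by linarith)
    nlinarith
  · have h1 : u (x + y) = u x + inner ℝ y p := by
      unfold affineGap at hy
      linarith
    have h2 : ∀ z, affineGap u (x + y) p z = affineGap u x p (y + z) := by
      intro z
      unfold affineGap
      rw [h1, inner_add_left, add_assoc]
      ring
    have h3 : p ∈ subdifferentialAt u (x + y) := by
      rw [mem_subdifferentialAt_iff]
      intro z
      have h4 := affineGap_nonneg hp (y + z)
      rw [← h2 z] at h4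
      unfold affineGap at h4
      linarith
    rw [← h2]
    exact affineGap_le_quadLin huc huv hL hB hB0 h3 h

/-- If the Perron solution were not a supersolution at `x₀`, it would fail to be one, by the largest
amount, at an extreme point of the set where it agrees with its tangent plane at `x₀`. Near that
point it could be raised to a slightly tilted plane and remain a subsolution. -/
theorem isSupersolution_perronSolution (H : IsConicDatum k s φ ψ L A) :
    IsSupersolution k s φ (perronSolution k s φ) := by
  have hsub := H.isSubsolution_perronSolution
  have hle : ∀ v ∈ subsolutionClass k s φ, ∀ x, v x ≤ perronSolution k s φ x :=
    fun v hv => H.le_perronSolution hv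
  have hφu := H.self_le_perronSolution
  have hlim := H.tendsto_perronSolution_sub
  have hL := H.second_perronSolution
  have hgap := fun x p => H.exists_isConicGap (x := x) (p := p)
  set u := perronSolution k s φ with hu
  have huc : Continuous u := hsub.1
  have huv : ConvexOn ℝ univ u := hsub.2.1
  refine ⟨huc, huv, fun x₀ => ?_⟩
  rw [EReal.coe_ennreal_le_coe_iff]
  refine ⟨?_, sub_nonneg.2 (hφu x₀)⟩
  by_contra! hcon
  obtain ⟨p₀, hp₀⟩ := subdifferentialAt_nonempty huc huv x₀
  obtain ⟨a, R, C, M, G⟩ := hgap x₀ p₀ hp₀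
  rw [hL.nonlocalOp_eq_kernelValue hp₀] at hcon
  set w := affineGap u x₀ p₀ with hw
  have hw0 : w 0 = 0 := affineGap_zero _ _ _
  have huw : ∀ y, u (x₀ + y) = u x₀ + inner ℝ y p₀ + w y := fun y => by
    simp only [hw, affineGap]; ring
  set g : EuclideanSpace ℝ (Fin n) → ℝ := fun y => u (x₀ + y) - φ (x₀ + y) with hg
  have hgc : Continuous g := by
    have := H.continuous
    fun_prop
  have hgs : ∀ y₁ y₂, w y₁ = 0 → w y₂ = 0 → y₁ ≠ y₂ →
      g y₁ + g y₂ < 2 * g ((2⁻¹ : ℝ) • (y₁ + y₂)) := by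
    intro y₁ y₂ h₁ h₂ hne
    have h3 := H.strictConvex.2 (mem_univ (x₀ + y₁)) (mem_univ (x₀ + y₂))
      (fun h => hne (add_left_cancel h)) (by norm_num : (0 : ℝ) < 2⁻¹)
      (by norm_num : (0 : ℝ) < 2⁻¹) (by norm_num)
    have h4 : (2⁻¹ : ℝ) • (x₀ + y₁) + (2⁻¹ : ℝ) • (x₀ + y₂) = x₀ + (2⁻¹ : ℝ) • (y₁ + y₂) := by
      module
    have h5 := G.nonneg ((2⁻¹ : ℝ) • (y₁ + y₂))
    rw [h4] at h3
    simp only [hg, huw, h₁, h₂, inner_smul_left, inner_add_left, RCLike.conj_to_real,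
      smul_eq_mul] at *
    linarith
  obtain ⟨e, he, hmax⟩ := G.exists_extremePoint_max H.one_le H.lt H.half_lt H.lt_one hw0 hgc hgs
  have hwe : w e = 0 := he.1
  set E := kernelValue n k s (fun h => w (e + h)) with hE
  have hEtop : E ≠ ⊤ := G.kernelValue_ne_top H.one_le H.lt H.half_lt H.lt_one hwe
  set γ := E.toReal - g e with hγ
  have hγ0 : 0 < γ := by
    refine lt_of_lt_of_le ?_ (hmax 0 hw0)
    have hfin := G.kernelValue_ne_top H.one_le H.lt H.half_lt H.lt_one hw0
    simp only [zero_add, hg, add_zero] at hfin ⊢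
    rw [ENNReal.ofReal_lt_iff_lt_toReal (sub_nonneg.2 (hφu x₀)) hfin] at hcon
    linarith
  have hge0 : 0 ≤ g e := sub_nonneg.2 (hφu _)
  have hEγ : E = ENNReal.ofReal (g e + γ) := by
    rw [hγ, add_sub_cancel, ENNReal.ofReal_toReal hEtop]
  have ha := G.a_pos
  have hR := G.one_le
  have hM := G.M_nonneg
  obtain ⟨η, hη, hstab⟩ := exists_kernelValue_le_add (s := s) H.one_le H.lt H.half_lt H.lt_one
    (half_pos ha) hR G.C_nonneg (show 0 < γ / 4 by positivity)
  set η' := min η (a / 2) with hη'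
  have hη'0 : 0 < η' := by positivity
  have hη'1 : η' ≤ η := min_le_left _ _
  have hη'2 : η' ≤ a / 2 := min_le_right _ _
  -- Near `e`, the tangent plane at `x₀` exceeds `φ` by little more than it does at `e`.
  have hℓ : Continuous fun y => u x₀ + inner ℝ y p₀ - φ (x₀ + y) := by
    have := H.continuous
    fun_prop
  obtain ⟨ρ₁, hρ₁, hρ₁f⟩ := Metric.continuous_iff.1 hℓ e (γ / 4) (by positivity)
  set ρ := min 1 (min ρ₁ (η' / (2 * (M + 1)))) with hρ
  have hρ0 : 0 < ρ := by positivity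
  have hρ1 : ρ ≤ 1 := min_le_left _ _
  have hρρ : ρ ≤ ρ₁ := (min_le_right _ _).trans (min_le_left _ _)
  have hρM : M * ρ ≤ η' / 2 := by
    have h1 : ρ ≤ η' / (2 * (M + 1)) := (min_le_right _ _).trans (min_le_right _ _)
    rw [le_div_iff₀ (by positivity)] at h1
    linarith
  set σ := min (η' / (2 * (‖e‖ + 3))) (γ / (4 * (‖e‖ + 3))) with hσ
  have hσ0 : 0 < σ := by positivity
  have hση : σ * (‖e‖ + 3) ≤ η' / 2 := by
    have h1 : σ ≤ η' / (2 * (‖e‖ + 3)) := min_le_left _ _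
    rw [le_div_iff₀ (by positivity)] at h1
    linarith
  have hσγ : σ * (‖e‖ + 3) ≤ γ / 4 := by
    have h1 : σ ≤ γ / (4 * (‖e‖ + 3)) := min_le_right _ _
    rw [le_div_iff₀ (by positivity)] at h1
    linarith
  obtain ⟨b, β, hb, hβ, hbe, hcap⟩ := G.exists_affine_cap he hρ0 hσ0
  set q : EuclideanSpace ℝ (Fin n) → ℝ := fun y => inner ℝ y b - β with hq
  have hqn : ∀ y, q y ≤ σ * (‖y‖ + 1) := by
    intro y
    have h1 := (abs_le.1 (abs_real_inner_le_norm y b)).2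
    have h2 := neg_abs_le β
    have h3 : ‖y‖ * ‖b‖ ≤ ‖y‖ * σ := by gcongr
    simp only [hq]; linarith
  set v : EuclideanSpace ℝ (Fin n) → ℝ :=
    fun x => max (u x) (u x₀ + inner ℝ (x - x₀) p₀ + q (x - x₀)) with hv
  have hvw : ∀ y, v (x₀ + y) = u x₀ + inner ℝ y p₀ + max (w y) (q y) := by
    intro y
    simp only [hv, add_sub_cancel_left]
    rw [huw, max_add_add_left]
  have huv' : ∀ x, u x ≤ v x := fun x => le_max_left _ _
  have hvmem : v ∈ subsolutionClass k s φ := by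
    refine ⟨⟨?_, ?_, fun x => ?_⟩, fun ε hε => ?_⟩
    · simp only [hv, hq]
      fun_prop
    · refine huv.sup ⟨convex_univ, fun x _ y _ t₁ t₂ _ _ ht => le_of_eq ?_⟩
      have ht' : t₂ = 1 - t₁ := by linarith
      subst ht'
      simp only [hq, inner_sub_left, inner_add_left, inner_smul_left, RCLike.conj_to_real,
        smul_eq_mul]
      ring
    · rw [EReal.coe_le_coe_ennreal_iff]
      obtain ⟨y, rfl⟩ : ∃ y, x = x₀ + y := ⟨x - x₀, by abel⟩
      rcases le_or_gt (q y) (w y) with hqw | hqw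
      · have h1 : v (x₀ + y) = u (x₀ + y) := by rw [hvw, max_eq_left hqw, huw]
        rw [h1]
        refine (EReal.coe_le_coe_ennreal_iff.1 (hsub.2.2 (x₀ + y))).trans
          (nonlocalOp_mono_of_touch fun z => ?_)
        rw [h1]
        linarith [huv' z]
      · have hyρ := hcap y hqw
        rw [dist_eq_norm] at hyρ
        have hye : ‖y‖ ≤ ‖e‖ + 1 := by
          have : ‖y‖ ≤ ‖e‖ + ‖y - e‖ := by simpa using norm_add_le e (y - e)
          linarith
        have hvy : v (x₀ + y) = u x₀ + inner ℝ y p₀ + q y := by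
          rw [hvw, max_eq_right hqw.le]
        set W : EuclideanSpace ℝ (Fin n) → ℝ := fun h => max (w (y + h) - q (y + h)) 0 with hW
        have hvgap : ∀ h, affineGap v (x₀ + y) (p₀ + b) h = W h := by
          intro h
          unfold affineGap
          rw [hvy, add_assoc x₀ y h, hvw]
          have h1 : max (w (y + h)) (q (y + h)) = W h + q (y + h) := by
            simp only [hW]
            rw [max_add, sub_add_cancel, zero_add]
          rw [h1]
          simp only [hq, inner_add_left, inner_add_right]
          ring
        have hpv : p₀ + b ∈ subdifferentialAt v (x₀ + y) := by
          rw [mem_subdifferentialAt_iff]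
          intro h
          have h1 : 0 ≤ W h := le_max_right _ _
          rw [← hvgap h] at h1
          unfold affineGap at h1
          linarith
        have hop : kernelValue n k s W ≤ nonlocalOp k s v (x₀ + y) := by
          have h1 : W = affineGap v (x₀ + y) (p₀ + b) := funext fun h => (hvgap h).symm
          rw [nonlocalOp_eq, h1]
          exact mul_le_mul_right (le_iSup₂
            (f := fun p _ => kernelInf n k s (affineGap v (x₀ + y) p)) _ hpv) _
        -- The gap of `u` at `x₀ + e` is controlled by that of `v`, up to `η'`.
        have hlow : ∀ h, w (e + h) ≤ W h + η' * (1 + ‖h‖) ∧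
            w (e + h) ≤ W h + (M * ρ + σ * (‖e‖ + 2 + ‖h‖)) := by
          intro h
          have h1 := G.lipschitz (e + h) (y + h)
          rw [add_sub_add_right_eq_sub, norm_sub_rev] at h1
          have h2 : w (y + h) - q (y + h) ≤ W h := le_max_left _ _
          have h3 := hqn (y + h)
          have h4 : σ * (‖y + h‖ + 1) ≤ σ * (‖e‖ + 2 + ‖h‖) := by
            refine mul_le_mul_of_nonneg_left ?_ hσ0.le
            linarith [norm_add_le y h]
          have h5 : M * ‖y - e‖ ≤ M * ρ := by gcongr
          have h6 : σ * (‖e‖ + 2 + ‖h‖) ≤ σ * (‖e‖ + 3) * (1 + ‖h‖) := by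
            rw [mul_assoc]
            gcongr
            nlinarith [norm_nonneg e, norm_nonneg h]
          have h7 : σ * (‖e‖ + 3) * (1 + ‖h‖) ≤ η' / 2 * (1 + ‖h‖) := by gcongr
          have h8 : 0 ≤ η' / 2 * ‖h‖ := by positivity
          constructor <;> linarith
        have hcoer : ∀ h, R ≤ ‖h‖ → a / 2 * ‖h‖ ≤ W h := by
          intro h hh
          have h1 := G.coercive e hwe h hh
          have h2 := (hlow h).2
          have h3 : M * ρ ≤ M * ρ * ‖h‖ := le_mul_of_one_le_right (by positivity) (by linarith)
          have h4 : σ * (‖e‖ + 2 + ‖h‖) ≤ σ * (‖e‖ + 3) * ‖h‖ := by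
            rw [mul_assoc]
            gcongr
            nlinarith [norm_nonneg e]
          have h5 : σ * (‖e‖ + 3) * ‖h‖ ≤ η' / 2 * ‖h‖ := by gcongr
          have h6 : M * ρ * ‖h‖ ≤ η' / 2 * ‖h‖ := by gcongr
          have h7 : η' * ‖h‖ ≤ a / 2 * ‖h‖ := by gcongr
          linarith
        have hWm : Measurable W := by
          have h1 : Continuous fun h => w (y + h) := G.continuous.comp (by fun_prop)
          have h2 : Continuous fun h => q (y + h) := by
            simp only [hq]
            fun_prop
          exact ((h1.sub h2).max continuous_const).measurable
        have hst := hstab (fun h => w (e + h)) W hWm (fun h => le_max_right _ _) hcoer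
          (G.quad e hwe) fun h => (hlow h).1.trans (by gcongr)
        rw [← hE, hEγ] at hst
        have h1 : v (x₀ + y) - φ (x₀ + y) ≤ g e + γ - γ / 4 := by
          have h2 := hρ₁f y (by rw [dist_eq_norm]; linarith)
          rw [Real.dist_eq] at h2
          have h3 := (abs_lt.1 h2).2
          have h4 := hqn y
          have h5 : σ * (‖y‖ + 1) ≤ σ * (‖e‖ + 3) := by gcongr ?_ * ?_; linarith
          rw [hvy]
          simp only [hg, huw, hwe]
          linarith
        refine (ENNReal.ofReal_le_ofReal h1).trans (le_trans ?_ hop)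
        rw [ENNReal.ofReal_sub _ (by positivity)]
        exact tsub_le_iff_right.2 hst
    · have h1 : ∀ᶠ x in Bornology.cobounded (EuclideanSpace ℝ (Fin n)), ρ ≤ ‖x - (x₀ + e)‖ :=
        (tendsto_norm_cobounded_atTop.comp
          (tendsto_sub_const_cobounded (x₀ + e))).eventually_ge_atTop ρ
      filter_upwards [h1, hlim.eventually (gt_mem_nhds hε)] with x hx hxε
      obtain ⟨y, rfl⟩ : ∃ y, x = x₀ + y := ⟨x - x₀, by abel⟩
      rw [add_sub_add_left_eq_sub, ← dist_eq_norm] at hx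
      have h2 : q y ≤ w y := by
        by_contra! h
        exact (hcap y h).not_ge hx
      rwa [hvw, max_eq_left h2, ← huw]
  have h1 := hle v hvmem (x₀ + e)
  rw [hvw, huw, hwe] at h1
  have h2 : q e ≤ max 0 (q e) := le_max_right _ _
  have h3 : 0 < q e := hbe
  linarith

end IsConicDatum

/-! ### Existence, uniqueness and regularity -/

theorem IsPoissonSolution.le {n k : ℕ} {s : ℝ} {φ u v : EuclideanSpace ℝ (Fin n) → ℝ}
    (hv : IsPoissonSolution k s φ v) (hu : IsPoissonSolution k s φ u)
    (x : EuclideanSpace ℝ (Fin n)) : v x ≤ u x := by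
  refine hv.1.le_of_isSupersolution hu.2.1 (fun ε hε => ?_) x
  have h := hv.2.2.sub hu.2.2
  rw [sub_zero] at h
  filter_upwards [h.eventually (gt_mem_nhds hε)] with y hy
  linarith

theorem theorem6p1 (n k : ℕ) (hk : 1 ≤ k) (hkn : k < n) (s : ℝ) (hs : 1 / 2 < s) (hs' : s < 1)
    (φ ψ : EuclideanSpace ℝ (Fin n) → ℝ)
    (hφ_nonneg : ∀ x, 0 ≤ φ x)
    (hφ_smooth : ContDiff ℝ ((⊤ : ℕ∞) : WithTop ℕ∞) φ)
    (hφ_convex : StrictConvexOn ℝ Set.univ φ)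
    (hψ : IsCone ψ)
    (hφψ : Filter.Tendsto (fun x => φ x - ψ x)
      (Bornology.cobounded (EuclideanSpace ℝ (Fin n))) (nhds 0))
    (hφ_C11 : IsC11 φ) :
    ∃ u : EuclideanSpace ℝ (Fin n) → ℝ,
      IsPoissonSolution k s φ u ∧
      (∀ v : EuclideanSpace ℝ (Fin n) → ℝ, IsPoissonSolution k s φ v → v = u) ∧
      IsC11 u ∧ c11Seminorm u ≤ c11Seminorm φ := by
  have hc : Continuous φ := hφ_smooth.continuous
  obtain ⟨A, hA0, hA⟩ := exists_linear_growth hc hψ hφψ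
  have hdatum : ∀ L : ℝ≥0, LipschitzWith L (gradient φ) → IsConicDatum k s φ ψ L A :=
    fun L hL => ⟨hk, hkn, hs, hs', hc, hφ_convex, L.2,
      hasSecondDifferenceBound_of_lipschitzWith_gradient hφ_C11.1 hL, hA0, hA, hψ, hφψ⟩
  obtain ⟨L, hL⟩ := hφ_C11.2
  have H := hdatum L hL
  have hsol : IsPoissonSolution k s φ (perronSolution k s φ) :=
    ⟨H.isSubsolution_perronSolution, H.isSupersolution_perronSolution,
      H.tendsto_perronSolution_sub⟩
  have hlip : ∀ L : ℝ≥0, LipschitzWith L (gradient φ) →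
      LipschitzWith L (gradient (perronSolution k s φ)) := fun L' hL' =>
    lipschitzWith_gradient_of_secondDifference H.continuous_perronSolution
      H.convexOn_perronSolution (hdatum L' hL').second_perronSolution
  refine ⟨perronSolution k s φ, hsol, fun v hv => funext fun x =>
    le_antisymm (hv.le hsol x) (hsol.le hv x), ⟨fun x => ?_, L, hlip L hL⟩,
    le_iInf₂ fun L' hL' => iInf₂_le L' (hlip L' hL')⟩
  obtain ⟨p, hp⟩ := subdifferentialAt_nonempty H.continuous_perronSolution
    H.convexOn_perronSolution x
  exact (H.second_perronSolution.hasGradientAt hp).differentiableAt
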